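/- Let $G\rightrightarrows M$ be a Lie groupoid with source, range $s,r$, whose unit space $M=G^{(0)}$ is a compact Hausdorff manifold; the arrow manifold $G$ need not be Hausdorff. Let $\{\mu_x\}_{x\in M}$ be a right-invariant Haar system on $G$: Radon measures $\mu_x$ on the source fibres $G_x=s^{-1}(x)$ such that, for all $f\in C_c^\infty(G)$, the function $x\mapsto\int_{G_x}f\,d\mu_x$ is smooth and $\int_{G_{s(\eta)}}f(\gamma)\,d\mu_{s(\eta)}(\gamma)=\int_{G_{r(\eta)}}f(\gamma\eta)\,d\mu_{r(\eta)}(\gamma)$ for every $\eta\in G$. For a $C^*$-algebra $B$, let $C_c(G,B)$ be the linear span of the functions $G\to B$ that are continuous on some Hausdorff open subset of $G$ and vanish outside a compact subset of it ($C_c^\infty(G)$ is defined in the same way with smooth complex-valued functions). It is a $*$-algebra with $$(f*g)(\gamma)=\int_{G_{s(\gamma)}}f(\gamma\gamma_1^{-1})\,g(\gamma_1)\,d\mu_{s(\gamma)}(\gamma_1),\qquad f^*(\gamma)=f(\gamma^{-1})^*.$$ Put $$\|f\|_I=\sup_{x\in M}\max\left\{\int_{G_x}\|f(\gamma)\|\,d\mu_x(\gamma),\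 \int_{G_x}\|f(\gamma^{-1})\|\,d\mu_x(\gamma)\right\}.$$ A $*$-representation $\varphi$ of $C_c(G,B)$ on a Hilbert space is called bounded if $\|\varphi(f)\|\le\|f\|_I$ for all $f$. The full groupoid $C^*$-algebra $C^*(G,B)$ with coefficients in $B$ is the (Hausdorff) completion of $C_c(G,B)$ with respect to $\|f\|_{C^*(G,B)}=\sup_\varphi\|\varphi(f)\|$, where $\varphi$ ranges over all bounded representations. Let $B$ be a $C^*$-algebra and $J\subset B$ a closed two-sided ideal. Then the maps $C_c(G,J)\to C_c(G,B)$ and $C_c(G,B)\to C_c(G,B/J)$, given by composing functions with the inclusion $J\to B$ and with the quotient map $B\to B/J$, extend to $*$-homomorphisms of the completions, and the resulting sequence $$0\to C^*(G,J)\to C^*(G,B)\to C^*(G,B/J)\to 0$$ is exact. -/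

import Mathlib

set_option linter.unusedSectionVars false

open scoped ContDiff Manifold ENNReal
open MeasureTheory Filter Topology

/-- Closed two-sided ideals of a C⋆-algebra. -/
structure ClosedIdeal (B : Type*) [NonUnitalCStarAlgebra B] extends Submodule ℂ B where
  mul_mem_left' : ∀ b : B, ∀ x ∈ carrier, b * x ∈ carrier
  mul_mem_right' : ∀ x ∈ carrier, ∀ b : B, x * b ∈ carrier
  isClosed' : IsClosed carrier

namespace ClosedIdeal

variable {B : Type*} [NonUnitalCStarAlgebra B] (J : ClosedIdeal B)

lemma mul_left (b : B) {x : B} (hx : x ∈ J.toSubmodule) : b * x ∈ J.toSubmodule :=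
  J.mul_mem_left' b x hx

lemma mul_right (b : B) {x : B} (hx : x ∈ J.toSubmodule) : x * b ∈ J.toSubmodule :=
  J.mul_mem_right' x hx b

lemma isClosed : IsClosed (J.toSubmodule : Set B) := J.isClosed'

/-- The intersection of `J` with its adjoint, a C⋆-subalgebra of `B`. -/
def selfAdj : NonUnitalStarSubalgebra ℂ B where
  carrier := {x | x ∈ J.toSubmodule ∧ star x ∈ J.toSubmodule}
  add_mem' := fun ha hb => ⟨add_mem ha.1 hb.1, by rw [star_add]; exact add_mem ha.2 hb.2⟩
  zero_mem' := ⟨zero_mem _, by rw [star_zero]; exact zero_mem _⟩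
  mul_mem' := fun {a b} ha hb => ⟨J.mul_left a hb.1, by rw [star_mul]; exact J.mul_left _ ha.2⟩
  smul_mem' := fun c x hx =>
    ⟨J.smul_mem c hx.1, by rw [star_smul]; exact J.smul_mem _ hx.2⟩
  star_mem' := fun {a} ha => ⟨ha.2, by rw [star_star]; exact ha.1⟩

lemma selfAdj_closed : IsClosed (J.selfAdj : Set B) :=
  J.isClosed.inter (J.isClosed.preimage continuous_star)

/-- Approximate units: an element of the ideal that acts almost as a unit on a given element. -/
lemma exists_unit {x : B} (hx : x ∈ J.selfAdj) {ε : ℝ} (hε : 0 < ε) :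
    ∃ e ∈ J.selfAdj, (∀ b : B, ‖b - b * e‖ ≤ ‖b‖) ∧ star e = e ∧
      ‖x - x * e‖ < ε ∧ ‖x - e * x‖ < ε := by
  have : IsClosed (J.selfAdj : Set B) := J.selfAdj_closed
  let : NonUnitalCStarAlgebra J.selfAdj := NonUnitalStarSubalgebra.nonUnitalCStarAlgebra _
  let := CStarAlgebra.spectralOrder J.selfAdj
  let := CStarAlgebra.spectralOrderedRing J.selfAdj
  let := CStarAlgebra.spectralOrder (Unitization ℂ B)
  let := CStarAlgebra.spectralOrderedRing (Unitization ℂ B)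
  have hl := CStarAlgebra.increasingApproximateUnit J.selfAdj
  have h1 := hl.tendsto_mul_left ⟨x, hx⟩
  have h2 := hl.tendsto_mul_right ⟨x, hx⟩
  rw [Metric.tendsto_nhds] at h1 h2
  obtain ⟨e, he1, he2, he3, he4, he5⟩ :=
    ((h1 ε hε).and ((h2 ε hε).and (hl.eventually_nonneg.and
      (hl.eventually_norm.and hl.eventually_star_eq)))).exists
  refine ⟨e, e.2, fun b => ?_, congrArg Subtype.val he5, ?_, ?_⟩
  · have hpos : 0 ≤ ((e : B) : Unitization ℂ B) :=
      map_nonneg ((Unitization.inrNonUnitalStarAlgHom ℂ B).comp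
        (NonUnitalStarSubalgebraClass.subtype J.selfAdj)) he3
    have hn : ‖((e : B) : Unitization ℂ B)‖ ≤ 1 := by
      rw [Unitization.norm_inr]; exact he4
    have hle : ((e : B) : Unitization ℂ B) ≤ 1 :=
      (CStarAlgebra.norm_le_one_iff_of_nonneg _ hpos).1 hn
    have h3 : ‖(1 : Unitization ℂ B) - ((e : B) : Unitization ℂ B)‖ ≤ 1 := by
      rw [CStarAlgebra.norm_le_one_iff_of_nonneg _ (sub_nonneg.2 hle)]
      exact sub_le_self _ hpos
    calc ‖b - b * e‖ = ‖(b : Unitization ℂ B) * (1 - ((e : B) : Unitization ℂ B))‖ := by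
          rw [mul_sub, mul_one, ← Unitization.inr_mul, ← Unitization.inr_sub, Unitization.norm_inr]
      _ ≤ ‖(b : Unitization ℂ B)‖ * ‖(1 : Unitization ℂ B) - ((e : B) : Unitization ℂ B)‖ :=
          norm_mul_le _ _
      _ ≤ ‖b‖ * 1 := by
          rw [Unitization.norm_inr]
          exact mul_le_mul_of_nonneg_left h3 (norm_nonneg _)
      _ = ‖b‖ := mul_one _
  · rw [← dist_eq_norm, dist_comm]; exact he1
  · rw [← dist_eq_norm, dist_comm]; exact he2

/-- A closed two-sided ideal of a C⋆-algebra is self-adjoint. -/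
lemma star_mem {x : B} (hx : x ∈ J.toSubmodule) : star x ∈ J.toSubmodule := by
  have hxx : x * star x ∈ J.selfAdj :=
    ⟨J.mul_right _ hx, by rw [star_mul, star_star]; exact J.mul_right _ hx⟩
  have hcl := J.isClosed
  rw [← SetLike.mem_coe, ← hcl.closure_eq, Metric.mem_closure_iff]
  intro ε hε
  obtain ⟨e, he, hb, hs, h1, h2⟩ := J.exists_unit hxx (ε := ε ^ 2) (by positivity)
  refine ⟨star x * e, J.mul_left _ he.1, ?_⟩
  rw [dist_eq_norm]
  refine lt_of_pow_lt_pow_left₀ 2 hε.le (lt_of_le_of_lt ?_ h2)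
  have hz : star (star x - star x * e) * (star x - star x * e)
      = (x * star x - e * (x * star x)) - (x * star x - e * (x * star x)) * e := by
    rw [star_sub, star_mul, star_star, hs]
    simp only [sub_mul, mul_sub, mul_assoc]
  rw [sq, ← CStarRing.norm_star_mul_self, hz]
  exact hb _

/-- The ideal as a (closed) ⋆-subalgebra. -/
def toStarSubalgebra : NonUnitalStarSubalgebra ℂ B where
  carrier := J.toSubmodule
  add_mem' := fun ha hb => add_mem ha hb
  zero_mem' := zero_mem J.toSubmodule
  mul_mem' := fun {a _} _ hb => J.mul_left a hb
  smul_mem' := fun c _ hx => J.toSubmodule.smul_mem c hx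
  star_mem' := fun ha => J.star_mem ha

instance : IsClosed (J.toStarSubalgebra : Set B) := J.isClosed

/-- The inclusion of the C⋆-algebra `J` in `B`. -/
def incl : J.toStarSubalgebra →⋆ₙₐ[ℂ] B :=
  NonUnitalStarSubalgebraClass.subtype J.toStarSubalgebra

/-- The quotient C⋆-algebra `B / J`, with the quotient norm. -/
def Quot : Type _ := B ⧸ J.toSubmodule

namespace Quot

instance : IsClosed (J.toSubmodule : Set B) := J.isClosed

noncomputable instance : NormedAddCommGroup J.Quot :=
  inferInstanceAs (NormedAddCommGroup (B ⧸ J.toSubmodule))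

noncomputable instance : NormedSpace ℂ J.Quot :=
  inferInstanceAs (NormedSpace ℂ (B ⧸ J.toSubmodule))

instance : CompleteSpace J.Quot :=
  inferInstanceAs (CompleteSpace (B ⧸ J.toSubmodule))

variable {J} in
/-- The class of an element of `B`. -/
def mk (b : B) : J.Quot := Submodule.Quotient.mk b

lemma mk_surjective : Function.Surjective (mk : B → J.Quot) :=
  Submodule.Quotient.mk_surjective _

variable {J}

lemma mk_eq {a b : B} : (mk a : J.Quot) = mk b ↔ a - b ∈ J.toSubmodule :=
  Submodule.Quotient.eq _

lemma mk_add (a b : B) : (mk (a + b) : J.Quot) = mk a + mk b := rfl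
lemma mk_sub (a b : B) : (mk (a - b) : J.Quot) = mk a - mk b := rfl
lemma mk_zero : (mk 0 : J.Quot) = 0 := rfl
lemma mk_smul (c : ℂ) (b : B) : (mk (c • b) : J.Quot) = c • mk b := rfl

lemma norm_mk_le (b : B) : ‖(mk b : J.Quot)‖ ≤ ‖b‖ := Submodule.Quotient.norm_mk_le _ b

lemma exists_lift (q : J.Quot) {ε : ℝ} (hε : 0 < ε) :
    ∃ b : B, mk b = q ∧ ‖b‖ < ‖q‖ + ε :=
  Submodule.Quotient.norm_mk_lt q hε

instance : Mul J.Quot where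
  mul := Quotient.map₂ (· * ·) (by
    intro a a' ha b b' hb
    replace ha := Submodule.quotientRel_def _ |>.1 ha
    replace hb := Submodule.quotientRel_def _ |>.1 hb
    refine (Submodule.quotientRel_def _).2 ?_
    have : a * b - a' * b' = (a - a') * b + a' * (b - b') := by
      rw [sub_mul, mul_sub]; abel
    rw [this]
    exact add_mem (J.mul_right _ ha) (J.mul_left _ hb))

lemma mk_mul (a b : B) : (mk (a * b) : J.Quot) = mk a * mk b := rfl

instance : Star J.Quot where
  star := Quotient.map star (by
    intro a a' ha
    replace ha := Submodule.quotientRel_def _ |>.1 ha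
    refine (Submodule.quotientRel_def _).2 ?_
    rw [← star_sub]
    exact J.star_mem ha)

lemma mk_star (a : B) : (mk (star a) : J.Quot) = star (mk a) := rfl

noncomputable instance : NonUnitalNormedRing J.Quot where
  __ := (inferInstance : NormedAddCommGroup J.Quot)
  left_distrib a b c := by
    obtain ⟨a, rfl⟩ := mk_surjective J a
    obtain ⟨b, rfl⟩ := mk_surjective J b
    obtain ⟨c, rfl⟩ := mk_surjective J c
    simp only [← mk_mul, ← mk_add, mul_add]
  right_distrib a b c := by
    obtain ⟨a, rfl⟩ := mk_surjective J a
    obtain ⟨b, rfl⟩ := mk_surjective J b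
    obtain ⟨c, rfl⟩ := mk_surjective J c
    simp only [← mk_mul, ← mk_add, add_mul]
  zero_mul a := by
    obtain ⟨a, rfl⟩ := mk_surjective J a
    rw [← mk_zero, ← mk_mul, zero_mul]
  mul_zero a := by
    obtain ⟨a, rfl⟩ := mk_surjective J a
    rw [← mk_zero, ← mk_mul, mul_zero]
  mul_assoc a b c := by
    obtain ⟨a, rfl⟩ := mk_surjective J a
    obtain ⟨b, rfl⟩ := mk_surjective J b
    obtain ⟨c, rfl⟩ := mk_surjective J c
    simp only [← mk_mul, mul_assoc]
  norm_mul_le a b := by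
    have key : ∀ ε > 0, ‖a * b‖ ≤ (‖a‖ + ε) * (‖b‖ + ε) := by
      intro ε hε
      obtain ⟨a', rfl, ha⟩ := exists_lift a hε
      obtain ⟨b', rfl, hb⟩ := exists_lift b hε
      rw [← mk_mul]
      exact (norm_mk_le _).trans ((norm_mul_le _ _).trans
        (mul_le_mul ha.le hb.le (norm_nonneg _) (by positivity)))
    have hlim : Tendsto (fun ε : ℝ => (‖a‖ + ε) * (‖b‖ + ε)) (𝓝[>] 0) (𝓝 (‖a‖ * ‖b‖)) := by
      have : Continuous (fun ε : ℝ => (‖a‖ + ε) * (‖b‖ + ε)) := by fun_prop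
      simpa using (this.tendsto 0).mono_left nhdsWithin_le_nhds
    exact ge_of_tendsto hlim (eventually_nhdsWithin_of_forall key)

noncomputable instance : StarRing J.Quot where
  star_involutive a := by
    obtain ⟨a, rfl⟩ := mk_surjective J a
    rw [← mk_star, ← mk_star, star_star]
  star_mul a b := by
    obtain ⟨a, rfl⟩ := mk_surjective J a
    obtain ⟨b, rfl⟩ := mk_surjective J b
    simp only [← mk_mul, ← mk_star, star_mul]
  star_add a b := by
    obtain ⟨a, rfl⟩ := mk_surjective J a
    obtain ⟨b, rfl⟩ := mk_surjective J b
    simp only [← mk_add, ← mk_star, star_add]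

noncomputable instance : NonUnitalCStarAlgebra J.Quot where
  norm_mul_self_le q := by
    refine le_of_forall_pos_le_add fun ε hε => ?_
    obtain ⟨b, rfl⟩ := mk_surjective J q
    obtain ⟨c, hc, hcn⟩ := exists_lift (star (mk b : J.Quot) * mk b) (half_pos hε)
    rw [← mk_star, ← mk_mul, mk_eq] at hc
    have hj' : star b * b - c ∈ J.toSubmodule := by
      have := neg_mem hc; rwa [neg_sub] at this
    obtain ⟨e, he, hb, hs, h1, -⟩ :=
      J.exists_unit (x := star b * b - c) ⟨hj', J.star_mem hj'⟩ (half_pos hε)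
    have h3 : ‖(mk b : J.Quot)‖ ≤ ‖b - b * e‖ := by
      have : (mk b : J.Quot) = mk (b - b * e) := by
        rw [mk_eq, sub_sub_cancel]; exact J.mul_left _ he.1
      rw [this]; exact norm_mk_le _
    have h4 : star (b - b * e) * (b - b * e)
        = star (star (star b * b - star b * b * e) - star (star b * b - star b * b * e) * e) := by
      simp only [star_sub, star_mul, star_star, hs, sub_mul, mul_sub, mul_assoc]
      abel
    have h5 : ‖b - b * e‖ * ‖b - b * e‖ ≤ ‖star b * b - star b * b * e‖ := by
      rw [← CStarRing.norm_star_mul_self, h4, norm_star]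
      exact (hb _).trans (norm_star _).le
    have h6 : star b * b - star b * b * e
        = (c - c * e) + ((star b * b - c) - (star b * b - c) * e) := by
      rw [sub_mul]; abel
    calc ‖(mk b : J.Quot)‖ * ‖(mk b : J.Quot)‖ ≤ ‖b - b * e‖ * ‖b - b * e‖ :=
          mul_le_mul h3 h3 (norm_nonneg _) (norm_nonneg _)
      _ ≤ ‖c - c * e‖ + ‖(star b * b - c) - (star b * b - c) * e‖ := by
          refine h5.trans ?_
          rw [h6]; exact norm_add_le _ _
      _ ≤ ‖c‖ + ε / 2 := add_le_add (hb c) h1.le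
      _ ≤ ‖star (mk b : J.Quot) * mk b‖ + ε := by linarith
  smul_assoc c a b := by
    obtain ⟨a, rfl⟩ := mk_surjective J a
    obtain ⟨b, rfl⟩ := mk_surjective J b
    simp only [smul_eq_mul, ← mk_smul, ← mk_mul, smul_mul_assoc]
  smul_comm c a b := by
    obtain ⟨a, rfl⟩ := mk_surjective J a
    obtain ⟨b, rfl⟩ := mk_surjective J b
    simp only [smul_eq_mul, ← mk_smul, ← mk_mul, mul_smul_comm]
  star_smul c a := by
    obtain ⟨a, rfl⟩ := mk_surjective J a
    simp only [← mk_smul, ← mk_star, star_smul]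

end Quot

/-- The quotient ⋆-homomorphism `B → B / J`. -/
noncomputable def proj : B →⋆ₙₐ[ℂ] J.Quot where
  toFun := Quot.mk
  map_smul' _ _ := rfl
  map_zero' := rfl
  map_add' _ _ := rfl
  map_mul' _ _ := rfl
  map_star' _ := rfl

end ClosedIdeal

/-! ### Compactly supported functions on a possibly non-Hausdorff space -/

/-- `f` is continuous on some Hausdorff open set `U` and vanishes outside a compact subset of `U`. -/
def IsElementaryCc {X B : Type*} [TopologicalSpace X] [TopologicalSpace B] [Zero B]
    (f : X → B) : Prop :=
  ∃ U : Set X, IsOpen U ∧ T2Space U ∧ ContinuousOn f U ∧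
    ∃ K ⊆ U, IsCompact K ∧ ∀ x ∉ K, f x = 0

/-- The space `C_c(X, B)`: the linear span of the functions that are continuous on a Hausdorff
open subset and vanish outside a compact subset of it. -/
def Cc (X B : Type*) [TopologicalSpace X] [NonUnitalCStarAlgebra B] : Submodule ℂ (X → B) :=
  Submodule.span ℂ {f | IsElementaryCc f}

namespace Cc

variable {X B C : Type*} [TopologicalSpace X] [NonUnitalCStarAlgebra B] [NonUnitalCStarAlgebra C]

instance : CoeFun (Cc X B) (fun _ => X → B) := ⟨Subtype.val⟩

lemma induction {p : (X → B) → Prop} (h : ∀ f, IsElementaryCc f → p f) (h0 : p 0)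
    (hadd : ∀ f g, p f → p g → p (f + g)) (hsmul : ∀ (c : ℂ) f, p f → p (c • f))
    {f : X → B} (hf : f ∈ Cc X B) : p f :=
  Submodule.span_induction (p := fun f _ => p f) h h0 (fun f g _ _ => hadd f g)
    (fun c f _ => hsmul c f) hf

lemma comp_mem (φ : B →⋆ₙₐ[ℂ] C) {f : X → B} (hf : f ∈ Cc X B) : φ ∘ f ∈ Cc X C := by
  refine induction (p := fun f => φ ∘ f ∈ Cc X C) ?_ ?_ ?_ ?_ hf
  · rintro f ⟨U, hU, hT, hc, K, hK, hKc, h0⟩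
    exact Submodule.subset_span ⟨U, hU, hT, (NonUnitalStarAlgHom.instContinuousLinearMapClassComplex.map_continuous φ).comp_continuousOn hc, K, hK, hKc,
      fun x hx => by simp [h0 x hx]⟩
  · convert zero_mem (Cc X C)
    ext x; simp
  · intro f g hf hg
    convert add_mem hf hg
    ext x; simp
  · intro c f hf
    convert Submodule.smul_mem _ c hf
    ext x; simp

/-- The map `C_c(X, B) → C_c(X, C)`, `f ↦ φ ∘ f`, induced by a ⋆-homomorphism `φ : B → C`. -/
def map (φ : B →⋆ₙₐ[ℂ] C) : Cc X B →ₗ[ℂ] Cc X C where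
  toFun f := ⟨φ ∘ f, comp_mem φ f.2⟩
  map_add' f g := by ext x; simp
  map_smul' c f := by ext x; simp

lemma precomp_mem (e : X ≃ₜ X) {f : X → B} (hf : f ∈ Cc X B) : f ∘ e ∈ Cc X B := by
  refine induction (p := fun f => f ∘ e ∈ Cc X B) ?_ ?_ ?_ ?_ hf
  · rintro f ⟨U, hU, hT, hc, K, hK, hKc, h0⟩
    refine Submodule.subset_span ⟨e ⁻¹' U, hU.preimage e.continuous, ?_,
      hc.comp e.continuous.continuousOn (Set.mapsTo_preimage e U), e ⁻¹' K,
      Set.preimage_mono hK, e.isCompact_preimage.2 hKc, fun x hx => h0 _ hx⟩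
    exact T2Space.of_injective_continuous (f := Set.MapsTo.restrict e (e ⁻¹' U) U fun _ h => h)
      (fun a b hab => Subtype.ext (e.injective (congrArg Subtype.val hab)))
      (e.continuous.restrict _)
  · exact zero_mem (Cc X B)
  · exact fun f g hf hg => add_mem hf hg
  · exact fun c f hf => Submodule.smul_mem _ c hf

lemma star_mem {f : X → B} (hf : f ∈ Cc X B) : (fun x => star (f x)) ∈ Cc X B := by
  refine induction (p := fun f => (fun x => star (f x)) ∈ Cc X B) ?_ ?_ ?_ ?_ hf
  · rintro f ⟨U, hU, hT, hc, K, hK, hKc, h0⟩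
    exact Submodule.subset_span ⟨U, hU, hT, hc.star, K, hK, hKc,
      fun x hx => by simp [h0 x hx]⟩
  · convert zero_mem (Cc X B)
    simp
  · intro f g hf hg
    convert add_mem hf hg
    simp
  · intro c f hf
    convert Submodule.smul_mem _ (star c) hf
    simp

lemma bounded {f : X → B} (hf : f ∈ Cc X B) :
    ∃ K : Set X, IsCompact K ∧ ∃ D : ℝ, (∀ x, ‖f x‖ ≤ D) ∧ ∀ x ∉ K, f x = 0 := by
  refine induction (p := fun f => ∃ K : Set X, IsCompact K ∧ ∃ D : ℝ,
    (∀ x, ‖f x‖ ≤ D) ∧ ∀ x ∉ K, f x = 0) ?_ ?_ ?_ ?_ hf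
  · rintro f ⟨U, hU, hT, hc, K, hK, hKc, h0⟩
    obtain ⟨D, hD⟩ := hKc.exists_bound_of_continuousOn (hc.mono hK)
    refine ⟨K, hKc, max D 0, fun x => ?_, h0⟩
    by_cases hx : x ∈ K
    · exact (hD x hx).trans (le_max_left _ _)
    · simp [h0 x hx]
  · exact ⟨∅, isCompact_empty, 0, by simp⟩
  · rintro f g ⟨K, hK, D, hD, h⟩ ⟨K', hK', D', hD', h'⟩
    refine ⟨K ∪ K', hK.union hK', D + D', fun x => ?_, fun x hx => ?_⟩
    · exact (norm_add_le _ _).trans (add_le_add (hD x) (hD' x))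
    · rw [Set.mem_union, not_or] at hx
      simp [h x hx.1, h' x hx.2]
  · rintro c f ⟨K, hK, D, hD, h⟩
    refine ⟨K, hK, ‖c‖ * D, fun x => ?_, fun x hx => by simp [h x hx]⟩
    rw [Pi.smul_apply, norm_smul]
    exact mul_le_mul_of_nonneg_left (hD x) (norm_nonneg _)

end Cc

/-! ### Lie groupoids and Haar systems -/

section Groupoid

universe u v

variable (EG EM : Type*) [NormedAddCommGroup EG] [NormedSpace ℝ EG] [FiniteDimensional ℝ EG]
  [NormedAddCommGroup EM] [NormedSpace ℝ EM]

/-- Lie groupoids `G ⇉ M`: the arrow manifold `G` (modelled on `EG`) need not be Hausdorff.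
`mul γ η` is the composition `γ ∘ η`; it is meaningful only when `src γ = rng η`, and its values
at other pairs are irrelevant. Smoothness of the composition on the embedded submanifold of
composable pairs is smoothness within that subset of `G × G`. -/
structure LieGroupoid (G M : Type*)
    [TopologicalSpace G] [ChartedSpace EG G] [IsManifold 𝓘(ℝ, EG) ∞ G]
    [TopologicalSpace M] [ChartedSpace EM M] [IsManifold 𝓘(ℝ, EM) ∞ M] where
  src : G → M
  rng : G → M
  one : M → G
  inv : G → G
  mul : G → G → G
  src_one : ∀ x, src (one x) = x
  rng_one : ∀ x, rng (one x) = x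
  src_inv : ∀ γ, src (inv γ) = rng γ
  rng_inv : ∀ γ, rng (inv γ) = src γ
  src_mul : ∀ γ η, src γ = rng η → src (mul γ η) = src η
  rng_mul : ∀ γ η, src γ = rng η → rng (mul γ η) = rng γ
  mul_assoc : ∀ γ η ζ, src γ = rng η → src η = rng ζ → mul (mul γ η) ζ = mul γ (mul η ζ)
  mul_one : ∀ γ, mul γ (one (src γ)) = γ
  one_mul : ∀ γ, mul (one (rng γ)) γ = γ
  mul_inv : ∀ γ, mul γ (inv γ) = one (rng γ)
  inv_mul : ∀ γ, mul (inv γ) γ = one (src γ)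
  src_submersion : Manifold.IsSubmersion 𝓘(ℝ, EG) 𝓘(ℝ, EM) ∞ src
  rng_submersion : Manifold.IsSubmersion 𝓘(ℝ, EG) 𝓘(ℝ, EM) ∞ rng
  one_smooth : ContMDiff 𝓘(ℝ, EM) 𝓘(ℝ, EG) ∞ one
  inv_smooth : ContMDiff 𝓘(ℝ, EG) 𝓘(ℝ, EG) ∞ inv
  mul_smooth : ContMDiffOn (𝓘(ℝ, EG).prod 𝓘(ℝ, EG)) 𝓘(ℝ, EG) ∞
    (fun p : G × G => mul p.1 p.2) {p | src p.1 = rng p.2}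

variable {EG EM}
variable {G : Type u} {M : Type*}
  [TopologicalSpace G] [ChartedSpace EG G] [IsManifold 𝓘(ℝ, EG) ∞ G]
  [TopologicalSpace M] [T2Space M] [ChartedSpace EM M] [IsManifold 𝓘(ℝ, EM) ∞ M]

variable (EG G) in
/-- The space `C_c^∞(G)`: the linear span of the functions that are smooth on a Hausdorff
open subset and vanish outside a compact subset of it. -/
def CcSmooth : Submodule ℂ (G → ℂ) :=
  Submodule.span ℂ {f | ∃ U : Set G, IsOpen U ∧ T2Space U ∧
    ContMDiffOn 𝓘(ℝ, EG) 𝓘(ℝ, ℂ) ∞ f U ∧ ∃ K ⊆ U, IsCompact K ∧ ∀ x ∉ K, f x = 0}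

namespace LieGroupoid

variable (𝒢 : LieGroupoid EG EM G M)

lemma inv_inv (γ : G) : 𝒢.inv (𝒢.inv γ) = γ := by
  have h1 : 𝒢.src (𝒢.inv (𝒢.inv γ)) = 𝒢.rng (𝒢.inv γ) := 𝒢.src_inv _
  calc 𝒢.inv (𝒢.inv γ)
      = 𝒢.mul (𝒢.inv (𝒢.inv γ)) (𝒢.one (𝒢.src γ)) := by
        rw [← 𝒢.rng_inv γ, ← h1, 𝒢.mul_one]
    _ = 𝒢.mul (𝒢.inv (𝒢.inv γ)) (𝒢.mul (𝒢.inv γ) γ) := by rw [𝒢.inv_mul]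
    _ = 𝒢.mul (𝒢.mul (𝒢.inv (𝒢.inv γ)) (𝒢.inv γ)) γ :=
        (𝒢.mul_assoc _ _ _ h1 (𝒢.src_inv γ)).symm
    _ = 𝒢.mul (𝒢.one (𝒢.rng γ)) γ := by rw [𝒢.inv_mul, 𝒢.src_inv]
    _ = γ := 𝒢.one_mul γ

/-- Inversion as a homeomorphism. -/
def invHomeo : G ≃ₜ G where
  toFun := 𝒢.inv
  invFun := 𝒢.inv
  left_inv := 𝒢.inv_inv
  right_inv := 𝒢.inv_inv
  continuous_toFun := 𝒢.inv_smooth.continuous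
  continuous_invFun := 𝒢.inv_smooth.continuous

/-- The source fibre `G_x`, with its subspace topology and Borel σ-algebra. -/
def Fiber (x : M) : Type u := {γ : G // 𝒢.src γ = x}

namespace Fiber

variable {𝒢} {x : M}

instance : TopologicalSpace (𝒢.Fiber x) := instTopologicalSpaceSubtype
instance : MeasurableSpace (𝒢.Fiber x) := borel _
instance : BorelSpace (𝒢.Fiber x) := ⟨rfl⟩

/-- The underlying arrow. -/
def val (γ : 𝒢.Fiber x) : G := Subtype.val γ

instance : CoeOut (𝒢.Fiber x) G := ⟨val⟩

lemma src_val (γ : 𝒢.Fiber x) : 𝒢.src γ.val = x := Subtype.property γ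

lemma continuous_val : Continuous (fun γ : 𝒢.Fiber x => (γ : G)) := continuous_subtype_val

lemma isClosedEmbedding : IsClosedEmbedding (fun γ : 𝒢.Fiber x => (γ : G)) := by
  refine IsClosed.isClosedEmbedding_subtypeVal (s := {γ | 𝒢.src γ = x}) ?_
  exact isClosed_singleton.preimage 𝒢.src_submersion.contMDiff.continuous

end Fiber

/-- A (right invariant) Haar system on a Lie groupoid: Radon measures on the source fibres,
depending smoothly on the base point and invariant under right translations. -/
structure HaarSystem where
  meas : ∀ x : M, Measure (𝒢.Fiber x)
  regular : ∀ x, (meas x).Regular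
  smooth : ∀ f ∈ CcSmooth EG G,
    ContMDiff 𝓘(ℝ, EM) 𝓘(ℝ, ℂ) ∞ (fun x => ∫ γ : 𝒢.Fiber x, f γ ∂(meas x))
  invariant : ∀ η : G, ∀ f ∈ CcSmooth EG G,
    ∫ γ : 𝒢.Fiber (𝒢.src η), f γ ∂(meas (𝒢.src η)) =
      ∫ γ : 𝒢.Fiber (𝒢.rng η), f (𝒢.mul γ η) ∂(meas (𝒢.rng η))

namespace HaarSystem

variable {𝒢} (μ : 𝒢.HaarSystem) {B : Type v} [NonUnitalCStarAlgebra B]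

/-- The convolution `(f ∗ g)(γ) = ∫_{G_{s(γ)}} f(γ γ₁⁻¹) g(γ₁) dμ_{s(γ)}(γ₁)`. -/
noncomputable def conv (f g : G → B) (γ : G) : B :=
  ∫ γ₁ : 𝒢.Fiber (𝒢.src γ), f (𝒢.mul γ (𝒢.inv γ₁)) * g γ₁ ∂(μ.meas (𝒢.src γ))

/-- The norm `‖·‖_I`, with values in `[0, ∞]`; it is finite on `C_c(G, B)`. -/
noncomputable def INorm (f : G → B) : ℝ≥0∞ :=
  ⨆ x : M, max (∫⁻ γ : 𝒢.Fiber x, ‖f γ‖ₑ ∂(μ.meas x))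
    (∫⁻ γ : 𝒢.Fiber x, ‖f (𝒢.inv γ)‖ₑ ∂(μ.meas x))

end HaarSystem

/-- The adjoint `f⋆(γ) = f(γ⁻¹)⋆` on `C_c(G, B)`. -/
def adj {B : Type v} [NonUnitalCStarAlgebra B] (f : Cc G B) : Cc G B :=
  ⟨fun γ => star (f (𝒢.inv γ)), Cc.star_mem (Cc.precomp_mem 𝒢.invHomeo f.2)⟩

namespace HaarSystem

variable {𝒢} (μ : 𝒢.HaarSystem) {B : Type v} [NonUnitalCStarAlgebra B]

lemma exists_bump (k : G) : ∃ ψ : G → ℝ, (∀ γ, 0 ≤ ψ γ) ∧ (∀ᶠ γ in 𝓝 k, ψ γ = 1) ∧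
    ∃ U : Set G, IsOpen U ∧ T2Space U ∧
    ContMDiffOn 𝓘(ℝ, EG) 𝓘(ℝ, ℝ) ∞ ψ U ∧ ∃ K ⊆ U, IsCompact K ∧ ∀ x ∉ K, ψ x = 0 := by
  classical
  set e := chartAt EG k with he
  have hk : k ∈ e.source := mem_chart_source EG k
  obtain ⟨r, hr, hrs⟩ := Metric.nhds_basis_closedBall.mem_iff.1
    (e.open_target.mem_nhds (e.map_source hk))
  let b : ContDiffBump (e k) := ⟨r / 2, r, by positivity, by linarith⟩
  have hb1 : ∀ γ ∈ e.source, (if γ ∈ e.source then b (e γ) else 0) = b (e γ) :=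
    fun γ h => if_pos h
  refine ⟨fun γ => if γ ∈ e.source then b (e γ) else 0, ?_, ?_, e.source, e.open_source, ?_, ?_,
    e.symm '' Metric.closedBall (e k) r, ?_, ?_, ?_⟩
  · intro γ
    dsimp only
    split_ifs
    · exact b.nonneg
    · exact le_rfl
  · have h1 : ∀ᶠ γ in 𝓝 k, b (e γ) = 1 :=
      (e.continuousAt hk).eventually b.eventuallyEq_one
    filter_upwards [h1, e.open_source.mem_nhds hk] with γ h h'
    rw [if_pos h', h]
  · exact T2Space.of_injective_continuous (f := fun γ : e.source => e γ)
      (fun a b hab => Subtype.ext (e.injOn a.2 b.2 hab)) e.continuousOn.domRestrict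
  · refine ContMDiffOn.congr ?_ hb1
    exact (b.contDiff.contMDiff (n := ∞)).comp_contMDiffOn (contMDiffOn_chart (x := k))
  · rintro _ ⟨y, hy, rfl⟩
    exact e.map_target (hrs hy)
  · exact (isCompact_closedBall _ _).image_of_continuousOn (e.continuousOn_symm.mono hrs)
  · intro γ hγ
    dsimp only
    split_ifs with h
    · refine b.zero_of_le_dist ?_
      by_contra hlt
      exact hγ ⟨e γ, Metric.mem_closedBall.2 (not_le.1 hlt).le, e.left_inv h⟩
    · rfl

lemma exists_lintegral_bump_le {ψ : G → ℝ} (h0 : ∀ γ, 0 ≤ ψ γ)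
    (h : ∃ U : Set G, IsOpen U ∧ T2Space U ∧
    ContMDiffOn 𝓘(ℝ, EG) 𝓘(ℝ, ℝ) ∞ ψ U ∧ ∃ K ⊆ U, IsCompact K ∧ ∀ x ∉ K, ψ x = 0) :
    ∃ C : ℝ, ∀ x, ∫⁻ γ : 𝒢.Fiber x, ENNReal.ofReal (ψ γ) ∂(μ.meas x) ≤ ENNReal.ofReal C := by
  classical
  obtain ⟨U, hU, hT, hψ, K, hKU, hK, hz⟩ := h
  have hmem : (fun γ => (ψ γ : ℂ)) ∈ CcSmooth EG G := by
    refine Submodule.subset_span ⟨U, hU, hT, ?_, K, hKU, hK, fun x hx => by simp [hz x hx]⟩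
    exact (Complex.ofRealCLM.contDiff.contMDiff (n := ∞)).comp_contMDiffOn hψ
  have hcont := (μ.smooth _ hmem).continuous
  obtain ⟨C, hC⟩ := (hK.image 𝒢.src_submersion.contMDiff.continuous).exists_bound_of_continuousOn
    hcont.continuousOn
  refine ⟨max C 0, fun x => ?_⟩
  by_cases hx : x ∈ 𝒢.src '' K
  · have := μ.regular x
    have hKx : IsCompact ((fun γ : 𝒢.Fiber x => (γ : G)) ⁻¹' K) :=
      Fiber.isClosedEmbedding.isCompact_preimage hK
    have hmeas : Measurable (fun γ : 𝒢.Fiber x => ψ γ) := by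
      have hUo : IsOpen ((fun γ : 𝒢.Fiber x => (γ : G)) ⁻¹' U) := hU.preimage Fiber.continuous_val
      have := ContinuousOn.measurable_piecewise (f := fun γ : 𝒢.Fiber x => ψ γ)
        (g := fun _ => 0) (s := (fun γ : 𝒢.Fiber x => (γ : G)) ⁻¹' U)
        (hψ.continuousOn.comp Fiber.continuous_val.continuousOn (Set.mapsTo_preimage _ _))
        continuousOn_const hUo.measurableSet
      convert this using 1
      ext γ
      simp only [Set.piecewise]
      split_ifs with hγ
      · rfl
      · exact hz _ fun h => hγ (hKU h)
    obtain ⟨D, hD⟩ := hK.exists_bound_of_continuousOn (hψ.continuousOn.mono hKU)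
    have hint : Integrable (fun γ : 𝒢.Fiber x => ψ γ) (μ.meas x) := by
      have hfin : IntegrableOn (fun γ : 𝒢.Fiber x => ψ γ)
          ((fun γ : 𝒢.Fiber x => (γ : G)) ⁻¹' K) (μ.meas x) := by
        refine Measure.integrableOn_of_bounded (M := max D 0) hKx.measure_lt_top.ne
          hmeas.aestronglyMeasurable (Eventually.of_forall fun γ => ?_)
        by_cases hγ : (γ : G) ∈ K
        · exact (hD _ hγ).trans (le_max_left _ _)
        · simp [hz _ hγ]
      exact hfin.integrable_of_forall_notMem_eq_zero fun γ hγ => hz _ hγ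
    rw [← ofReal_integral_eq_lintegral_ofReal hint (Eventually.of_forall fun γ => h0 _)]
    refine ENNReal.ofReal_le_ofReal (le_trans (le_trans ?_ (hC x hx)) (le_max_left _ _))
    rw [integral_complex_ofReal, Complex.norm_real]
    exact le_abs_self _
  · have : ∀ γ : 𝒢.Fiber x, ENNReal.ofReal (ψ γ) = 0 := fun γ => by
      rw [hz, ENNReal.ofReal_zero]
      exact fun h => hx ⟨γ, h, γ.src_val⟩
    simp [this]

lemma exists_meas_le {K : Set G} (hK : IsCompact K) :
    ∃ C : ℝ≥0∞, C ≠ ⊤ ∧ ∀ x, μ.meas x {γ : 𝒢.Fiber x | (γ : G) ∈ K} ≤ C := by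
  refine hK.induction_on (p := fun K => ∃ C : ℝ≥0∞, C ≠ ⊤ ∧
    ∀ x, μ.meas x {γ : 𝒢.Fiber x | (γ : G) ∈ K} ≤ C) ?_ ?_ ?_ ?_
  · exact ⟨0, ENNReal.zero_ne_top, fun x => by simp⟩
  · rintro s t hst ⟨C, hC, h⟩
    exact ⟨C, hC, fun x => le_trans (measure_mono (fun γ hγ => hst hγ)) (h x)⟩
  · rintro s t ⟨C, hC, h⟩ ⟨D, hD, h'⟩
    refine ⟨C + D, ENNReal.add_ne_top.2 ⟨hC, hD⟩, fun x => ?_⟩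
    exact (measure_union_le {γ : 𝒢.Fiber x | (γ : G) ∈ s} {γ : 𝒢.Fiber x | (γ : G) ∈ t}).trans
      (add_le_add (h x) (h' x))
  · intro k _
    obtain ⟨ψ, h0, h1, h⟩ := exists_bump (EG := EG) k
    obtain ⟨C, hC⟩ := μ.exists_lintegral_bump_le h0 h
    obtain ⟨O, hO, hOo, hkO⟩ := eventually_nhds_iff.1 h1
    refine ⟨O, mem_nhdsWithin_of_mem_nhds (hOo.mem_nhds hkO), ENNReal.ofReal C,
      ENNReal.ofReal_ne_top, fun x => le_trans ?_ (hC x)⟩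
    have hm : MeasurableSet {γ : 𝒢.Fiber x | (γ : G) ∈ O} :=
      (hOo.preimage Fiber.continuous_val).measurableSet
    rw [← lintegral_indicator_one hm]
    refine lintegral_mono fun γ => ?_
    by_cases hγ : γ ∈ {γ : 𝒢.Fiber x | (γ : G) ∈ O}
    · rw [Set.indicator_of_mem hγ, hO _ hγ]
      simp
    · rw [Set.indicator_of_notMem hγ]
      exact zero_le

lemma exists_lintegral_le {f : G → B} (hf : f ∈ Cc G B) :
    ∃ C : ℝ≥0∞, C ≠ ⊤ ∧ ∀ x, ∫⁻ γ : 𝒢.Fiber x, ‖f γ‖ₑ ∂(μ.meas x) ≤ C := by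
  obtain ⟨K, hK, D, hD, hz⟩ := Cc.bounded hf
  obtain ⟨C, hC, h⟩ := μ.exists_meas_le hK
  refine ⟨ENNReal.ofReal D * C, ENNReal.mul_ne_top ENNReal.ofReal_ne_top hC, fun x => ?_⟩
  calc ∫⁻ γ : 𝒢.Fiber x, ‖f γ‖ₑ ∂(μ.meas x)
      ≤ ∫⁻ γ : 𝒢.Fiber x, Set.indicator {γ : 𝒢.Fiber x | (γ : G) ∈ K}
          (fun _ => ENNReal.ofReal D) γ ∂(μ.meas x) := by
        refine lintegral_mono fun γ => ?_
        by_cases hγ : γ ∈ {γ : 𝒢.Fiber x | (γ : G) ∈ K}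
        · rw [Set.indicator_of_mem hγ, ← ofReal_norm]
          exact ENNReal.ofReal_le_ofReal (hD _)
        · rw [Set.indicator_of_notMem hγ, hz _ hγ]
          simp
    _ ≤ ENNReal.ofReal D * μ.meas x {γ : 𝒢.Fiber x | (γ : G) ∈ K} :=
        lintegral_indicator_const_le _ _
    _ ≤ ENNReal.ofReal D * C := by gcongr; exact h x

/-- The `I`-norm is finite on `C_c(G, B)`. -/
lemma INorm_ne_top (f : Cc G B) : μ.INorm f ≠ ⊤ := by
  obtain ⟨C, hC, h⟩ := μ.exists_lintegral_le f.2
  obtain ⟨D, hD, h'⟩ := μ.exists_lintegral_le (Cc.precomp_mem 𝒢.invHomeo f.2)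
  refine ne_top_of_le_ne_top (b := max C D) (by simp [hC, hD]) (iSup_le fun x => ?_)
  exact max_le_max (h x) (h' x)

variable (B) in
/-- Bounded ⋆-representations of the convolution algebra `C_c(G, B)` on Hilbert spaces.
As `C_c(G, B)` is closed under convolution, `map_conv` says `ρ(f ∗ g) = ρ(f) ρ(g)` for all `f`, `g`.
Hilbert spaces in the universe of `C_c(G, B)` suffice for the supremum of the norms `‖ρ(f)‖`, since
cyclic representations embed there. -/
structure BoundedRep where
  H : Type (max u v)
  [normed : NormedAddCommGroup H]
  [inner : InnerProductSpace ℂ H]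
  [complete : CompleteSpace H]
  toLin : Cc G B →ₗ[ℂ] (H →L[ℂ] H)
  map_conv : ∀ f g h : Cc G B, (∀ γ, h γ = μ.conv f g γ) → toLin h = toLin f * toLin g
  map_adj : ∀ f : Cc G B, toLin (𝒢.adj f) = star (toLin f)
  bounded : ∀ f : Cc G B, ‖toLin f‖ₑ ≤ μ.INorm f

attribute [instance] BoundedRep.normed BoundedRep.inner BoundedRep.complete

variable (B) in
/-- The C⋆-algebra of bounded families of operators, one on the space of each bounded
representation of `C_c(G, B)`, with the supremum norm. -/
def RepProd : Type _ := lp (fun ρ : μ.BoundedRep B => ρ.H →L[ℂ] ρ.H) ∞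

noncomputable instance : NonUnitalCStarAlgebra (μ.RepProd B) :=
  inferInstanceAs (NonUnitalCStarAlgebra (lp (fun ρ : μ.BoundedRep B => ρ.H →L[ℂ] ρ.H) ∞))

/-- The universal representation `f ↦ (ρ(f))_ρ`, so that `‖univ f‖ = sup_ρ ‖ρ(f)‖`. -/
noncomputable def univ : Cc G B →ₗ[ℂ] μ.RepProd B where
  toFun f := ⟨fun ρ => ρ.toLin f, memℓp_infty ⟨(μ.INorm f).toReal, by
    rintro _ ⟨ρ, rfl⟩
    have := ENNReal.toReal_mono (μ.INorm_ne_top f) (ρ.bounded f)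
    rwa [toReal_enorm] at this⟩⟩
  map_add' f g := Subtype.ext (funext fun ρ => ρ.toLin.map_add f g)
  map_smul' c f := Subtype.ext (funext fun ρ => ρ.toLin.map_smul c f)

variable (B) in
/-- The full groupoid C⋆-algebra `C⋆(G, B)`, the completion of `C_c(G, B)` in the norm
`sup_ρ ‖ρ(f)‖`: it is realised as the closed ⋆-subalgebra generated by the image of
`C_c(G, B)` under the universal representation (the image is a ⋆-algebra, so this is its closure,
and every `f` has norm `sup_ρ ‖ρ(f)‖` in it). -/
noncomputable def FullCStar : NonUnitalStarSubalgebra ℂ (μ.RepProd B) :=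
  (NonUnitalStarAlgebra.adjoin ℂ (Set.range (μ.univ (B := B)))).topologicalClosure

instance : IsClosed (μ.FullCStar B : Set (μ.RepProd B)) :=
  NonUnitalStarSubalgebra.isClosed_topologicalClosure _

/-- The canonical map `C_c(G, B) → C⋆(G, B)`. -/
noncomputable def toFull : Cc G B →ₗ[ℂ] μ.FullCStar B where
  toFun f := ⟨μ.univ f, NonUnitalStarSubalgebra.le_topologicalClosure _
    (NonUnitalStarAlgebra.subset_adjoin ℂ _ ⟨f, rfl⟩)⟩
  map_add' f g := Subtype.ext (map_add _ f g)
  map_smul' c f := Subtype.ext (map_smul (μ.univ (B := B)) c f)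

end HaarSystem

end LieGroupoid

end Groupoid

/-! Everything rests on an approximate unit `e` of the ideal `J`, consisting of self-adjoint
contractions, and on the fact that ⋆-homomorphisms of C⋆-algebras have closed range.

Injectivity amounts to the norm of C⋆(G, B) dominating that of C⋆(G, J) on C_c(G, J). For this every
bounded representation ρ of C_c(G, J) is extended to C_c(G, B) as the strong limit of ρ(f e)
(`BoundedRep.exists_extension`). On vectors ρ(g)η the limit exists because (f e) ∗ g = f ∗ (e g)
tends to f ∗ g in the I-norm; on the orthogonal complement of these vectors everything vanishes; and
‖f e‖_I ≤ ‖f‖_I keeps the extension bounded.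

For exactness in the middle, the image of C⋆(G, J) is a closed ideal of C⋆(G, B) (`rangeIdeal`). The
quotient map by this ideal, restricted to C_c(G, B), kills C_c(G, J). Since f - f e has I-norm at
most that of the class of f in C_c(G, B / J), up to ε (`exists_INorm_sub_map_incl_le`), the quotient
map descends to a homomorphism on C_c(G, B / J) that is bounded by the I-norm, and so extends to
C⋆(G, B / J). The kernel of π therefore lies in the image of ι.

Surjectivity holds because functions in C_c(G, B / J) lift to C_c(G, B) (`Cc.map_proj_surjective`),
so that π has dense, hence full, range.

The extension steps use the universal property `exists_lift`, which has two ingredients. One is that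
C_c(G, B) is closed under convolution (`convBilin_mem`); as `G` need not be Hausdorff, this is
proved for functions with small supports, whose products stay in a Hausdorff open set. The other is
that the norm of C⋆(G, B) dominates bounded homomorphisms to all C⋆-algebras
(`norm_le_norm_toFull`), by the GNS construction and a cardinality argument that brings the Hilbert
space into the required universe. -/

namespace ClosedIdeal

/-! ### Closed ideals, quotients and approximate units -/

variable {B C : Type*} [NonUnitalCStarAlgebra B] [NonUnitalCStarAlgebra C] (J : ClosedIdeal B)

/-- The kernel of a ⋆-homomorphism as a closed ideal. -/
def ker (φ : B →⋆ₙₐ[ℂ] C) : ClosedIdeal B where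
  carrier := {x | φ x = 0}
  add_mem' := fun {a b} ha hb => by
    change φ (a + b) = 0
    rw [map_add, show φ a = 0 from ha, show φ b = 0 from hb, add_zero]
  zero_mem' := map_zero φ
  smul_mem' := fun c x hx => by
    change φ (c • x) = 0
    rw [map_smul, show φ x = 0 from hx, smul_zero]
  mul_mem_left' := fun b x hx => by
    change φ (b * x) = 0
    rw [map_mul, show φ x = 0 from hx, mul_zero]
  mul_mem_right' := fun x hx b => by
    change φ (x * b) = 0
    rw [map_mul, show φ x = 0 from hx, zero_mul]
  isClosed' := isClosed_eq
    (NonUnitalStarAlgHom.instContinuousLinearMapClassComplex.map_continuous φ) continuous_const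

lemma mem_ker {φ : B →⋆ₙₐ[ℂ] C} {x : B} : x ∈ (ker φ).toSubmodule ↔ φ x = 0 := Iff.rfl

variable {J} in
/-- The ⋆-homomorphism on `B / J` induced by a ⋆-homomorphism on `B` that vanishes on `J`. -/
def Quot.lift (φ : B →⋆ₙₐ[ℂ] C) (h : ∀ x ∈ J.toSubmodule, φ x = 0) : J.Quot →⋆ₙₐ[ℂ] C where
  toFun := J.toSubmodule.liftQ (φ : B →ₗ[ℂ] C) h
  map_smul' c x := map_smul (J.toSubmodule.liftQ (φ : B →ₗ[ℂ] C) h) c x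
  map_zero' := map_zero (J.toSubmodule.liftQ (φ : B →ₗ[ℂ] C) h)
  map_add' x y := map_add (J.toSubmodule.liftQ (φ : B →ₗ[ℂ] C) h) x y
  map_mul' x y := by
    obtain ⟨x, rfl⟩ := Quot.mk_surjective J x
    obtain ⟨y, rfl⟩ := Quot.mk_surjective J y
    exact map_mul φ x y
  map_star' x := by
    obtain ⟨x, rfl⟩ := Quot.mk_surjective J x
    exact map_star φ x

lemma proj_eq_zero_iff (b : B) : J.proj b = 0 ↔ b ∈ J.toSubmodule := by
  change (Quot.mk b : J.Quot) = Quot.mk 0 ↔ _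
  rw [Quot.mk_eq, sub_zero]

/-- The range of a ⋆-homomorphism of C⋆-algebras is closed. -/
lemma isClosed_range_starAlgHom (φ : B →⋆ₙₐ[ℂ] C) : IsClosed (Set.range φ) := by
  -- Modulo its kernel the homomorphism is injective, hence isometric, and an isometric image of a
  -- complete space is closed.
  let ψ : (ker φ).Quot →⋆ₙₐ[ℂ] C := Quot.lift φ fun x hx => hx
  have hψ : Function.Injective ψ := by
    intro x y hxy
    obtain ⟨x, rfl⟩ := Quot.mk_surjective _ x
    obtain ⟨y, rfl⟩ := Quot.mk_surjective _ y
    rw [Quot.mk_eq, mem_ker, map_sub, sub_eq_zero]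
    exact hxy
  have hr : Set.range φ = Set.range ψ := by
    rw [← (Quot.mk_surjective (ker φ)).range_comp ψ]
    rfl
  rw [hr]
  exact (NonUnitalStarAlgHom.isometry ψ hψ).isClosedEmbedding.isClosed_range

/-- A ⋆-homomorphism of C⋆-algebras with dense range is surjective. -/
lemma surjective_of_denseRange (φ : B →⋆ₙₐ[ℂ] C) (h : DenseRange φ) : Function.Surjective φ := by
  rw [← Set.range_eq_univ, ← (isClosed_range_starAlgHom φ).closure_eq]
  exact h.closure_range

/-- A closed ideal has an approximate unit of self-adjoint contractions. -/
lemma exists_approximateUnit : ∃ l : Filter J.toStarSubalgebra, l.IsApproximateUnit ∧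
    ∀ᶠ e : J.toStarSubalgebra in l, star e = e ∧ ‖e‖ ≤ 1 ∧ ∀ b : B, ‖b - b * e‖ ≤ ‖b‖ := by
  let := CStarAlgebra.spectralOrder J.toStarSubalgebra
  let := CStarAlgebra.spectralOrderedRing J.toStarSubalgebra
  let := CStarAlgebra.spectralOrder (Unitization ℂ B)
  let := CStarAlgebra.spectralOrderedRing (Unitization ℂ B)
  have hl := CStarAlgebra.increasingApproximateUnit J.toStarSubalgebra
  refine ⟨_, hl.toIsApproximateUnit, ?_⟩
  filter_upwards [hl.eventually_nonneg, hl.eventually_norm, hl.eventually_star_eq] with e h1 h2 h3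
  refine ⟨h3, h2, fun b => ?_⟩
  have hpos : 0 ≤ ((e : B) : Unitization ℂ B) :=
    map_nonneg ((Unitization.inrNonUnitalStarAlgHom ℂ B).comp
      (NonUnitalStarSubalgebraClass.subtype J.toStarSubalgebra)) h1
  have hn : ‖((e : B) : Unitization ℂ B)‖ ≤ 1 := by
    rw [Unitization.norm_inr]; exact h2
  have hle : ((e : B) : Unitization ℂ B) ≤ 1 :=
    (CStarAlgebra.norm_le_one_iff_of_nonneg _ hpos).1 hn
  have h4 : ‖(1 : Unitization ℂ B) - ((e : B) : Unitization ℂ B)‖ ≤ 1 := by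
    rw [CStarAlgebra.norm_le_one_iff_of_nonneg _ (sub_nonneg.2 hle)]
    exact sub_le_self _ hpos
  calc ‖b - b * e‖ = ‖(b : Unitization ℂ B) * (1 - ((e : B) : Unitization ℂ B))‖ := by
        rw [mul_sub, mul_one, ← Unitization.inr_mul, ← Unitization.inr_sub, Unitization.norm_inr]
    _ ≤ ‖(b : Unitization ℂ B)‖ * ‖(1 : Unitization ℂ B) - ((e : B) : Unitization ℂ B)‖ :=
        norm_mul_le _ _
    _ ≤ ‖b‖ * 1 := by
        rw [Unitization.norm_inr]
        exact mul_le_mul_of_nonneg_left h4 (norm_nonneg _)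
    _ = ‖b‖ := mul_one _

variable {J} in
-- Replace `b` by a representative `c` of its class of nearly minimal norm: `c - c * e` is no longer
-- than `c`, and the rest of `b - b * e` tends to zero because `b - c` lies in `J`.
lemma eventually_norm_sub_mul_le {l : Filter J.toStarSubalgebra} (hl : l.IsApproximateUnit)
    (h : ∀ᶠ e : J.toStarSubalgebra in l, star e = e ∧ ‖e‖ ≤ 1 ∧ ∀ b : B, ‖b - b * e‖ ≤ ‖b‖) (b : B) {ε : ℝ}
    (hε : 0 < ε) : ∀ᶠ e : J.toStarSubalgebra in l, ‖b - b * e‖ ≤ ‖(Quot.mk b : J.Quot)‖ + ε := by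
  obtain ⟨c, hc, hcn⟩ := Quot.exists_lift (Quot.mk b : J.Quot) (half_pos hε)
  rw [eq_comm, Quot.mk_eq] at hc
  have h1 := hl.tendsto_mul_left ⟨b - c, hc⟩
  rw [Metric.tendsto_nhds] at h1
  filter_upwards [h, h1 _ (half_pos hε)] with e he h1
  have h2 : ‖(b - c) - (b - c) * e‖ < ε / 2 := by
    rw [dist_comm, dist_eq_norm] at h1
    exact h1
  have h3 : b - b * e = (c - c * e) + ((b - c) - (b - c) * e) := by
    rw [sub_mul]; abel
  rw [h3]
  refine (norm_add_le _ _).trans ?_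
  have := he.2.2 c
  linarith

end ClosedIdeal

/-! ### Uniform approximation and lifting of continuous functions -/

/-- Pointwise eventual bounds on an eventually equi-Lipschitz family are uniform on totally
bounded sets. -/
lemma TotallyBounded.eventually_forall_le {E ι : Type*} [SeminormedAddCommGroup E] {S : Set E}
    (hS : TotallyBounded S) {l : Filter ι} {F : ι → E → ℝ}
    (hF : ∀ᶠ i in l, ∀ x y, F i x ≤ F i y + 2 * ‖x - y‖)
    (h : ∀ x, ∀ ε > 0, ∀ᶠ i in l, F i x ≤ ε) {ε : ℝ} (hε : 0 < ε) :
    ∀ᶠ i in l, ∀ x ∈ S, F i x ≤ ε := by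
  -- Moving by ε / 4 changes `F i` by at most ε / 2, which leaves ε / 2 for the points of the finite
  -- net.
  obtain ⟨t, ht, hSt⟩ := Metric.totallyBounded_iff.1 hS (ε / 4) (by positivity)
  have h1 : ∀ᶠ i in l, ∀ y ∈ t, F i y ≤ ε / 2 :=
    (eventually_all_finite ht).2 fun y _ => h y _ (half_pos hε)
  filter_upwards [hF, h1] with i hi h1 x hx
  obtain ⟨y, hy, hxy⟩ := Set.mem_iUnion₂.1 (hSt hx)
  rw [Metric.mem_ball, dist_eq_norm] at hxy
  have := hi x y
  have := h1 y hy
  linarith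

/-- Take a partition of unity subordinate to the sets on which `f` is within ε of one of finitely
many of its values. Such sums lift along B → B / J, since only finitely many vectors are involved.
-/
lemma ContinuousMap.exists_sum_smul_approx {K E : Type*} [TopologicalSpace K] [CompactSpace K]
    [T2Space K] [NormedAddCommGroup E] [NormedSpace ℂ E] (f : C(K, E)) {ε : ℝ} (hε : 0 < ε) :
    ∃ (n : ℕ) (ψ : Fin n → C(K, ℝ)) (k : Fin n → K),
      ∀ x, ‖f x - ∑ i, (ψ i x : ℂ) • f (k i)‖ ≤ ε := by
  obtain ⟨t, ht⟩ := isCompact_univ.elim_nhds_subcover (fun k : K => {y | ‖f y - f k‖ < ε})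
    fun k _ => (isOpen_lt (by fun_prop) continuous_const).mem_nhds (by simpa using hε)
  let k : Fin t.card → K := fun i => (t.equivFin.symm i : K)
  obtain ⟨ψ, h1, h2, h3, -⟩ := exists_continuous_sum_one_of_isOpen_isCompact (X := K)
    (s := fun i : Fin t.card => {y | ‖f y - f (k i)‖ < ε}) (t := Set.univ)
    (fun i => isOpen_lt (by fun_prop) continuous_const) isCompact_univ (by
      intro x _
      obtain ⟨y, hy, hxy⟩ := Set.mem_iUnion₂.1 (ht.2 (Set.mem_univ x))
      refine Set.mem_iUnion.2 ⟨t.equivFin ⟨y, hy⟩, ?_⟩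
      simpa [k] using hxy)
  refine ⟨_, ψ, k, fun x => ?_⟩
  have hsum : ∑ i, ψ i x = 1 := by simpa using h2 (Set.mem_univ x)
  have hf : f x = ∑ i, (ψ i x : ℂ) • f x := by
    rw [← Finset.sum_smul, ← Complex.ofReal_sum, hsum]; simp
  calc ‖f x - ∑ i, (ψ i x : ℂ) • f (k i)‖ = ‖∑ i, (ψ i x : ℂ) • (f x - f (k i))‖ := by
        conv_lhs => rw [hf]
        rw [← Finset.sum_sub_distrib]
        simp only [← smul_sub]
    _ ≤ ∑ i, ψ i x * ε := by
        refine norm_sum_le_of_le _ fun i _ => ?_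
        rw [norm_smul, Complex.norm_real, Real.norm_of_nonneg (h3 i x).1]
        by_cases hx : ψ i x = 0
        · simp [hx]
        · exact mul_le_mul_of_nonneg_left (le_of_lt (h1 i (subset_tsupport _ hx))) (h3 i x).1
    _ = ε := by rw [← Finset.sum_mul, hsum, one_mul]

namespace ClosedIdeal

/-- Continuous functions on a compact space lift along the quotient map `B → B / J`. -/
lemma exists_continuous_lift {B : Type*} [NonUnitalCStarAlgebra B] (J : ClosedIdeal B)
    {K : Type*} [TopologicalSpace K] [CompactSpace K] [T2Space K] (f : C(K, J.Quot)) :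
    ∃ g : C(K, B), ∀ x, Quot.mk (g x) = f x := by
  have hcont : Continuous J.proj :=
    NonUnitalStarAlgHom.instContinuousLinearMapClassComplex.map_continuous J.proj
  -- Composition with the projection is itself a ⋆-homomorphism of C⋆-algebras, so it is enough that
  -- its range is dense.
  let Φ : C(K, B) →⋆ₙₐ[ℂ] C(K, J.Quot) :=
    { toFun := fun g => ⟨fun x => J.proj (g x), hcont.comp g.continuous⟩
      map_smul' := fun c g => by ext x; exact map_smul J.proj c (g x)
      map_zero' := by ext x; exact map_zero J.proj
      map_add' := fun g h => by ext x; exact map_add J.proj (g x) (h x)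
      map_mul' := fun g h => by ext x; exact map_mul J.proj (g x) (h x)
      map_star' := fun g => by ext x; exact map_star J.proj (g x) }
  have hd : DenseRange Φ := by
    intro f
    rw [Metric.mem_closure_iff]
    intro ε hε
    obtain ⟨n, ψ, k, h⟩ := f.exists_sum_smul_approx (half_pos hε)
    choose b hb using fun i => Quot.mk_surjective J (f (k i))
    refine ⟨_, ⟨⟨fun x => ∑ i, (ψ i x : ℂ) • b i, by fun_prop⟩, rfl⟩, ?_⟩
    rw [dist_eq_norm]
    refine lt_of_le_of_lt ((ContinuousMap.norm_le _ (half_pos hε).le).2 fun x => ?_)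
      (half_lt_self hε)
    refine le_of_eq_of_le (congrArg norm ?_) (h x)
    change f x - J.proj (∑ i, (ψ i x : ℂ) • b i) = _
    rw [map_sum]
    simp only [map_smul, ← hb]
    rfl
  obtain ⟨g, hg⟩ := surjective_of_denseRange Φ hd f
  exact ⟨g, fun x => congrArg (fun h : C(K, J.Quot) => h x) hg⟩

end ClosedIdeal

/-! ### Representations that attain the norm of an element -/

section Functional

open scoped ComplexStarModule ComplexOrder

/-- This is the open convex set to which the Hahn–Banach theorem is applied below. A perturbation of
norm less than `r / 2` lowers the real part by at most `r / 2`. -/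
lemma isOpen_realPart_pos (D : Type*) [CStarAlgebra D] [PartialOrder D] [StarOrderedRing D] :
    IsOpen {x : D | ∃ r : ℝ, 0 < r ∧ algebraMap ℝ D r ≤ (ℜ x : D)} := by
  rw [Metric.isOpen_iff]
  rintro x ⟨r, hr, hx⟩
  refine ⟨r / 2, half_pos hr, fun y hy => ⟨r / 2, half_pos hr, ?_⟩⟩
  rw [Metric.mem_ball, dist_eq_norm] at hy
  have h1 : -algebraMap ℝ D ‖(ℜ (y - x) : D)‖ ≤ (ℜ (y - x) : D) :=
    IsSelfAdjoint.neg_algebraMap_norm_le_self (ℜ (y - x)).2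
  have h2 : algebraMap ℝ D ‖(ℜ (y - x) : D)‖ ≤ algebraMap ℝ D (r / 2) := by
    refine algebraMap_mono D (le_trans ?_ hy.le)
    exact realPart.norm_le (y - x)
  have h3 : (ℜ y : D) = ℜ x + ℜ (y - x) := by
    rw [map_sub, AddSubgroupClass.coe_sub]; abel
  rw [h3]
  calc algebraMap ℝ D (r / 2) = algebraMap ℝ D r + -algebraMap ℝ D (r / 2) := by
        rw [← map_neg, ← map_add]; congr 1; ring
    _ ≤ ℜ x + ℜ (y - x) := add_le_add hx ((neg_le_neg h2).trans h1)

lemma convex_realPart_pos (D : Type*) [CStarAlgebra D] [PartialOrder D] [StarOrderedRing D] :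
    Convex ℝ {x : D | ∃ r : ℝ, 0 < r ∧ algebraMap ℝ D r ≤ (ℜ x : D)} := by
  rintro x ⟨r, hr, hx⟩ y ⟨s, hs, hy⟩ a b ha hb hab
  refine ⟨a * r + b * s, ?_, ?_⟩
  · rcases ha.eq_or_lt with rfl | ha
    · rw [zero_add] at hab; subst hab; simpa using hs
    · have := mul_nonneg hb hs.le
      positivity
  · have h3 : (ℜ (a • x + b • y) : D) = a • (ℜ x : D) + b • (ℜ y : D) := by
      simp
    rw [h3, map_add]
    refine add_le_add ?_ ?_
    · rw [← smul_eq_mul, Algebra.algebraMap_eq_smul_one, smul_assoc,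
        ← Algebra.algebraMap_eq_smul_one]
      exact smul_le_smul_of_nonneg_left hx ha
    · rw [← smul_eq_mul, Algebra.algebraMap_eq_smul_one, smul_assoc,
        ← Algebra.algebraMap_eq_smul_one]
      exact smul_le_smul_of_nonneg_left hy hb

/-- A positive element of a unital C⋆-algebra attains its norm at some positive functional. -/
lemma exists_positiveLinearMap_apply_eq_norm {D : Type*} [CStarAlgebra D] [PartialOrder D]
    [StarOrderedRing D] [Nontrivial D] {b : D} (hb : 0 ≤ b) :
    ∃ τ : D →ₚ[ℂ] ℂ, τ b = ‖b‖ * τ 1 ∧ τ 1 ≠ 0 := by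
  set t : D := algebraMap ℝ D ‖b‖ - b with ht
  have hbs : IsSelfAdjoint b := .of_nonneg hb
  have ht0 : 0 ≤ t := sub_nonneg.2 hbs.le_algebraMap_norm_self
  -- The positive element `t` = ‖b‖ - b has no lower bound `r` > 0, since this would give ‖b‖ ≤ ‖b‖
  -- - r. It can thus be separated from the open set, and the negative of the separating functional
  -- turns out to be positive and to vanish at `t`.
  have htC : t ∉ {x : D | ∃ r : ℝ, 0 < r ∧ algebraMap ℝ D r ≤ (ℜ x : D)} := by
    rintro ⟨r, hr, h⟩
    rw [(IsSelfAdjoint.of_nonneg ht0).coe_realPart, ht, le_sub_comm, ← map_sub] at h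
    have h0 : 0 ≤ ‖b‖ - r := by
      have := hb.trans h
      rw [← map_zero (algebraMap ℝ D)] at this
      by_contra hlt
      have h' := algebraMap_mono D (not_le.1 hlt).le
      have := le_antisymm this h'
      exact (not_le.1 hlt).ne' ((algebraMap ℝ D).injective this)
    have := CStarAlgebra.norm_le_norm_of_nonneg_of_le hb h
    rw [norm_algebraMap', Real.norm_of_nonneg h0] at this
    linarith
  obtain ⟨f, hf⟩ := RCLike.geometric_hahn_banach_open_point (𝕜 := ℂ) (convex_realPart_pos D)
    (isOpen_realPart_pos D) htC
  have hre : ∀ x : D, 0 ≤ x → ∀ s : ℝ, 0 ≤ s → ∀ ε : ℝ, 0 < ε →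
      s * (f x).re + ε * (f 1).re < (f t).re := by
    intro x hx s hs ε hε
    have := hf (s • x + ε • 1) ⟨ε, hε, by
      have : 0 ≤ s • x + ε • (1 : D) :=
        add_nonneg (smul_nonneg hs hx) (smul_nonneg hε.le zero_le_one)
      rw [(IsSelfAdjoint.of_nonneg this).coe_realPart, Algebra.algebraMap_eq_smul_one]
      exact le_add_of_nonneg_left (smul_nonneg hs hx)⟩
    rw [← Complex.coe_smul, ← Complex.coe_smul, map_add, map_smul, map_smul] at this
    simpa using this
  -- The elements 1 - s i x have real part 1 for all real `s`, so the real part of `f` is bounded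
  -- above on this line and its slope, the imaginary part of `f x`, vanishes.
  have him : ∀ x : D, IsSelfAdjoint x → (f x).im = 0 := by
    intro x hx
    have key : ∀ s : ℝ, (f 1).re + s * (f x).im < (f t).re := by
      intro s
      have hm : (ℜ ((1 : D) + (-s : ℝ) • (Complex.I • x)) : D) = 1 := by
        rw [map_add, AddSubgroup.coe_add, (IsSelfAdjoint.one D).coe_realPart, map_smul,
          realPart_I_smul]
        simp [hx.imaginaryPart]
      have := hf ((1 : D) + (-s : ℝ) • (Complex.I • x)) ⟨1, one_pos, by rw [hm, map_one]⟩
      rw [← Complex.coe_smul, map_add, map_smul, map_smul] at this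
      simpa using this
    by_contra h
    have := key (((f t).re - (f 1).re) / (f x).im)
    rw [div_mul_cancel₀ _ h] at this
    linarith
  have hle : ∀ x : D, 0 ≤ x → (f x).re ≤ 0 := by
    intro x hx
    by_contra! h
    have h1 := hre x hx ((|(f t).re| + |(f 1).re|) / (f x).re) (by positivity) 1 one_pos
    rw [div_mul_cancel₀ _ h.ne'] at h1
    have := le_abs_self (f t).re
    have := neg_abs_le (f 1).re
    linarith
  -- One inequality is `hle`; the other is the limit ε → 0 of the separation inequality at the
  -- points ε 1.
  have hft : f t = 0 := by
    refine Complex.ext (le_antisymm (hle t ht0) ?_) (him t (.of_nonneg ht0))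
    have hlim : Tendsto (fun ε : ℝ => ε * (f 1).re) (𝓝[>] 0) (𝓝 (0 * (f 1).re)) :=
      ((continuous_id.mul continuous_const).tendsto 0).mono_left nhdsWithin_le_nhds
    rw [zero_mul] at hlim
    refine le_of_tendsto hlim (eventually_nhdsWithin_of_forall fun ε hε => ?_)
    have := hre 0 le_rfl 0 le_rfl ε hε
    simp only [zero_mul, zero_add] at this
    exact this.le
  have hf1 : (f 1).re < 0 := by
    have := hre 0 le_rfl 0 le_rfl 1 one_pos
    simpa [hft] using this
  refine ⟨PositiveLinearMap.mk₀ (-f.toLinearMap) fun x hx => ?_, ?_, ?_⟩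
  · have h1 := hle x hx
    have h2 := him x (.of_nonneg hx)
    rw [Complex.le_def]
    simp [h1, h2]
  · change -f b = ‖b‖ * -f 1
    have : f (algebraMap ℝ D ‖b‖) = ‖b‖ * f 1 := by
      rw [Algebra.algebraMap_eq_smul_one, ← Complex.coe_smul, map_smul, smul_eq_mul]
    rw [ht, map_sub, sub_eq_zero, this] at hft
    rw [← hft]; ring
  · change -f 1 ≠ 0
    intro h
    rw [neg_eq_zero] at h
    simp [h] at hf1

/-- For each element of a C⋆-algebra there is a representation on a Hilbert space and a vector at
which the element attains its norm. -/
lemma exists_representation_norm_attained.{w} {A : Type w} [NonUnitalCStarAlgebra A] (a : A) :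
    ∃ (H : Type w) (_ : NormedAddCommGroup H) (_ : InnerProductSpace ℂ H) (_ : CompleteSpace H)
      (π : A →⋆ₙₐ[ℂ] (H →L[ℂ] H)) (ξ : H), ξ ≠ 0 ∧ ‖π a ξ‖ = ‖a‖ * ‖ξ‖ := by
  let := CStarAlgebra.spectralOrder (Unitization ℂ A)
  let := CStarAlgebra.spectralOrderedRing (Unitization ℂ A)
  -- In the GNS representation of a functional that attains the norm of a⋆a, the class ξ of 1
  -- satisfies ‖π(a)ξ‖² = τ(a⋆a) = ‖a‖² τ(1).
  obtain ⟨τ, h1, h2⟩ := exists_positiveLinearMap_apply_eq_norm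
    (star_mul_self_nonneg (a : Unitization ℂ A))
  have hn : ∀ x : Unitization ℂ A, ‖(τ.toPreGNS x : τ.GNS)‖ ^ 2 = τ (star x * x) := fun x => by
    rw [UniformSpace.Completion.norm_coe, τ.preGNS_norm_sq]
    rfl
  refine ⟨τ.GNS, inferInstance, inferInstance, inferInstance,
    τ.gnsNonUnitalStarAlgHom.comp (Unitization.inrNonUnitalStarAlgHom ℂ A), τ.toPreGNS 1, ?_, ?_⟩
  · intro h0
    have := hn 1
    rw [h0] at this
    simp at this
    exact h2 this.symm
  · rw [← sq_eq_sq₀ (norm_nonneg _) (mul_nonneg (norm_nonneg _) (norm_nonneg _)), mul_pow,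
      ← Complex.ofReal_inj]
    have h3 : (τ.gnsNonUnitalStarAlgHom.comp (Unitization.inrNonUnitalStarAlgHom ℂ A)) a
        (τ.toPreGNS 1 : τ.GNS) = (τ.toPreGNS (a : Unitization ℂ A) : τ.GNS) := by
      change τ.gnsNonUnitalStarAlgHom (a : Unitization ℂ A) _ = _
      rw [τ.gnsNonUnitalStarAlgHom_apply_coe, τ.leftMulMapPreGNS_apply]
      simp
    rw [h3]
    push_cast
    rw [hn, hn, h1, CStarRing.norm_star_mul_self, Unitization.norm_inr]
    push_cast
    simp [sq]

end Functional

/-- A small Hilbert space has an isometric copy in the smaller universe. -/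
lemma exists_shrink_hilbert.{w, w'} {K : Type w'} [NormedAddCommGroup K] [InnerProductSpace ℂ K]
    [CompleteSpace K] [Small.{w} K] :
    ∃ (H : Type w) (_ : NormedAddCommGroup H) (_ : InnerProductSpace ℂ H) (_ : CompleteSpace H),
      Nonempty (H ≃ₗᵢ[ℂ] K) := by
  let e : Shrink.{w} K ≃ₗ[ℂ] K := Shrink.linearEquiv ℂ K
  let i1 : NormedAddCommGroup (Shrink.{w} K) :=
    NormedAddCommGroup.induced _ K e.toLinearMap e.injective
  let i2 : InnerProductSpace ℂ (Shrink.{w} K) :=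
    { NormedSpace.induced ℂ (Shrink.{w} K) K e.toLinearMap with
      inner := fun x y => inner ℂ (e x) (e y)
      norm_sq_eq_re_inner := fun x => norm_sq_eq_re_inner (𝕜 := ℂ) (e x)
      conj_inner_symm := fun x y => inner_conj_symm (e x) (e y)
      add_left := fun x y z => by
        change inner ℂ (e (x + y)) (e z) = _
        rw [map_add, inner_add_left]
      smul_left := fun x y r => by
        change inner ℂ (e (r • x)) (e y) = _
        rw [map_smul, inner_smul_left] }
  let f : Shrink.{w} K ≃ₗᵢ[ℂ] K := ⟨e, fun x => rfl⟩
  exact ⟨Shrink.{w} K, i1, i2, f.toIsometryEquiv.completeSpace, ⟨f⟩⟩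

/-! ### Compactly supported functions on a non-Hausdorff space -/

namespace Cc

variable {X B C : Type*} [TopologicalSpace X] [NonUnitalCStarAlgebra B] [NonUnitalCStarAlgebra C]

/-- Elements of C_c(X, B) need not be continuous on `X`, as compact sets need not be closed. Their
preimages in the Hausdorff space `Y` are, so an elementary `f ∘ i` vanishes near each point outside
the preimage of `U`. -/
lemma continuous_comp {Y : Type*} [TopologicalSpace Y] [T2Space Y] {i : Y → X} (hi : Continuous i)
    (hK : ∀ K, IsCompact K → IsCompact (i ⁻¹' K)) {f : X → B} (hf : f ∈ Cc X B) :
    Continuous (f ∘ i) := by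
  refine induction (p := fun f => Continuous (f ∘ i)) ?_ continuous_const
    (fun f g hf hg => hf.add hg) (fun c f hf => hf.const_smul c) hf
  rintro f ⟨U, hU, -, hc, K, hKU, hKc, h0⟩
  rw [continuous_iff_continuousAt]
  intro y
  by_cases hy : i y ∈ U
  · exact (hc.continuousAt (hU.mem_nhds hy)).comp hi.continuousAt
  · have h : ∀ᶠ z in 𝓝 y, (f ∘ i) z = 0 := by
      filter_upwards [(hK K hKc).isClosed.isOpen_compl.mem_nhds fun h => hy (hKU h)] with z hz
      exact h0 _ hz
    exact continuousAt_const.congr (EventuallyEq.symm h)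

/-- Compactness of the set of values turns pointwise convergence along an approximate unit of `J`
into uniform convergence. -/
lemma exists_isCompact_forall_mem {f : X → B} (hf : f ∈ Cc X B) :
    ∃ S : Set B, IsCompact S ∧ ∀ x, f x ∈ S := by
  refine induction (p := fun f => ∃ S : Set B, IsCompact S ∧ ∀ x, f x ∈ S) ?_ ?_ ?_ ?_ hf
  · rintro f ⟨U, hU, -, hc, K, hKU, hKc, h0⟩
    refine ⟨f '' K ∪ {0}, (hKc.image_of_continuousOn (hc.mono hKU)).union isCompact_singleton,
      fun x => ?_⟩
    by_cases hx : x ∈ K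
    · exact Or.inl ⟨x, hx, rfl⟩
    · exact Or.inr (h0 x hx)
  · exact ⟨{0}, isCompact_singleton, fun x => rfl⟩
  · rintro f g ⟨S, hS, hf⟩ ⟨T, hT, hg⟩
    exact ⟨(fun q : B × B => q.1 + q.2) '' S ×ˢ T, (hS.prod hT).image continuous_add,
      fun x => ⟨(f x, g x), ⟨hf x, hg x⟩, rfl⟩⟩
  · rintro c f ⟨S, hS, hf⟩
    exact ⟨(fun b : B => c • b) '' S, hS.image (continuous_const_smul c),
      fun x => ⟨f x, hf x, rfl⟩⟩

lemma clm_comp_mem (φ : B →L[ℂ] C) {f : X → B} (hf : f ∈ Cc X B) : φ ∘ f ∈ Cc X C := by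
  refine induction (p := fun f => φ ∘ f ∈ Cc X C) ?_ ?_ ?_ ?_ hf
  · rintro f ⟨U, hU, hT, hc, K, hK, hKc, h0⟩
    exact Submodule.subset_span ⟨U, hU, hT, φ.continuous.comp_continuousOn hc, K, hK, hKc,
      fun x hx => by simp [h0 x hx]⟩
  · convert zero_mem (Cc X C)
    ext x; simp
  · intro f g hf hg
    convert add_mem hf hg
    ext x; simp
  · intro c f hf
    convert Submodule.smul_mem _ c hf
    ext x; simp

lemma isCompact_preimage_val {U K : Set X} (hK : IsCompact K) (hKU : K ⊆ U) :
    IsCompact ((fun x : U => (x : X)) ⁻¹' K) :=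
  (IsInducing.subtypeVal.isCompact_preimage_iff (by simpa using hKU)).2 hK

lemma t2Space_of_subset {U V : Set X} (hUV : U ⊆ V) (hV : T2Space V) : T2Space U :=
  T2Space.of_injective_continuous (Set.inclusion_injective hUV) (continuous_inclusion hUV)

/-- To prove an additive property of all functions in `C_c(X, B)` it suffices to prove it for
those supported near a given point. -/
lemma induction_local [LocallyCompactSpace X] {p : (X → B) → Prop} (h0 : p 0)
    (hadd : ∀ f g, p f → p g → p (f + g))
    (h : ∀ x, ∃ N ∈ 𝓝 x, ∀ (f : X → B) (U K : Set X), IsOpen U → T2Space U → U ⊆ N →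
      ContinuousOn f U → IsCompact K → K ⊆ U → (∀ y ∉ K, f y = 0) → p f)
    {f : X → B} (hf : f ∈ Cc X B) : p f := by
  classical
  -- Invariance of `p` under scalars is not assumed, so the induction runs over all multiples at
  -- once.
  suffices ∀ c : ℂ, p (c • f) by simpa using this 1
  refine induction (p := fun f => ∀ c : ℂ, p (c • f)) ?_ (fun c => by simpa using h0) ?_ ?_ hf
  · rintro f ⟨U, hU, hT, hc, K, hKU, hK, hf0⟩ c
    choose N hN hNp using h
    have : LocallyCompactSpace U := hU.locallyCompactSpace
    obtain ⟨t, ht⟩ := (isCompact_preimage_val hK hKU).elim_nhds_subcover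
      (fun x : U => (fun y : U => (y : X)) ⁻¹' interior (N x))
      fun x _ => (isOpen_interior.preimage continuous_subtype_val).mem_nhds
        (mem_interior_iff_mem_nhds.2 (hN x))
    -- The partition of unity lives on the Hausdorff space `U`; its products with `f` are then
    -- extended by zero.
    obtain ⟨ψ, hψ, hψc⟩ := PartitionOfUnity.exists_isSubordinate_of_locallyFinite_t2space
      (isCompact_preimage_val hK hKU)
      (fun x : t => (fun y : U => (y : X)) ⁻¹' interior (N (x : U)))
      (fun x => isOpen_interior.preimage continuous_subtype_val) (locallyFinite_of_finite _)
      (by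
        intro y hy
        obtain ⟨x, hx, hxy⟩ := Set.mem_iUnion₂.1 (ht.2 hy)
        exact Set.mem_iUnion.2 ⟨⟨x, hx⟩, hxy⟩)
    let g : t → X → B := fun i y => if hy : y ∈ U then (ψ i ⟨y, hy⟩ : ℂ) • (c • f y) else 0
    have hg : c • f = ∑ i, g i := by
      ext y
      rw [Finset.sum_apply, Pi.smul_apply]
      by_cases hy : y ∈ K
      · have hsum : ∑ i, ψ i ⟨y, hKU hy⟩ = 1 := by
          rw [← finsum_eq_sum_of_fintype]
          exact ψ.sum_eq_one (x := ⟨y, hKU hy⟩) hy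
        simp only [g, dif_pos (hKU hy)]
        rw [← Finset.sum_smul, ← Complex.ofReal_sum, hsum, Complex.ofReal_one, one_smul]
      · simp [g, hf0 y hy]
    rw [hg]
    refine Finset.sum_induction _ p hadd h0 fun i _ => ?_
    refine hNp i (g i) (U ∩ interior (N i)) ((fun x : U => (x : X)) '' tsupport (ψ i))
      (hU.inter isOpen_interior) (t2Space_of_subset Set.inter_subset_left hT)
      (Set.inter_subset_right.trans interior_subset) ?_ ((hψc i).image continuous_subtype_val) ?_ ?_
    · refine ContinuousOn.mono ?_ Set.inter_subset_left
      rw [continuousOn_iff_continuous_domRestrict] at hc ⊢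
      have : U.domRestrict (g i) = fun x : U => (ψ i x : ℂ) • (c • U.domRestrict f x) := by
        ext x
        simp [g]
      rw [this]
      exact (Complex.continuous_ofReal.comp (ψ i).continuous).smul (hc.const_smul c)
    · rintro _ ⟨x, hx, rfl⟩
      exact ⟨x.2, hψ i hx⟩
    · intro y hy
      by_cases hyU : y ∈ U
      · have : ψ i ⟨y, hyU⟩ = 0 := image_eq_zero_of_notMem_tsupport fun h => hy ⟨_, h, rfl⟩
        simp [g, hyU, this]
      · simp [g, hyU]
  · intro f g hf hg c
    rw [smul_add]
    exact hadd _ _ (hf c) (hg c)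
  · intro d f hf c
    rw [smul_smul]
    exact hf _

/-- The map `C_c(X, B) → C_c(X, B / J)` is surjective. -/
lemma map_proj_surjective [LocallyCompactSpace X] (J : ClosedIdeal B) :
    Function.Surjective (Cc.map (X := X) J.proj) := by
  classical
  suffices ∀ f ∈ Cc X J.Quot, ∃ g : Cc X B, ∀ x, ClosedIdeal.Quot.mk (g x) = f x by
    intro f
    obtain ⟨g, hg⟩ := this f f.2
    exact ⟨g, Subtype.ext (funext hg)⟩
  intro f hf
  refine induction (p := fun f => ∃ g : Cc X B, ∀ x, ClosedIdeal.Quot.mk (g x) = f x) ?_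
    ⟨0, fun x => rfl⟩ ?_ ?_ hf
  · rintro f ⟨U, hU, hT, hc, K, hKU, hK, hf0⟩
    have : LocallyCompactSpace U := hU.locallyCompactSpace
    -- Lift `f` over a compact neighbourhood `L` of `K` and multiply by a cut-off equal to 1 on `K`
    -- and supported inside `L`. The class is unchanged because `f` vanishes off `K`.
    obtain ⟨L, hL, hKL⟩ := exists_compact_superset (isCompact_preimage_val hK hKU)
    obtain ⟨χ, hχ1, hχ2, -, hχ3⟩ := exists_continuous_sum_one_of_isOpen_isCompact (n := 1)
      (s := fun _ => interior L) (fun _ => isOpen_interior) (isCompact_preimage_val hK hKU)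
      (fun x hx => Set.mem_iUnion.2 ⟨0, hKL hx⟩)
    rw [continuousOn_iff_continuous_domRestrict] at hc
    have : CompactSpace L := isCompact_iff_compactSpace.1 hL
    obtain ⟨g, hg⟩ := J.exists_continuous_lift
      ⟨fun x : L => U.domRestrict f x, hc.comp continuous_subtype_val⟩
    let F : U → B := fun y => if hy : y ∈ L then (χ 0 y : ℂ) • g ⟨y, hy⟩ else 0
    have hF0 : ∀ y, y ∉ tsupport (χ 0) → F y = 0 := fun y hy => by
      simp only [F, image_eq_zero_of_notMem_tsupport hy]
      simp
    have hF : Continuous F := by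
      rw [continuous_iff_continuousAt]
      intro y
      by_cases hy : y ∈ tsupport (χ 0)
      · have hyL := hχ1 0 hy
        have h1 : ContinuousOn F (interior L) := by
          rw [continuousOn_iff_continuous_domRestrict]
          have : (interior L).domRestrict F =
              fun x : interior L => (χ 0 x : ℂ) • g (Set.inclusion interior_subset x) := by
            ext x
            have : (x : U) ∈ L := interior_subset x.2
            simp [F, this, Set.inclusion]
          rw [this]
          have := continuous_inclusion (interior_subset (s := L))
          fun_prop
        exact h1.continuousAt (isOpen_interior.mem_nhds hyL)
      · have h : ∀ᶠ z in 𝓝 y, F z = 0 := by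
          filter_upwards [(isClosed_tsupport (χ 0)).isOpen_compl.mem_nhds hy] with z hz
          exact hF0 z hz
        exact continuousAt_const.congr (EventuallyEq.symm h)
    refine ⟨⟨fun x => if hx : x ∈ U then F ⟨x, hx⟩ else 0, Submodule.subset_span
      ⟨U, hU, hT, ?_, (fun x : U => (x : X)) '' tsupport (χ 0), ?_, ?_, ?_⟩⟩, ?_⟩
    · rw [continuousOn_iff_continuous_domRestrict]
      convert hF using 1
      ext x
      simp
    · rintro _ ⟨x, hx, rfl⟩
      exact x.2
    · exact (hχ3 0).image continuous_subtype_val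
    · intro y hy
      dsimp only
      split_ifs with h
      · exact hF0 _ fun h' => hy ⟨_, h', rfl⟩
      · rfl
    · intro x
      dsimp only
      split_ifs with hx
      · by_cases hxL : (⟨x, hx⟩ : U) ∈ L
        · simp only [F, dif_pos hxL]
          rw [ClosedIdeal.Quot.mk_smul, hg]
          change _ • f x = f x
          by_cases hxK : x ∈ K
          · have : χ 0 ⟨x, hx⟩ = 1 := by simpa using hχ2 (show (⟨x, hx⟩ : U) ∈ _ from hxK)
            rw [this, Complex.ofReal_one, one_smul]
          · rw [hf0 x hxK, smul_zero]
        · simp only [F, dif_neg hxL]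
          rw [ClosedIdeal.Quot.mk_zero, hf0 x fun h => hxL (interior_subset (hKL h))]
      · rw [ClosedIdeal.Quot.mk_zero, hf0 x fun h => hx (hKU h)]
  · rintro f g ⟨f', hf⟩ ⟨g', hg⟩
    exact ⟨f' + g', fun x => by rw [Pi.add_apply, ← hf, ← hg]; rfl⟩
  · rintro c f ⟨f', hf⟩
    exact ⟨c • f', fun x => by rw [Pi.smul_apply, ← hf]; rfl⟩

end Cc

/-! ### Source fibres and convolution integrals -/

section Groupoid

universe u v

variable {EG EM : Type*} [NormedAddCommGroup EG] [NormedSpace ℝ EG] [FiniteDimensional ℝ EG]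
  [NormedAddCommGroup EM] [NormedSpace ℝ EM]
variable {G : Type u} {M : Type*}
  [TopologicalSpace G] [ChartedSpace EG G] [IsManifold 𝓘(ℝ, EG) ∞ G]
  [TopologicalSpace M] [T2Space M] [ChartedSpace EM M] [IsManifold 𝓘(ℝ, EM) ∞ M]

namespace LieGroupoid

variable (𝒢 : LieGroupoid EG EM G M)

lemma continuous_src : Continuous 𝒢.src := 𝒢.src_submersion.contMDiff.continuous

lemma continuous_rng : Continuous 𝒢.rng := 𝒢.rng_submersion.contMDiff.continuous

lemma continuous_inv : Continuous 𝒢.inv := 𝒢.inv_smooth.continuous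

lemma tendsto_mul {ι : Type*} {F : Filter ι} {a b : ι → G} {γ η : G} (ha : Tendsto a F (𝓝 γ))
    (hb : Tendsto b F (𝓝 η)) (h : ∀ᶠ i in F, 𝒢.src (a i) = 𝒢.rng (b i))
    (h0 : 𝒢.src γ = 𝒢.rng η) : Tendsto (fun i => 𝒢.mul (a i) (b i)) F (𝓝 (𝒢.mul γ η)) := by
  have h1 := 𝒢.mul_smooth.continuousOn (γ, η) h0
  exact h1.tendsto.comp (tendsto_nhdsWithin_iff.2 ⟨ha.prodMk_nhds hb, h⟩)

lemma inv_mul_cancel_left {γ η : G} (h : 𝒢.src γ = 𝒢.rng η) :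
    𝒢.mul (𝒢.inv γ) (𝒢.mul γ η) = η := by
  rw [← 𝒢.mul_assoc _ _ _ (𝒢.src_inv γ) h, 𝒢.inv_mul, h, 𝒢.one_mul]

lemma mul_inv_cancel_left {γ η : G} (h : 𝒢.rng γ = 𝒢.rng η) :
    𝒢.mul γ (𝒢.mul (𝒢.inv γ) η) = η := by
  rw [← 𝒢.mul_assoc _ _ _ (𝒢.rng_inv γ).symm ((𝒢.src_inv γ).trans h), 𝒢.mul_inv, h, 𝒢.one_mul]

lemma inv_mul_cancel_right {γ η : G} (h : 𝒢.src γ = 𝒢.src η) :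
    𝒢.mul (𝒢.mul γ (𝒢.inv η)) η = γ := by
  rw [𝒢.mul_assoc _ _ _ (h.trans (𝒢.rng_inv η).symm) (𝒢.src_inv η), 𝒢.inv_mul, ← h, 𝒢.mul_one]

lemma mul_inv_cancel_right {γ η : G} (h : 𝒢.src γ = 𝒢.rng η) :
    𝒢.mul (𝒢.mul γ η) (𝒢.inv η) = γ := by
  rw [𝒢.mul_assoc _ _ _ h (𝒢.rng_inv η).symm, 𝒢.mul_inv, ← h, 𝒢.mul_one]

lemma inv_mul_rev {γ η : G} (h : 𝒢.src γ = 𝒢.rng η) :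
    𝒢.inv (𝒢.mul γ η) = 𝒢.mul (𝒢.inv η) (𝒢.inv γ) := by
  have h1 : 𝒢.src (𝒢.inv η) = 𝒢.rng (𝒢.inv γ) := by rw [𝒢.src_inv, 𝒢.rng_inv, h]
  have h2 : 𝒢.mul (𝒢.mul γ η) (𝒢.mul (𝒢.inv η) (𝒢.inv γ)) = 𝒢.one (𝒢.rng γ) := by
    rw [𝒢.mul_assoc _ _ _ h (by rw [𝒢.rng_mul _ _ h1, 𝒢.rng_inv]),
      𝒢.mul_inv_cancel_left (by rw [𝒢.rng_inv, h]), 𝒢.mul_inv]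
  have h3 : 𝒢.src (𝒢.mul γ η) = 𝒢.rng (𝒢.mul (𝒢.inv η) (𝒢.inv γ)) := by
    rw [𝒢.src_mul _ _ h, 𝒢.rng_mul _ _ h1, 𝒢.rng_inv]
  have h4 := 𝒢.inv_mul_cancel_left h3
  rw [h2, ← 𝒢.rng_mul _ _ h, ← 𝒢.src_inv, 𝒢.mul_one] at h4
  exact h4

/-- If arrows z of the fibre converge to both γ and η, then γ and η have the same range, as `M` is
Hausdorff, and η⁻¹γ is a limit of the constant z⁻¹z = 1. Points of `G` are closed, so η⁻¹γ = 1. -/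
instance (x : M) : T2Space (𝒢.Fiber x) := by
  have : T1Space G := ChartedSpace.t1Space EG G
  refine t2_iff_ultrafilter.2 fun {γ η} F hγ hη => ?_
  have hγ' : Tendsto (fun z : 𝒢.Fiber x => (z : G)) F (𝓝 γ) :=
    (Fiber.continuous_val.tendsto γ).comp hγ
  have hη' : Tendsto (fun z : 𝒢.Fiber x => (z : G)) F (𝓝 η) :=
    (Fiber.continuous_val.tendsto η).comp hη
  have hr : 𝒢.rng γ = 𝒢.rng η :=
    tendsto_nhds_unique ((𝒢.continuous_rng.tendsto _).comp hγ')
      ((𝒢.continuous_rng.tendsto _).comp hη')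
  have h := 𝒢.tendsto_mul ((𝒢.continuous_inv.tendsto _).comp hη') hγ'
    (Eventually.of_forall fun z => 𝒢.src_inv z) ((𝒢.src_inv _).trans hr.symm)
  have h1 : (fun z : 𝒢.Fiber x => 𝒢.mul ((𝒢.inv ∘ fun z : 𝒢.Fiber x => (z : G)) z) z)
      = fun _ => 𝒢.one x := by
    ext z
    rw [Function.comp_apply, 𝒢.inv_mul, z.src_val]
  rw [h1, tendsto_const_nhds_iff] at h
  have h2 := 𝒢.mul_inv_cancel_left hr.symm
  have h3 := 𝒢.mul_one (η : G)
  rw [η.src_val] at h3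
  rw [← h, h3] at h2
  exact Subtype.ext h2.symm

variable {𝒢} in
lemma Fiber.isCompact_preimage {x : M} {K : Set G} (hK : IsCompact K) :
    IsCompact ((fun γ : 𝒢.Fiber x => (γ : G)) ⁻¹' K) :=
  Fiber.isClosedEmbedding.isCompact_preimage hK

variable {B : Type v} [NonUnitalCStarAlgebra B]

lemma continuous_restrict_fiber {f : G → B} (hf : f ∈ Cc G B) (x : M) :
    Continuous (fun γ : 𝒢.Fiber x => f γ) :=
  Cc.continuous_comp Fiber.continuous_val (fun _ hK => Fiber.isCompact_preimage hK) hf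

/-- The map η ↦ γη⁻¹ is proper on the fibre: the preimage of `K` consists of the arrows k⁻¹γ with
`k` in the compact set of elements of `K` that have the range of γ. -/
lemma continuous_translate_fiber {f : G → B} (hf : f ∈ Cc G B) (γ : G) :
    Continuous (fun η : 𝒢.Fiber (𝒢.src γ) => f (𝒢.mul γ (𝒢.inv η))) := by
  have hcomp : ∀ η : 𝒢.Fiber (𝒢.src γ), 𝒢.src γ = 𝒢.rng (𝒢.inv η) := fun η => by
    rw [𝒢.rng_inv, η.src_val]
  refine Cc.continuous_comp (i := fun η : 𝒢.Fiber (𝒢.src γ) => 𝒢.mul γ (𝒢.inv η)) ?_ ?_ hf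
  · rw [continuous_iff_continuousAt]
    intro η
    exact 𝒢.tendsto_mul tendsto_const_nhds
      ((𝒢.continuous_inv.comp Fiber.continuous_val).tendsto η)
      (Eventually.of_forall hcomp) (hcomp η)
  · intro K hK
    have h1 : IsCompact (K ∩ {k | 𝒢.rng k = 𝒢.rng γ}) :=
      hK.inter_right (isClosed_singleton.preimage 𝒢.continuous_rng)
    have h2 : ContinuousOn (fun k => 𝒢.mul (𝒢.inv k) γ) (K ∩ {k | 𝒢.rng k = 𝒢.rng γ}) := by
      intro k hk
      exact 𝒢.tendsto_mul (𝒢.continuous_inv.continuousWithinAt.tendsto) tendsto_const_nhds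
        (eventually_nhdsWithin_of_forall fun k hk => (𝒢.src_inv k).trans hk.2)
        ((𝒢.src_inv k).trans hk.2)
    convert Fiber.isCompact_preimage (𝒢 := 𝒢) (x := 𝒢.src γ) (h1.image_of_continuousOn h2) using 1
    ext η
    constructor
    · intro hη
      refine ⟨_, ⟨hη, 𝒢.rng_mul _ _ (hcomp η)⟩, ?_⟩
      change 𝒢.mul (𝒢.inv (𝒢.mul γ (𝒢.inv η))) γ = η
      rw [𝒢.inv_mul_rev (hcomp η), 𝒢.inv_inv, 𝒢.inv_mul_cancel_right]
      exact η.src_val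
    · rintro ⟨k, ⟨hk, hkr⟩, hkη⟩
      replace hkη : 𝒢.mul (𝒢.inv k) γ = η := hkη
      change 𝒢.mul γ (𝒢.inv η) ∈ K
      have : 𝒢.mul γ (𝒢.inv η) = k := by
        rw [← hkη, 𝒢.inv_mul_rev ((𝒢.src_inv k).trans hkr), 𝒢.inv_inv,
          𝒢.mul_inv_cancel_left hkr.symm]
      rwa [this]

namespace HaarSystem

variable {𝒢} (μ : 𝒢.HaarSystem) {B₁ B₂ B₃ : Type*} [NonUnitalCStarAlgebra B₁]
  [NonUnitalCStarAlgebra B₂] [NonUnitalCStarAlgebra B₃]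

/-- The constant is a bound, uniform in `x`, for the mass of `K` in the fibre over `x`. -/
lemma exists_lintegral_enorm_le {E : Type*} [NormedAddCommGroup E] {K : Set G} (hK : IsCompact K) :
    ∃ C : ℝ, 0 ≤ C ∧ ∀ (x : M) (F : 𝒢.Fiber x → E) (ε : ℝ), (∀ γ, ‖F γ‖ ≤ ε) →
      (∀ γ : 𝒢.Fiber x, (γ : G) ∉ K → F γ = 0) →
      ∫⁻ γ, ‖F γ‖ₑ ∂(μ.meas x) ≤ ENNReal.ofReal (C * ε) := by
  obtain ⟨C, hC, h⟩ := μ.exists_meas_le hK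
  refine ⟨C.toReal, ENNReal.toReal_nonneg, fun x F ε hε hF => ?_⟩
  calc ∫⁻ γ : 𝒢.Fiber x, ‖F γ‖ₑ ∂(μ.meas x)
      ≤ ∫⁻ γ : 𝒢.Fiber x, Set.indicator {γ : 𝒢.Fiber x | (γ : G) ∈ K}
          (fun _ => ENNReal.ofReal ε) γ ∂(μ.meas x) := by
        refine lintegral_mono fun γ => ?_
        by_cases hγ : γ ∈ {γ : 𝒢.Fiber x | (γ : G) ∈ K}
        · rw [Set.indicator_of_mem hγ, ← ofReal_norm]
          exact ENNReal.ofReal_le_ofReal (hε _)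
        · rw [Set.indicator_of_notMem hγ, hF _ hγ]
          simp
    _ ≤ ENNReal.ofReal ε * μ.meas x {γ : 𝒢.Fiber x | (γ : G) ∈ K} :=
        lintegral_indicator_const_le _ _
    _ ≤ ENNReal.ofReal ε * C := by gcongr; exact h x
    _ = ENNReal.ofReal (C.toReal * ε) := by
        rw [ENNReal.ofReal_mul ENNReal.toReal_nonneg, ENNReal.ofReal_toReal hC, mul_comm]

lemma exists_norm_integral_le {E : Type*} [NormedAddCommGroup E] [NormedSpace ℝ E] {K : Set G}
    (hK : IsCompact K) :
    ∃ C : ℝ, 0 ≤ C ∧ ∀ (x : M) (F : 𝒢.Fiber x → E) (ε : ℝ), 0 ≤ ε → (∀ γ, ‖F γ‖ ≤ ε) →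
      (∀ γ : 𝒢.Fiber x, (γ : G) ∉ K → F γ = 0) → ‖∫ γ, F γ ∂(μ.meas x)‖ ≤ C * ε := by
  obtain ⟨C, hC, h⟩ := μ.exists_lintegral_enorm_le (E := E) hK
  refine ⟨C, hC, fun x F ε h0 hε hF => ?_⟩
  have := (enorm_integral_le_lintegral_enorm _).trans (h x F ε hε hF)
  rwa [← ofReal_norm, ENNReal.ofReal_le_ofReal_iff (mul_nonneg hC h0)] at this

lemma integrable_of_mem_Cc {f : G → B₁} (hf : f ∈ Cc G B₁) (x : M) :
    Integrable (fun γ : 𝒢.Fiber x => f γ) (μ.meas x) := by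
  have := μ.regular x
  obtain ⟨K, hK, -, -, hf0⟩ := Cc.bounded hf
  exact (𝒢.continuous_restrict_fiber hf x).integrable_of_hasCompactSupport
    (HasCompactSupport.intro (Fiber.isCompact_preimage hK) fun γ hγ => hf0 γ hγ)

/-- Convolution with respect to a bounded bilinear map. -/
noncomputable def convBilin (β : B₁ →L[ℂ] B₂ →L[ℂ] B₃) (f : G → B₁) (g : G → B₂) (γ : G) : B₃ :=
  ∫ η : 𝒢.Fiber (𝒢.src γ), β (f (𝒢.mul γ (𝒢.inv η))) (g η) ∂(μ.meas (𝒢.src γ))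

variable {μ} in
lemma integrable_convBilin (β : B₁ →L[ℂ] B₂ →L[ℂ] B₃) {f : G → B₁} {g : G → B₂}
    (hf : f ∈ Cc G B₁) (hg : g ∈ Cc G B₂) (γ : G) :
    Integrable (fun η : 𝒢.Fiber (𝒢.src γ) => β (f (𝒢.mul γ (𝒢.inv η))) (g η))
      (μ.meas (𝒢.src γ)) := by
  have := μ.regular (𝒢.src γ)
  obtain ⟨K, hK, -, -, hg0⟩ := Cc.bounded hg
  refine Continuous.integrable_of_hasCompactSupport ?_
    (HasCompactSupport.intro (Fiber.isCompact_preimage hK) fun η hη => ?_)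
  · exact (β.continuous.comp (𝒢.continuous_translate_fiber hf γ)).clm_apply
      (𝒢.continuous_restrict_fiber hg _)
  · rw [hg0 η hη, map_zero]

lemma convBilin_add_left (β : B₁ →L[ℂ] B₂ →L[ℂ] B₃) {f f' : G → B₁} {g : G → B₂}
    (hf : f ∈ Cc G B₁) (hf' : f' ∈ Cc G B₁) (hg : g ∈ Cc G B₂) :
    μ.convBilin β (f + f') g = μ.convBilin β f g + μ.convBilin β f' g := by
  ext γ
  rw [Pi.add_apply, convBilin, convBilin, convBilin,
    ← integral_add (integrable_convBilin β hf hg γ) (integrable_convBilin β hf' hg γ)]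
  simp

lemma convBilin_add_right (β : B₁ →L[ℂ] B₂ →L[ℂ] B₃) {f : G → B₁} {g g' : G → B₂}
    (hf : f ∈ Cc G B₁) (hg : g ∈ Cc G B₂) (hg' : g' ∈ Cc G B₂) :
    μ.convBilin β f (g + g') = μ.convBilin β f g + μ.convBilin β f g' := by
  ext γ
  rw [Pi.add_apply, convBilin, convBilin, convBilin,
    ← integral_add (integrable_convBilin β hf hg γ) (integrable_convBilin β hf hg' γ)]
  simp

lemma convBilin_zero_left (β : B₁ →L[ℂ] B₂ →L[ℂ] B₃) (g : G → B₂) :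
    μ.convBilin β 0 g = 0 := by
  ext γ
  simp [convBilin]

lemma convBilin_zero_right (β : B₁ →L[ℂ] B₂ →L[ℂ] B₃) (f : G → B₁) :
    μ.convBilin β f 0 = 0 := by
  ext γ
  simp [convBilin]

end HaarSystem

/-- The set of products of composable arrows in `K` and `L`. -/
def mulSet (K L : Set G) : Set G :=
  (fun p : G × G => 𝒢.mul p.1 p.2) '' (K ×ˢ L ∩ {p | 𝒢.src p.1 = 𝒢.rng p.2})

lemma isCompact_mulSet {K L : Set G} (hK : IsCompact K) (hL : IsCompact L) :
    IsCompact (𝒢.mulSet K L) := by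
  refine ((hK.prod hL).inter_right ?_).image_of_continuousOn
    (𝒢.mul_smooth.continuousOn.mono Set.inter_subset_right)
  exact isClosed_eq (𝒢.continuous_src.comp continuous_fst) (𝒢.continuous_rng.comp continuous_snd)

namespace HaarSystem

variable {𝒢} (μ : 𝒢.HaarSystem) {B₁ B₂ B₃ : Type*} [NonUnitalCStarAlgebra B₁]
  [NonUnitalCStarAlgebra B₂] [NonUnitalCStarAlgebra B₃]

/-- Where the integrand does not vanish, γ = (γη⁻¹)η is a product of elements of `K` and `L`. -/
lemma convBilin_eq_zero (β : B₁ →L[ℂ] B₂ →L[ℂ] B₃) {f : G → B₁} {g : G → B₂} {K L : Set G}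
    (hf : ∀ γ ∉ K, f γ = 0) (hg : ∀ γ ∉ L, g γ = 0) {γ : G} (hγ : γ ∉ 𝒢.mulSet K L) :
    μ.convBilin β f g γ = 0 := by
  rw [convBilin]
  refine integral_eq_zero_of_ae (Eventually.of_forall fun η => ?_)
  by_cases hη : (η : G) ∈ L
  · by_cases hk : 𝒢.mul γ (𝒢.inv η) ∈ K
    · refine absurd ⟨(𝒢.mul γ (𝒢.inv η), (η : G)), ⟨⟨hk, hη⟩, ?_⟩, ?_⟩ hγ
      · change 𝒢.src (𝒢.mul γ (𝒢.inv η)) = 𝒢.rng η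
        rw [𝒢.src_mul _ _ (by rw [𝒢.rng_inv, η.src_val]), 𝒢.src_inv]
      · exact 𝒢.inv_mul_cancel_right η.src_val.symm
    · simp [hf _ hk]
  · simp [hg _ hη]

end HaarSystem

end LieGroupoid

/-! ### Continuity of fibre integrals and of convolutions -/

namespace LieGroupoid

variable {𝒢 : LieGroupoid EG EM G M}

/-- Without a Hausdorff assumption on the whole space, limits are still unique among points of a
common Hausdorff open set. -/
lemma _root_.eq_of_tendsto_of_t2Space_subtype {X ι : Type*} [TopologicalSpace X] {W : Set X}
    (hW : IsOpen W) (hT : T2Space W) {F : Filter ι} [F.NeBot] {a : ι → X} {x y : X} (hx : x ∈ W)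
    (hy : y ∈ W) (hax : Tendsto a F (𝓝 x)) (hay : Tendsto a F (𝓝 y)) : x = y := by
  by_contra hxy
  obtain ⟨u, v, hu, hv, hxu, hyv, huv⟩ :=
    t2_separation (X := W) (x := ⟨x, hx⟩) (y := ⟨y, hy⟩) fun h => hxy (congrArg Subtype.val h)
  have h1 := hax.eventually ((hW.isOpenMap_subtype_val u hu).mem_nhds ⟨_, hxu, rfl⟩)
  have h2 := hay.eventually ((hW.isOpenMap_subtype_val v hv).mem_nhds ⟨_, hyv, rfl⟩)
  obtain ⟨i, ⟨z, hz, hzi⟩, ⟨w, hw, hwi⟩⟩ := (h1.and h2).exists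
  have : z = w := Subtype.ext (hzi.trans hwi.symm)
  subst this
  exact Set.disjoint_left.1 huv hz hw

namespace HaarSystem

variable (μ : 𝒢.HaarSystem) {B₁ B₂ B₃ : Type*} [NonUnitalCStarAlgebra B₁]
  [NonUnitalCStarAlgebra B₂] [NonUnitalCStarAlgebra B₃]

/-- Continuity of the integrand of a convolution, for factors supported in compact subsets of
Hausdorff open sets whose product lies in a Hausdorff open set. -/
lemma tendsto_convBilin_integrand (β : B₁ →L[ℂ] B₂ →L[ℂ] B₃) {f : G → B₁} {g : G → B₂}
    {U K V L W : Set G} (hU : IsOpen U) (hfU : ContinuousOn f U) (hKU : K ⊆ U) (hK : IsCompact K)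
    (hf0 : ∀ γ ∉ K, f γ = 0) (hV : IsOpen V) (hVT : T2Space V) (hgV : ContinuousOn g V)
    (hLV : L ⊆ V) (hL : IsCompact L) (hg0 : ∀ γ ∉ L, g γ = 0) (hW : IsOpen W) (hWT : T2Space W)
    (hKL : 𝒢.mulSet K L ⊆ W) {γ η : G} (hγ : γ ∈ W) (hη : η ∈ V) (hγη : 𝒢.src γ = 𝒢.src η) :
    Tendsto (fun p : G × G => β (f (𝒢.mul p.1 (𝒢.inv p.2))) (g p.2))
      (𝓝[{p | 𝒢.src p.1 = 𝒢.src p.2}] (γ, η)) (𝓝 (β (f (𝒢.mul γ (𝒢.inv η))) (g η))) := by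
  rw [tendsto_iff_ultrafilter]
  intro F hF
  have hnhds : Tendsto (fun p : G × G => p) F (𝓝 (γ, η)) :=
    (tendsto_id'.2 hF).mono_right nhdsWithin_le_nhds
  have hs : ∀ᶠ p : G × G in F, 𝒢.src p.1 = 𝒢.src p.2 := hF self_mem_nhdsWithin
  have ha : Tendsto (fun p : G × G => p.1) F (𝓝 γ) := (continuous_fst.tendsto _).comp hnhds
  have hb : Tendsto (fun p : G × G => p.2) F (𝓝 η) := (continuous_snd.tendsto _).comp hnhds
  have hc : Tendsto (fun p : G × G => 𝒢.mul p.1 (𝒢.inv p.2)) F (𝓝 (𝒢.mul γ (𝒢.inv η))) :=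
    𝒢.tendsto_mul ha ((𝒢.continuous_inv.tendsto _).comp hb)
      (hs.mono fun p hp => hp.trans (𝒢.rng_inv _).symm) (hγη.trans (𝒢.rng_inv _).symm)
  by_cases hmem : 𝒢.mul γ (𝒢.inv η) ∈ U
  · have h1 := (hfU.continuousAt (hU.mem_nhds hmem)).tendsto.comp hc
    have h2 := (hgV.continuousAt (hV.mem_nhds hη)).tendsto.comp hb
    have h3 : Continuous fun q : B₁ × B₂ => β q.1 q.2 := by fun_prop
    exact (h3.tendsto (_, _)).comp (h1.prodMk_nhds h2)
  · have hz : f (𝒢.mul γ (𝒢.inv η)) = 0 := hf0 _ fun h => hmem (hKU h)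
    rw [hz, map_zero, zero_apply]
    refine tendsto_const_nhds.congr' (EventuallyEq.symm ?_)
    -- Otherwise γη⁻¹ stays in `K` and η in `L` along the ultrafilter, with limits `k` and `l`
    -- there. Uniqueness of limits in `V` and in `W` gives l = η and kl = γ, so that γη⁻¹ = k would
    -- lie in `U`.
    by_contra hne
    have hne' : ∀ᶠ p : G × G in F, ¬ β (f (𝒢.mul p.1 (𝒢.inv p.2))) (g p.2) = 0 :=
      Ultrafilter.eventually_not.2 hne
    have hk : ∀ᶠ p : G × G in F, 𝒢.mul p.1 (𝒢.inv p.2) ∈ K := hne'.mono fun p hp => by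
      by_contra h
      exact hp (by rw [hf0 _ h]; simp)
    have hl : ∀ᶠ p : G × G in F, p.2 ∈ L := hne'.mono fun p hp => by
      by_contra h
      exact hp (by rw [hg0 _ h]; simp)
    obtain ⟨k, hkK, hkt⟩ := hK.ultrafilter_le_nhds
      (F.map fun p : G × G => 𝒢.mul p.1 (𝒢.inv p.2)) (le_principal_iff.2 hk)
    obtain ⟨l, hlL, hlt⟩ := hL.ultrafilter_le_nhds
      (F.map fun p : G × G => p.2) (le_principal_iff.2 hl)
    replace hkt : Tendsto (fun p : G × G => 𝒢.mul p.1 (𝒢.inv p.2)) F (𝓝 k) := hkt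
    replace hlt : Tendsto (fun p : G × G => p.2) F (𝓝 l) := hlt
    have hle : l = η := eq_of_tendsto_of_t2Space_subtype hV hVT (hLV hlL) hη hlt hb
    subst hle
    have hcomp : ∀ᶠ p : G × G in F, 𝒢.src (𝒢.mul p.1 (𝒢.inv p.2)) = 𝒢.rng p.2 :=
      hs.mono fun p hp => by
        rw [𝒢.src_mul _ _ (hp.trans (𝒢.rng_inv _).symm), 𝒢.src_inv]
    have hkl : 𝒢.src k = 𝒢.rng l := by
      refine tendsto_nhds_unique ((𝒢.continuous_src.tendsto _).comp hkt) ?_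
      refine ((𝒢.continuous_rng.tendsto _).comp hb).congr' ?_
      filter_upwards [hcomp] with p hp using hp.symm
    have hprod : Tendsto (fun p : G × G => p.1) F (𝓝 (𝒢.mul k l)) := by
      refine (𝒢.tendsto_mul hkt hlt hcomp hkl).congr' ?_
      filter_upwards [hs] with p hp using 𝒢.inv_mul_cancel_right hp
    have hγe : 𝒢.mul k l = γ := eq_of_tendsto_of_t2Space_subtype hW hWT
      (hKL ⟨(k, l), ⟨⟨hkK, hlL⟩, hkl⟩, rfl⟩) hγ hprod ha
    rw [← hγe, 𝒢.mul_inv_cancel_right hkl] at hmem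
    exact hmem (hKU hkK)

/-- Integrals of compactly supported continuous functions over the fibres are continuous. -/
lemma continuous_integral {ψ : G → ℂ} (hψ : ψ ∈ Cc G ℂ) :
    Continuous (fun x => ∫ γ : 𝒢.Fiber x, ψ γ ∂(μ.meas x)) := by
  have : LocallyCompactSpace G := ChartedSpace.locallyCompactSpace EG G
  suffices ψ ∈ Cc G ℂ ∧ Continuous (fun x => ∫ γ : 𝒢.Fiber x, ψ γ ∂(μ.meas x)) from this.2
  refine Cc.induction_local (p := fun ψ => ψ ∈ Cc G ℂ ∧
    Continuous (fun x => ∫ γ : 𝒢.Fiber x, ψ γ ∂(μ.meas x))) ?_ ?_ ?_ hψ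
  · exact ⟨zero_mem _, by simpa using continuous_const⟩
  · rintro f g ⟨hf, hf'⟩ ⟨hg, hg'⟩
    refine ⟨add_mem hf hg, ?_⟩
    convert hf'.add hg' using 2 with x
    exact integral_add (μ.integrable_of_mem_Cc hf x) (μ.integrable_of_mem_Cc hg x)
  intro k
  set e := chartAt EG k with he
  refine ⟨e.source, e.open_source.mem_nhds (mem_chart_source EG k), ?_⟩
  intro f U K hU hT hUe hf hK hKU hf0
  have hfC : f ∈ Cc G ℂ := Submodule.subset_span ⟨U, hU, hT, hf, K, hKU, hK, hf0⟩
  refine ⟨hfC, ?_⟩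
  classical
  -- In the chart, `f` is uniformly approximated by smooth functions supported in a fixed compact
  -- set. Their fibre integrals are continuous by the definition of a Haar system, and the error is
  -- uniform over the fibres.
  let φ : EG → ℂ := fun y => if y ∈ e.target then f (e.symm y) else 0
  have hKe : IsCompact (e '' K) :=
    hK.image_of_continuousOn (e.continuousOn.mono (hKU.trans hUe))
  have hφ0 : ∀ y ∉ e '' K, φ y = 0 := by
    intro y hy
    by_cases hyt : y ∈ e.target
    · simp only [φ, if_pos hyt]
      exact hf0 _ fun h => hy ⟨_, h, e.right_inv hyt⟩
    · simp only [φ, if_neg hyt]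
  have hφ : Continuous φ := by
    rw [continuous_iff_continuousAt]
    intro y
    by_cases hy : y ∈ e '' K
    · obtain ⟨z, hz, rfl⟩ := hy
      have hze := hUe (hKU hz)
      have h1 : ContinuousAt (fun y => f (e.symm y)) (e z) := by
        refine ContinuousAt.comp ?_ (e.symm.continuousAt (e.map_source hze))
        rw [e.left_inv hze]
        exact hf.continuousAt (hU.mem_nhds (hKU hz))
      refine h1.congr ?_
      filter_upwards [e.open_target.mem_nhds (e.map_source hze)] with w hw
      simp only [φ, if_pos hw]
    · have h : ∀ᶠ z in 𝓝 y, φ z = 0 := by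
        filter_upwards [hKe.isClosed.isOpen_compl.mem_nhds hy] with z hz
        exact hφ0 z hz
      exact continuousAt_const.congr (EventuallyEq.symm h)
  obtain ⟨L, hL, hKL, hLe⟩ := exists_compact_between hKe e.open_target
    (by rintro _ ⟨z, hz, rfl⟩; exact e.map_source (hUe (hKU hz)))
  have hLG : IsCompact (e.symm '' L) :=
    hL.image_of_continuousOn (e.continuousOn_symm.mono hLe)
  obtain ⟨C, hC, hbound⟩ := μ.exists_norm_integral_le (E := ℂ) hLG
  have happrox : ∀ ε : ℝ, 0 < ε → ∃ g ∈ CcSmooth EG G, g ∈ Cc G ℂ ∧ (∀ γ, ‖f γ - g γ‖ ≤ ε) ∧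
      ∀ γ ∉ e.symm '' L, f γ - g γ = 0 := by
    intro ε hε
    -- The convex sets encode both closeness to φ and vanishing outside `L`; locally a constant
    -- value of φ or zero is admissible.
    obtain ⟨g, hg⟩ := exists_contMDiffMap_forall_mem_convex_of_local_const (n := (⊤ : ℕ∞)) 𝓘(ℝ, EG)
      (t := fun y : EG => {z : ℂ | ‖φ y - z‖ ≤ ε ∧ (y ∉ L → z = 0)}) (by
        intro y
        have hball : {z : ℂ | ‖φ y - z‖ ≤ ε} = Metric.closedBall (φ y) ε := by
          ext z
          rw [Metric.mem_closedBall, dist_comm, dist_eq_norm]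
          rfl
        refine Convex.inter (s := {z : ℂ | ‖φ y - z‖ ≤ ε}) (t := {z : ℂ | y ∉ L → z = 0}) ?_ ?_
        · rw [hball]
          exact convex_closedBall (φ y) ε
        · intro a ha b hb s t _ _ _ hy
          rw [ha hy, hb hy, smul_zero, smul_zero, add_zero]) (by
        intro y
        by_cases hy : y ∈ e '' K
        · refine ⟨φ y, ?_⟩
          have h1 : ∀ᶠ z in 𝓝 y, ‖φ z - φ y‖ < ε :=
            (isOpen_lt (by fun_prop) continuous_const).mem_nhds (by simpa using hε)
          filter_upwards [h1, isOpen_interior.mem_nhds (hKL hy)] with z hz hzL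
          exact ⟨hz.le, fun h => absurd (interior_subset hzL) h⟩
        · refine ⟨0, ?_⟩
          filter_upwards [hKe.isClosed.isOpen_compl.mem_nhds hy] with z hz
          exact ⟨by simp [hφ0 z hz, hε.le], fun _ => rfl⟩)
    let g' : G → ℂ := fun γ => if γ ∈ e.source then g (e γ) else 0
    have hg'0 : ∀ γ ∉ e.symm '' L, g' γ = 0 := by
      intro γ hγ
      by_cases h : γ ∈ e.source
      · simp only [g', if_pos h]
        exact (hg (e γ)).2 fun h' => hγ ⟨_, h', e.left_inv h⟩
      · simp only [g', if_neg h]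
    have hg's : ContMDiffOn 𝓘(ℝ, EG) 𝓘(ℝ, ℂ) ∞ g' e.source := by
      refine ContMDiffOn.congr (g.contMDiff.comp_contMDiffOn (contMDiffOn_chart (x := k)))
        fun γ hγ => ?_
      simp only [g', if_pos hγ]
      rfl
    have hTs : T2Space e.source :=
      T2Space.of_injective_continuous (f := fun γ : e.source => e γ)
        (fun a b hab => Subtype.ext (e.injOn a.2 b.2 hab)) e.continuousOn.domRestrict
    have hLs : e.symm '' L ⊆ e.source := by
      rintro _ ⟨y, hy, rfl⟩
      exact e.map_target (hLe hy)
    have hf0' : ∀ γ ∉ e.symm '' L, f γ = 0 := fun γ hγ => hf0 γ fun h =>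
      hγ ⟨e γ, interior_subset (hKL ⟨γ, h, rfl⟩), e.left_inv (hUe (hKU h))⟩
    refine ⟨g', Submodule.subset_span ⟨e.source, e.open_source, hTs, hg's, _, hLs, hLG, hg'0⟩,
      Submodule.subset_span ⟨e.source, e.open_source, hTs, hg's.continuousOn, _, hLs, hLG, hg'0⟩,
      fun γ => ?_, fun γ hγ => by rw [hf0' γ hγ, hg'0 γ hγ, sub_zero]⟩
    by_cases h : γ ∈ e.source
    · have h1 := (hg (e γ)).1
      simp only [φ, if_pos (e.map_source h), e.left_inv h] at h1
      simpa only [g', if_pos h] using h1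
    · rw [hf0' γ fun h' => h (hLs h'), hg'0 γ fun h' => h (hLs h'), sub_zero, norm_zero]
      exact hε.le
  rw [Metric.continuous_iff']
  intro x ε hε
  obtain ⟨g, hgs, hgC, hfg, hfg0⟩ := happrox (ε / (3 * (C + 1))) (by positivity)
  have hclose : ∀ y, ‖(∫ γ : 𝒢.Fiber y, f γ ∂(μ.meas y)) - ∫ γ : 𝒢.Fiber y, g γ ∂(μ.meas y)‖
      < ε / 3 := by
    intro y
    rw [← integral_sub (μ.integrable_of_mem_Cc hfC y) (μ.integrable_of_mem_Cc hgC y)]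
    refine (hbound y _ _ (by positivity) (fun γ => hfg γ) (fun γ hγ => hfg0 γ hγ)).trans_lt ?_
    rw [mul_div_assoc', div_lt_div_iff₀ (by positivity) (by positivity)]
    nlinarith
  have hgc := Metric.continuous_iff'.1 (μ.smooth g hgs).continuous x (ε / 3) (by positivity)
  filter_upwards [hgc] with y hy
  have h1 := hclose y
  have h2 := hclose x
  rw [← dist_eq_norm] at h1 h2
  rw [dist_comm] at h2
  have := dist_triangle4 (∫ γ : 𝒢.Fiber y, f γ ∂(μ.meas y)) (∫ γ : 𝒢.Fiber y, g γ ∂(μ.meas y))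
    (∫ γ : 𝒢.Fiber x, g γ ∂(μ.meas x)) (∫ γ : 𝒢.Fiber x, f γ ∂(μ.meas x))
  linarith

end HaarSystem

end LieGroupoid

namespace LieGroupoid

variable {𝒢 : LieGroupoid EG EM G M}

namespace HaarSystem

variable (μ : 𝒢.HaarSystem) {B₁ B₂ B₃ : Type*} [NonUnitalCStarAlgebra B₁]
  [NonUnitalCStarAlgebra B₂] [NonUnitalCStarAlgebra B₃]

/-- Near γ₀ the integrand is uniformly close to a finite sum Σ ψᵢ(η) cᵢ. Here the cᵢ are its values
at γ₀ and at points of `L` over the source of γ₀, and the ψᵢ form a partition of unity on that part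
of `L`. The fibre integrals of the ψᵢ are continuous by `continuous_integral`. -/
lemma continuousOn_convBilin (β : B₁ →L[ℂ] B₂ →L[ℂ] B₃) {f : G → B₁} {g : G → B₂}
    {U K V L W : Set G} (hU : IsOpen U) (hUT : T2Space U) (hfU : ContinuousOn f U) (hKU : K ⊆ U)
    (hK : IsCompact K) (hf0 : ∀ γ ∉ K, f γ = 0) (hV : IsOpen V) (hVT : T2Space V)
    (hgV : ContinuousOn g V) (hLV : L ⊆ V) (hL : IsCompact L) (hg0 : ∀ γ ∉ L, g γ = 0)
    (hW : IsOpen W) (hWT : T2Space W) (hKL : 𝒢.mulSet K L ⊆ W) :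
    ContinuousOn (μ.convBilin β f g) W := by
  classical
  have : LocallyCompactSpace G := ChartedSpace.locallyCompactSpace EG G
  have : LocallyCompactSpace V := hV.locallyCompactSpace
  have hfC : f ∈ Cc G B₁ := Submodule.subset_span ⟨U, hU, hUT, hfU, K, hKU, hK, hf0⟩
  have hgC : g ∈ Cc G B₂ := Submodule.subset_span ⟨V, hV, hVT, hgV, L, hLV, hL, hg0⟩
  intro γ₀ hγ₀
  refine ContinuousAt.continuousWithinAt ?_
  let Φ : G → G → B₃ := fun γ η => β (f (𝒢.mul γ (𝒢.inv η))) (g η)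
  obtain ⟨D, hD0, hD⟩ : ∃ D : ℝ, 0 ≤ D ∧ ∀ γ η, ‖Φ γ η‖ ≤ D := by
    obtain ⟨-, -, D₁, h₁, -⟩ := Cc.bounded hfC
    obtain ⟨-, -, D₂, h₂, -⟩ := Cc.bounded hgC
    have h₁' := (norm_nonneg _).trans (h₁ γ₀)
    have h₂' := (norm_nonneg _).trans (h₂ γ₀)
    refine ⟨‖β‖ * D₁ * D₂, by positivity, fun γ η => (β.le_opNorm₂ _ _).trans ?_⟩
    gcongr
    · exact h₁ _
    · exact h₂ _
  have hLc : IsCompact ((fun x : V => (x : G)) ⁻¹' L) := Cc.isCompact_preimage_val hL hLV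
  obtain ⟨L', hL', hLL'⟩ := exists_compact_superset hLc
  obtain ⟨C, hC, hbound⟩ := μ.exists_norm_integral_le (E := B₃) (hL'.image continuous_subtype_val)
  set x₀ := 𝒢.src γ₀ with hx₀
  let L₀ : Set V := (fun x : V => (x : G)) ⁻¹' L ∩ {x | 𝒢.src x = x₀}
  have hsrcV : Continuous fun x : V => 𝒢.src x := 𝒢.continuous_src.comp continuous_subtype_val
  have hL₀ : IsCompact L₀ := hLc.inter_right (isClosed_singleton.preimage hsrcV)
  -- approximation of the convolution by finite combinations of fibre integrals
  have key : ∀ δ : ℝ, 0 < δ → δ ≤ 1 → ∃ S : G → B₃, ContinuousAt S γ₀ ∧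
      ∀ᶠ γ in 𝓝 γ₀, ‖μ.convBilin β f g γ - S γ‖ ≤ C * (δ * (1 + D)) := by
    intro δ hδ hδ1
    have hloc : ∀ η : L₀, ∃ N ∈ 𝓝 γ₀, ∃ O : Set V, IsOpen O ∧ (η : V) ∈ O ∧ O ⊆ interior L' ∧
        ∀ γ ∈ N, ∀ ζ ∈ O, 𝒢.src γ = 𝒢.src ζ → ‖Φ γ ζ - Φ γ₀ (η : V)‖ < δ := by
      intro η
      have h1 := tendsto_convBilin_integrand β hU hfU hKU hK hf0 hV hVT hgV hLV hL hg0 hW hWT hKL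
        hγ₀ (η : V).2 η.2.2.symm
      have h2 := h1.eventually (Metric.ball_mem_nhds _ hδ)
      rw [eventually_nhdsWithin_iff, nhds_prod_eq] at h2
      obtain ⟨p, hp, q, hq, hpq⟩ := eventually_prod_iff.1 h2
      obtain ⟨Q, hQ, hQo, hηQ⟩ := eventually_nhds_iff.1 hq
      refine ⟨_, hp, (fun x : V => (x : G)) ⁻¹' Q ∩ interior L',
        (hQo.preimage continuous_subtype_val).inter isOpen_interior, ⟨hηQ, hLL' η.2.1⟩,
        Set.inter_subset_right, fun γ hγ ζ hζ hs => ?_⟩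
      have := hpq hγ (hQ _ hζ.1) hs
      rwa [dist_eq_norm] at this
    choose N hN O hO hηO hOL' hNO using hloc
    obtain ⟨t, ht⟩ := hL₀.elim_nhds_subcover' (fun x hx => O ⟨x, hx⟩)
      fun x hx => (hO ⟨x, hx⟩).mem_nhds (hηO ⟨x, hx⟩)
    obtain ⟨ψ, hψ, hψc⟩ := PartitionOfUnity.exists_isSubordinate_of_locallyFinite_t2space hL₀
      (fun i : t => O i) (fun i => hO i) (locallyFinite_of_finite _) (by
        intro y hy
        obtain ⟨x, hx, hxy⟩ := Set.mem_iUnion₂.1 (ht hy)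
        exact Set.mem_iUnion.2 ⟨⟨x, hx⟩, hxy⟩)
    have hsum : ∀ y, ∑ i, ψ i y ≤ 1 := fun y => by
      rw [← finsum_eq_sum_of_fintype]
      exact ψ.sum_le_one y
    have hsum1 : ∀ y ∈ L₀, ∑ i, ψ i y = 1 := fun y hy => by
      rw [← finsum_eq_sum_of_fintype]
      exact ψ.sum_eq_one hy
    let Ψ : t → G → ℂ := fun i γ => if h : γ ∈ V then (ψ i ⟨γ, h⟩ : ℂ) else 0
    have hΨ : ∀ i, Ψ i ∈ Cc G ℂ := by
      intro i
      refine Submodule.subset_span ⟨V, hV, hVT, ?_, (fun x : V => (x : G)) '' tsupport (ψ i), ?_,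
        (hψc i).image continuous_subtype_val, ?_⟩
      · rw [continuousOn_iff_continuous_domRestrict]
        convert Complex.continuous_ofReal.comp (ψ i).continuous using 1
        ext x
        simp [Ψ]
      · rintro _ ⟨x, hx, rfl⟩
        exact x.2
      · intro γ hγ
        dsimp only [Ψ]
        split_ifs with h
        · rw [image_eq_zero_of_notMem_tsupport fun h' => hγ ⟨_, h', rfl⟩, Complex.ofReal_zero]
        · rfl
    let c : t → B₃ := fun i => Φ γ₀ ((i : L₀) : V)
    refine ⟨fun γ => ∑ i, (∫ η : 𝒢.Fiber (𝒢.src γ), Ψ i η ∂(μ.meas (𝒢.src γ))) • c i, ?_, ?_⟩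
    · refine Continuous.continuousAt (continuous_finsetSum _ fun i _ => ?_)
      exact ((μ.continuous_integral (hΨ i)).comp 𝒢.continuous_src).smul continuous_const
    -- The ψᵢ sum to 1 only on the part of `L` over `x₀`. The part of `L` where the sum is at most 1
    -- - δ is compact and misses the fibre over `x₀`, so its image in `M` is closed and nearby
    -- fibres miss it too.
    let L₁ : Set V := (fun x : V => (x : G)) ⁻¹' L ∩ {x | ∑ i, ψ i x ≤ 1 - δ}
    have hL₁ : IsCompact L₁ := hLc.inter_right (isClosed_le (by fun_prop) continuous_const)
    have hL₁x : x₀ ∉ (fun x : V => 𝒢.src x) '' L₁ := by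
      rintro ⟨y, ⟨hyL, hy⟩, hyx⟩
      have h1 := hsum1 y ⟨hyL, hyx⟩
      have h2 : ∑ i, ψ i y ≤ 1 - δ := hy
      linarith
    have hev1 : ∀ᶠ γ in 𝓝 γ₀, 𝒢.src γ ∉ (fun x : V => 𝒢.src x) '' L₁ :=
      𝒢.continuous_src.continuousAt.eventually
        ((hL₁.image hsrcV).isClosed.isOpen_compl.mem_nhds hL₁x)
    have hev2 : ∀ᶠ γ in 𝓝 γ₀, ∀ i : t, γ ∈ N i := eventually_all.2 fun i => hN i
    filter_upwards [hev1, hev2] with γ h1 h2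
    have hint : ∀ i, Integrable (fun η : 𝒢.Fiber (𝒢.src γ) => Ψ i η • c i) (μ.meas (𝒢.src γ)) :=
      fun i => (μ.integrable_of_mem_Cc (hΨ i) _).smul_const (c i)
    have heq : μ.convBilin β f g γ
        - ∑ i, (∫ η : 𝒢.Fiber (𝒢.src γ), Ψ i η ∂(μ.meas (𝒢.src γ))) • c i
        = ∫ η : 𝒢.Fiber (𝒢.src γ), (Φ γ η - ∑ i, Ψ i η • c i) ∂(μ.meas (𝒢.src γ)) := by
      rw [integral_sub (integrable_convBilin β hfC hgC γ)
        (integrable_finsetSum _ fun i _ => hint i), integral_finsetSum _ fun i _ => hint i]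
      simp only [integral_smul_const]
      rfl
    rw [heq]
    refine hbound _ _ _ (by positivity) ?_ ?_
    · intro η
      by_cases hηV : (η : G) ∈ V
      · have hΨη : ∀ i, Ψ i η = (ψ i ⟨η, hηV⟩ : ℂ) := fun i => dif_pos hηV
        -- The first term is the defect of the partition, at most δ D; the second is the oscillation
        -- of the integrand, at most δ.
        have hsplit : Φ γ η - ∑ i, Ψ i η • c i
            = (1 - ((∑ i, ψ i ⟨η, hηV⟩ : ℝ) : ℂ)) • Φ γ η
              + ∑ i, (ψ i ⟨η, hηV⟩ : ℂ) • (Φ γ η - c i) := by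
          simp only [hΨη, smul_sub, Finset.sum_sub_distrib, ← Finset.sum_smul, sub_smul, one_smul,
            Complex.ofReal_sum]
          abel
        have hpart1 : ‖(1 - ((∑ i, ψ i ⟨η, hηV⟩ : ℝ) : ℂ)) • Φ γ η‖ ≤ δ * D := by
          by_cases hηL : (η : G) ∈ L
          · rw [norm_smul, ← Complex.ofReal_one, ← Complex.ofReal_sub, Complex.norm_real,
              Real.norm_of_nonneg (sub_nonneg.2 (hsum _))]
            refine mul_le_mul ?_ (hD _ _) (norm_nonneg _) hδ.le
            by_contra hlt
            refine h1 ⟨⟨η, hηV⟩, ⟨hηL, ?_⟩, η.src_val⟩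
            change ∑ i, ψ i ⟨η, hηV⟩ ≤ 1 - δ
            linarith
          · have : Φ γ η = 0 := by simp [Φ, hg0 _ hηL]
            rw [this, smul_zero, norm_zero]
            positivity
        have hpart2 : ‖∑ i, (ψ i ⟨η, hηV⟩ : ℂ) • (Φ γ η - c i)‖ ≤ δ := by
          calc ‖∑ i, (ψ i ⟨η, hηV⟩ : ℂ) • (Φ γ η - c i)‖ ≤ ∑ i, ψ i ⟨η, hηV⟩ * δ := by
                refine norm_sum_le_of_le _ fun i _ => ?_
                rw [norm_smul, Complex.norm_real, Real.norm_of_nonneg (ψ.nonneg i _)]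
                by_cases hz : ψ i ⟨η, hηV⟩ = 0
                · simp [hz]
                · refine mul_le_mul_of_nonneg_left (le_of_lt ?_) (ψ.nonneg i _)
                  exact hNO i γ (h2 i) ⟨η, hηV⟩ (hψ i (subset_tsupport _ hz)) η.src_val.symm
            _ = (∑ i, ψ i ⟨η, hηV⟩) * δ := (Finset.sum_mul _ _ _).symm
            _ ≤ 1 * δ := mul_le_mul_of_nonneg_right (hsum _) hδ.le
            _ = δ := _root_.one_mul δ
        rw [hsplit]
        refine (norm_add_le _ _).trans ((add_le_add hpart1 hpart2).trans (le_of_eq ?_))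
        ring
      · have h3 : Φ γ η = 0 := by simp [Φ, hg0 _ fun h => hηV (hLV h)]
        have h4 : ∀ i, Ψ i η = 0 := fun i => dif_neg hηV
        simp only [h3, h4, zero_smul, Finset.sum_const_zero, sub_zero, norm_zero]
        positivity
    · intro η hη
      have h3 : Φ γ η = 0 := by
        have : g η = 0 := hg0 _ fun h => hη ⟨⟨η, hLV h⟩, interior_subset (hLL' h), rfl⟩
        simp [Φ, this]
      have h4 : ∀ i, Ψ i η = 0 := fun i => by
        by_cases hηV : (η : G) ∈ V
        · have : ψ i ⟨η, hηV⟩ = 0 := image_eq_zero_of_notMem_tsupport fun h =>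
            hη ⟨⟨η, hηV⟩, interior_subset (hOL' i (hψ i h)), rfl⟩
          simp [Ψ, hηV, this]
        · exact dif_neg hηV
      simp only [h3, h4, zero_smul, Finset.sum_const_zero, sub_zero]
  rw [ContinuousAt, Metric.tendsto_nhds]
  intro ε hε
  obtain ⟨S, hS, hhS⟩ := key (min 1 (ε / (3 * (C * (1 + D) + 1)))) (by positivity) (min_le_left _ _)
  have hsmall : C * (min 1 (ε / (3 * (C * (1 + D) + 1))) * (1 + D)) < ε / 3 := by
    have h1 : min 1 (ε / (3 * (C * (1 + D) + 1))) ≤ ε / (3 * (C * (1 + D) + 1)) := min_le_right _ _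
    calc C * (min 1 (ε / (3 * (C * (1 + D) + 1))) * (1 + D))
        ≤ C * (ε / (3 * (C * (1 + D) + 1)) * (1 + D)) := by gcongr
      _ = (C * (1 + D)) * ε / (3 * (C * (1 + D) + 1)) := by ring
      _ < ε / 3 := by
        rw [div_lt_div_iff₀ (by positivity) (by positivity)]
        nlinarith
  have hS' := Metric.tendsto_nhds.1 hS (ε / 3) (by positivity)
  have h0 := hhS.self_of_nhds
  filter_upwards [hhS, hS'] with γ h1 h2
  rw [← dist_eq_norm] at h0 h1
  rw [dist_comm] at h0
  have := dist_triangle4 (μ.convBilin β f g γ) (S γ) (S γ₀) (μ.convBilin β f g γ₀)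
  linarith

/-- `C_c` is closed under convolution. -/
lemma convBilin_mem (β : B₁ →L[ℂ] B₂ →L[ℂ] B₃) {f : G → B₁} {g : G → B₂}
    (hf : f ∈ Cc G B₁) (hg : g ∈ Cc G B₂) : μ.convBilin β f g ∈ Cc G B₃ := by
  have : LocallyCompactSpace G := ChartedSpace.locallyCompactSpace EG G
  suffices f ∈ Cc G B₁ ∧ μ.convBilin β f g ∈ Cc G B₃ from this.2
  refine Cc.induction_local (p := fun f => f ∈ Cc G B₁ ∧ μ.convBilin β f g ∈ Cc G B₃) ?_ ?_ ?_ hf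
  · exact ⟨zero_mem _, by rw [convBilin_zero_left]; exact zero_mem _⟩
  · rintro f f' ⟨hf, hf1⟩ ⟨hf', hf1'⟩
    refine ⟨add_mem hf hf', ?_⟩
    rw [μ.convBilin_add_left β hf hf' hg]
    exact add_mem hf1 hf1'
  intro k
  -- The neighbourhood of `k` may shrink with `g`, so it is part of the predicate when `g` is
  -- localised in turn.
  suffices g ∈ Cc G B₂ ∧ ∃ N ∈ 𝓝 k, ∀ (f : G → B₁) (U K : Set G), IsOpen U → T2Space U → U ⊆ N →
      ContinuousOn f U → IsCompact K → K ⊆ U → (∀ y ∉ K, f y = 0) →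
      f ∈ Cc G B₁ ∧ μ.convBilin β f g ∈ Cc G B₃ from this.2
  refine Cc.induction_local (p := fun g => g ∈ Cc G B₂ ∧ ∃ N ∈ 𝓝 k, ∀ (f : G → B₁) (U K : Set G),
      IsOpen U → T2Space U → U ⊆ N → ContinuousOn f U → IsCompact K → K ⊆ U →
      (∀ y ∉ K, f y = 0) → f ∈ Cc G B₁ ∧ μ.convBilin β f g ∈ Cc G B₃) ?_ ?_ ?_ hg
  · refine ⟨zero_mem _, Set.univ, univ_mem, fun f U K hU hT _ hf hK hKU hf0 => ?_⟩
    rw [convBilin_zero_right]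
    exact ⟨Submodule.subset_span ⟨U, hU, hT, hf, K, hKU, hK, hf0⟩, zero_mem _⟩
  · rintro g g' ⟨hg, N, hN, h⟩ ⟨hg', N', hN', h'⟩
    refine ⟨add_mem hg hg', N ∩ N', inter_mem hN hN', fun f U K hU hT hUN hf hK hKU hf0 => ?_⟩
    have h1 := h f U K hU hT (hUN.trans Set.inter_subset_left) hf hK hKU hf0
    have h2 := h' f U K hU hT (hUN.trans Set.inter_subset_right) hf hK hKU hf0
    refine ⟨h1.1, ?_⟩
    rw [μ.convBilin_add_right β h1.1 hg hg']
    exact add_mem h1.2 h2.2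
  intro l
  -- Products of arrows near a composable pair stay in a chart domain, which is Hausdorff. Near a
  -- pair that is not composable no two arrows compose, as `M` is Hausdorff, and `W` is empty.
  obtain ⟨W, hW, hWT, A, hA, O, hO, hAO⟩ : ∃ W : Set G, IsOpen W ∧ T2Space W ∧
      ∃ A ∈ 𝓝 k, ∃ O ∈ 𝓝 l, 𝒢.mulSet A O ⊆ W := by
    by_cases hkl : 𝒢.src k = 𝒢.rng l
    · set e := chartAt EG (𝒢.mul k l)
      have hTs : T2Space e.source :=
        T2Space.of_injective_continuous (f := fun γ : e.source => e γ)
          (fun a b hab => Subtype.ext (e.injOn a.2 b.2 hab)) e.continuousOn.domRestrict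
      have h1 := 𝒢.mul_smooth.continuousOn (k, l) hkl
      have h2 := h1.tendsto.eventually (e.open_source.mem_nhds (mem_chart_source EG _))
      rw [eventually_nhdsWithin_iff, nhds_prod_eq] at h2
      obtain ⟨p, hp, q, hq, hpq⟩ := eventually_prod_iff.1 h2
      refine ⟨e.source, e.open_source, hTs, _, hp, _, hq, ?_⟩
      rintro _ ⟨⟨a, b⟩, ⟨⟨ha, hb⟩, hab⟩, rfl⟩
      exact hpq ha hb hab
    · obtain ⟨u, v, hu, hv, hku, hlv, huv⟩ := t2_separation hkl
      refine ⟨∅, isOpen_empty, inferInstance, 𝒢.src ⁻¹' u,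
        (hu.preimage 𝒢.continuous_src).mem_nhds hku, 𝒢.rng ⁻¹' v,
        (hv.preimage 𝒢.continuous_rng).mem_nhds hlv, ?_⟩
      rintro _ ⟨⟨a, b⟩, ⟨⟨ha, hb⟩, hab⟩, rfl⟩
      refine Set.disjoint_left.1 huv ha ?_
      rw [show 𝒢.src a = 𝒢.rng b from hab]
      exact hb
  refine ⟨O, hO, fun g V L hV hVT hVO hg hL hLV hg0 => ⟨Submodule.subset_span
    ⟨V, hV, hVT, hg, L, hLV, hL, hg0⟩, A, hA, fun f U K hU hUT hUA hf hK hKU hf0 =>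
    ⟨Submodule.subset_span ⟨U, hU, hUT, hf, K, hKU, hK, hf0⟩, ?_⟩⟩⟩
  have hKL : 𝒢.mulSet K L ⊆ W := by
    refine subset_trans ?_ hAO
    exact Set.image_mono (Set.inter_subset_inter_left _
      (Set.prod_mono (hKU.trans hUA) (hLV.trans hVO)))
  exact Submodule.subset_span ⟨W, hW, hWT,
    μ.continuousOn_convBilin β hU hUT hf hKU hK hf0 hV hVT hg hLV hL hg0 hW hWT hKL,
    _, hKL, 𝒢.isCompact_mulSet hK hL, fun γ hγ => μ.convBilin_eq_zero β hf0 hg0 hγ⟩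

end HaarSystem

end LieGroupoid

/-! ### The universal property of C⋆(G, B) -/

namespace LieGroupoid

namespace HaarSystem

variable {𝒢 : LieGroupoid EG EM G M} (μ : 𝒢.HaarSystem) {B : Type v} [NonUnitalCStarAlgebra B]

/-- The convolution product on `C_c(G, B)`. -/
noncomputable def convCc (f g : Cc G B) : Cc G B :=
  ⟨μ.conv f g, μ.convBilin_mem (ContinuousLinearMap.mul ℂ B) f.2 g.2⟩

/-- Both the masses of `K` and those of its inverse enter, because the I-norm also integrates
f(γ⁻¹). -/
lemma exists_INorm_le {K : Set G} (hK : IsCompact K) :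
    ∃ C : ℝ, 0 ≤ C ∧ ∀ (f : G → B) (ε : ℝ), (∀ γ, ‖f γ‖ ≤ ε) → (∀ γ ∉ K, f γ = 0) →
      μ.INorm f ≤ ENNReal.ofReal (C * ε) := by
  obtain ⟨C, hC, h⟩ := μ.exists_lintegral_enorm_le (E := B) hK
  obtain ⟨D, hD, h'⟩ := μ.exists_lintegral_enorm_le (E := B) (hK.image 𝒢.continuous_inv)
  refine ⟨max C D, le_max_of_le_left hC, fun f ε hf hf0 => iSup_le fun x => ?_⟩
  have hε := (norm_nonneg _).trans (hf (𝒢.one x))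
  refine max_le ?_ ?_
  · refine (h x _ ε (fun γ => hf γ) fun γ hγ => hf0 γ hγ).trans (ENNReal.ofReal_le_ofReal ?_)
    exact mul_le_mul_of_nonneg_right (le_max_left _ _) hε
  · refine (h' x _ ε (fun γ => hf _) fun γ hγ => hf0 _ fun h => hγ ⟨_, h, 𝒢.inv_inv _⟩).trans
      (ENNReal.ofReal_le_ofReal ?_)
    exact mul_le_mul_of_nonneg_right (le_max_right _ _) hε

lemma INorm_mono {B₁ B₂ : Type*} [NonUnitalCStarAlgebra B₁] [NonUnitalCStarAlgebra B₂]
    {f : G → B₁} {g : G → B₂} (h : ∀ γ, ‖f γ‖ ≤ ‖g γ‖) : μ.INorm f ≤ μ.INorm g :=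
  iSup_mono fun x => max_le_max
    (lintegral_mono fun γ => by
      rw [← ofReal_norm, ← ofReal_norm]; exact ENNReal.ofReal_le_ofReal (h _))
    (lintegral_mono fun γ => by
      rw [← ofReal_norm, ← ofReal_norm]; exact ENNReal.ofReal_le_ofReal (h _))

/-- Right convolution factors supported in a fixed compact set act continuously from the supremum
norm to the `I`-norm. -/
lemma exists_INorm_convBilin_le {B₁ B₂ B₃ : Type*} [NonUnitalCStarAlgebra B₁]
    [NonUnitalCStarAlgebra B₂] [NonUnitalCStarAlgebra B₃] (β : B₁ →L[ℂ] B₂ →L[ℂ] B₃) {f : G → B₁}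
    (hf : f ∈ Cc G B₁) {L : Set G} (hL : IsCompact L) :
    ∃ C : ℝ, 0 ≤ C ∧ ∀ (g : G → B₂) (ε : ℝ), (∀ γ, ‖g γ‖ ≤ ε) → (∀ γ ∉ L, g γ = 0) →
      μ.INorm (μ.convBilin β f g) ≤ ENNReal.ofReal (C * ε) := by
  obtain ⟨K, hK, D, hD, hf0⟩ := Cc.bounded hf
  obtain ⟨C₁, hC₁, h₁⟩ := μ.exists_norm_integral_le (E := B₃) hL
  obtain ⟨C₂, hC₂, h₂⟩ := μ.exists_INorm_le (B := B₃) (𝒢.isCompact_mulSet hK hL)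
  rcases isEmpty_or_nonempty G with hG | ⟨⟨γ₀⟩⟩
  · refine ⟨0, le_rfl, fun g ε _ _ => ?_⟩
    refine iSup_le fun x => ?_
    exact isEmptyElim (𝒢.one x)
  have hD0 := (norm_nonneg _).trans (hD γ₀)
  -- The integrand is at most ‖β‖ D ε; `C₁` integrates it over `L`, and `C₂` passes from the
  -- supremum norm on the product of `K` and `L` to the I-norm.
  refine ⟨C₂ * (C₁ * (‖β‖ * D)), by positivity, fun g ε hg hg0 => ?_⟩
  have hε := (norm_nonneg _).trans (hg γ₀)
  have := h₂ (μ.convBilin β f g) (C₁ * (‖β‖ * D * ε)) (fun γ => ?_)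
    fun γ hγ => μ.convBilin_eq_zero β hf0 hg0 hγ
  · refine this.trans (le_of_eq ?_)
    congr 1
    ring
  · refine h₁ _ _ _ (by positivity) (fun η => (β.le_opNorm₂ _ _).trans ?_) fun η hη => ?_
    · gcongr
      · exact hD _
      · exact hg _
    · rw [hg0 _ hη, map_zero]

lemma norm_toLin_le (ρ : μ.BoundedRep B) (f : Cc G B) : ‖ρ.toLin f‖ ≤ ‖μ.toFull f‖ :=
  lp.norm_apply_le_norm (E := fun ρ : μ.BoundedRep B => ρ.H →L[ℂ] ρ.H) ENNReal.top_ne_zero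
    (μ.univ f) ρ

lemma norm_toFull_le {f : Cc G B} {C : ℝ} (hC : 0 ≤ C)
    (h : ∀ ρ : μ.BoundedRep B, ‖ρ.toLin f‖ ≤ C) : ‖μ.toFull f‖ ≤ C :=
  lp.norm_le_of_forall_le (E := fun ρ : μ.BoundedRep B => ρ.H →L[ℂ] ρ.H) (f := μ.univ f) hC h

lemma enorm_toFull_le (f : Cc G B) : ‖μ.toFull f‖ₑ ≤ μ.INorm f := by
  rw [← ofReal_norm]
  refine ENNReal.ofReal_le_of_le_toReal (μ.norm_toFull_le ENNReal.toReal_nonneg fun ρ => ?_)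
  have := ENNReal.toReal_mono (μ.INorm_ne_top f) (ρ.bounded f)
  rwa [toReal_enorm] at this

lemma toFull_convCc (f g : Cc G B) : μ.toFull (μ.convCc f g) = μ.toFull f * μ.toFull g :=
  Subtype.ext (Subtype.ext (funext fun ρ => ρ.map_conv f g _ fun _ => rfl))

lemma toFull_adj (f : Cc G B) : μ.toFull (𝒢.adj f) = star (μ.toFull f) :=
  Subtype.ext (Subtype.ext (funext fun ρ => ρ.map_adj f))

/-- Convolutions and adjoints stay in C_c(G, B), so its image is already a ⋆-algebra and adjoining
adds nothing. -/
lemma denseRange_toFull : DenseRange (μ.toFull (B := B)) := by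
  let S : NonUnitalStarSubalgebra ℂ (μ.RepProd B) :=
    { carrier := Set.range (μ.univ (B := B))
      add_mem' := by
        rintro _ _ ⟨f, rfl⟩ ⟨g, rfl⟩
        exact ⟨f + g, map_add _ f g⟩
      zero_mem' := ⟨0, map_zero _⟩
      mul_mem' := by
        rintro _ _ ⟨f, rfl⟩ ⟨g, rfl⟩
        exact ⟨μ.convCc f g, congrArg Subtype.val (μ.toFull_convCc f g)⟩
      smul_mem' := by
        rintro c _ ⟨f, rfl⟩
        exact ⟨c • f, map_smul (μ.univ (B := B)) c f⟩
      star_mem' := by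
        rintro _ ⟨f, rfl⟩
        exact ⟨𝒢.adj f, congrArg Subtype.val (μ.toFull_adj f)⟩ }
  have hS : NonUnitalStarAlgebra.adjoin ℂ (Set.range (μ.univ (B := B))) ≤ S :=
    NonUnitalStarAlgebra.adjoin_le (fun x hx => hx)
  intro x
  rw [closure_subtype, ← Set.range_comp]
  have hx : (x : μ.RepProd B) ∈ closure
      (NonUnitalStarAlgebra.adjoin ℂ (Set.range (μ.univ (B := B))) : Set (μ.RepProd B)) := x.2
  exact closure_mono (fun y hy => hS hy) hx

/-- Bounded ⋆-homomorphisms from `C_c(G, B)` to arbitrary C⋆-algebras are dominated by the norm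
of `C⋆(G, B)`. -/
lemma norm_le_norm_toFull {A : Type*} [NonUnitalCStarAlgebra A] (θ : Cc G B →ₗ[ℂ] A)
    (hmul : ∀ f g, θ (μ.convCc f g) = θ f * θ g) (hstar : ∀ f, θ (𝒢.adj f) = star (θ f))
    (hbound : ∀ f : Cc G B, ‖θ f‖ₑ ≤ μ.INorm f) (f : Cc G B) : ‖θ f‖ ≤ ‖μ.toFull f‖ := by
  obtain ⟨H', _, _, _, π, ξ, hξ, hπξ⟩ := exists_representation_norm_attained (θ f)
  have hπ : ∀ a, ‖π a‖ ≤ ‖a‖ := fun a => NonUnitalStarAlgHom.norm_apply_le π a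
  -- The range is spanned by ξ and its orbit. The scalar component keeps ξ in the subspace even if
  -- the representation is degenerate.
  let T : ℂ × Cc G B →ₗ[ℂ] H' :=
    { toFun := fun p => p.1 • ξ + π (θ p.2) ξ
      map_add' := fun p q => by
        simp only [Prod.fst_add, Prod.snd_add, map_add, add_smul, add_apply]
        abel
      map_smul' := fun c p => by
        simp only [Prod.smul_fst, Prod.smul_snd, map_smul, smul_add, smul_smul, smul_eq_mul,
          smul_apply, RingHom.id_apply] }
  let K : Submodule ℂ H' := (LinearMap.range T).topologicalClosure
  have hKc : IsClosed (K : Set H') := Submodule.isClosed_topologicalClosure _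
  have : CompleteSpace K := hKc.completeSpace_coe
  have hsmall : Small.{max u v} K := by
    -- A point of the closure is determined by the pullback of its neighbourhood filter along `T`,
    -- so `K` injects into the filters on ℂ × C_c(G, B), a type in the right universe.
    refine small_of_injective (f := fun x : K => comap T (𝓝 (x : H'))) fun x y hxy => ?_
    have hx : (x : H') ∈ closure (Set.range T) := x.2
    have : (comap T (𝓝 (x : H'))).NeBot := comap_neBot fun t ht => by
      obtain ⟨_, hyt, p, rfl⟩ := mem_closure_iff_nhds.1 hx t ht
      exact ⟨p, hyt⟩
    refine Subtype.ext (tendsto_nhds_unique (tendsto_comap (f := T) (x := 𝓝 (x : H'))) ?_)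
    have hxy' : comap T (𝓝 (x : H')) = comap T (𝓝 (y : H')) := hxy
    rw [hxy']
    exact tendsto_comap
  obtain ⟨H, _, _, _, ⟨e⟩⟩ := exists_shrink_hilbert.{max u v} (K := K)
  let W : H →ₗᵢ[ℂ] H' := K.subtypeₗᵢ.comp e.toLinearIsometry
  have hWmem : ∀ x, W x ∈ K := fun x => (e x).2
  have hWsurj : ∀ y ∈ K, ∃ x, W x = y := fun y hy => ⟨e.symm ⟨y, hy⟩, by simp [W]⟩
  let Wc : H →L[ℂ] H' := W.toContinuousLinearMap
  have hWW : ∀ x, Wc.adjoint (W x) = x := fun x =>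
    ext_inner_right ℂ fun y => by
      rw [ContinuousLinearMap.adjoint_inner_left]
      exact W.inner_map_map x y
  have hinv : ∀ (g : Cc G B), ∀ y ∈ K, π (θ g) y ∈ K := by
    intro g y hy
    refine map_mem_closure (π (θ g)).continuous hy ?_
    rintro _ ⟨⟨c, h⟩, rfl⟩
    refine ⟨(0, c • g + μ.convCc g h), ?_⟩
    simp [T, hmul]
  -- By invariance of `K` the projection W W⋆ does nothing here; this makes the compression by `W`
  -- multiplicative.
  have hW : ∀ g x, W (Wc.adjoint (π (θ g) (W x))) = π (θ g) (W x) := by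
    intro g x
    obtain ⟨z, hz⟩ := hWsurj _ (hinv g _ (hWmem x))
    rw [← hz, hWW]
  let ρ : μ.BoundedRep B :=
    { H := H
      toLin :=
        { toFun := fun g => Wc.adjoint ∘L π (θ g) ∘L Wc
          map_add' := fun g h => by
            ext x
            simp
          map_smul' := fun c g => by
            ext x
            simp }
      map_conv := fun g h k hk => by
        have hkc : k = μ.convCc g h := Subtype.ext (funext hk)
        ext x
        change Wc.adjoint (π (θ k) (W x)) =
          Wc.adjoint (π (θ g) (W (Wc.adjoint (π (θ h) (W x)))))
        rw [hW, hkc, hmul, map_mul]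
        rfl
      map_adj := fun g => by
        change Wc.adjoint ∘L π (θ (𝒢.adj g)) ∘L Wc =
          ContinuousLinearMap.adjoint (Wc.adjoint ∘L π (θ g) ∘L Wc)
        rw [ContinuousLinearMap.adjoint_comp, ContinuousLinearMap.adjoint_comp,
          ContinuousLinearMap.adjoint_adjoint, hstar, map_star]
        rfl
      bounded := fun g => by
        refine le_trans ?_ (hbound g)
        rw [← ofReal_norm, ← ofReal_norm]
        refine ENNReal.ofReal_le_ofReal (ContinuousLinearMap.opNorm_le_bound _ (norm_nonneg _) ?_)
        intro x
        change ‖Wc.adjoint (π (θ g) (W x))‖ ≤ _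
        rw [← W.norm_map, hW, ← W.norm_map x]
        exact (π (θ g)).le_of_opNorm_le (hπ _) _ }
  refine le_trans ?_ (μ.norm_toLin_le ρ f)
  obtain ⟨z, hz⟩ := hWsurj ξ (Submodule.le_topologicalClosure _ ⟨(1, 0), by simp [T]⟩)
  have h1 : ‖ρ.toLin f z‖ = ‖θ f‖ * ‖z‖ := by
    change ‖Wc.adjoint (π (θ f) (W z))‖ = _
    rw [← W.norm_map, hW, ← W.norm_map z, hz, hπξ]
  have hz0 : 0 < ‖z‖ := by
    rw [← W.norm_map, hz]
    exact norm_pos_iff.2 hξ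
  have h2 := (ρ.toLin f).le_opNorm z
  rw [h1] at h2
  exact le_of_mul_le_mul_right h2 hz0

/-- The universal property of `C⋆(G, B)`. -/
lemma exists_lift {A : Type*} [NonUnitalCStarAlgebra A] (θ : Cc G B →ₗ[ℂ] A)
    (hmul : ∀ f g, θ (μ.convCc f g) = θ f * θ g) (hstar : ∀ f, θ (𝒢.adj f) = star (θ f))
    (hbound : ∀ f : Cc G B, ‖θ f‖ₑ ≤ μ.INorm f) :
    ∃ Θ : μ.FullCStar B →⋆ₙₐ[ℂ] A, ∀ f, Θ (μ.toFull f) = θ f := by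
  let Θ : μ.FullCStar B →L[ℂ] A := θ.extendOfNorm (μ.toFull (B := B))
  have hΘ : ∀ f, Θ (μ.toFull f) = θ f := LinearMap.extendOfNorm_eq μ.denseRange_toFull
    ⟨1, fun f => by rw [_root_.one_mul]; exact μ.norm_le_norm_toFull θ hmul hstar hbound f⟩
  refine ⟨{ toFun := Θ, map_smul' := map_smul Θ, map_zero' := map_zero Θ, map_add' := map_add Θ,
            map_mul' := fun x y => ?_, map_star' := fun x => ?_ }, hΘ⟩
  · refine μ.denseRange_toFull.induction_on₂ (p := fun x y => Θ (x * y) = Θ x * Θ y)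
      (isClosed_eq (by fun_prop) (by fun_prop)) (fun f g => ?_) x y
    rw [← toFull_convCc, hΘ, hΘ, hΘ, hmul]
  · refine μ.denseRange_toFull.induction_on (p := fun x => Θ (star x) = star (Θ x)) x
      (isClosed_eq (by fun_prop) (by fun_prop)) (fun f => ?_)
    rw [← toFull_adj, hΘ, hΘ, hstar]

end HaarSystem

end LieGroupoid

end Groupoid

/-! ### Strong limits and uniform estimates along approximate units -/

lemma Submodule.eq_top_of_forall_orthogonal_mem {H : Type*} [NormedAddCommGroup H]
    [InnerProductSpace ℂ H] [CompleteSpace H] {D : Submodule ℂ H} (hD : IsClosed (D : Set H))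
    {S : Set H} (hS : S ⊆ D) (h : ∀ ξ, (∀ ζ ∈ S, inner ℂ ζ ξ = 0) → ξ ∈ D) : D = ⊤ := by
  have : CompleteSpace D := hD.completeSpace_coe
  rw [← Submodule.orthogonal_eq_bot_iff, Submodule.eq_bot_iff]
  intro ξ hξ
  have h1 := h ξ fun ζ hζ => (Submodule.mem_orthogonal D ξ).1 hξ ζ (hS hζ)
  exact inner_self_eq_zero.1 ((Submodule.mem_orthogonal D ξ).1 hξ ξ h1)

/-- An eventually bounded family of operators that converges pointwise on a set and on its
orthogonal complement converges strongly. -/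
lemma ContinuousLinearMap.exists_strong_limit {H : Type*} [NormedAddCommGroup H]
    [InnerProductSpace ℂ H] [CompleteSpace H] {ι : Type*} {l : Filter ι} [l.NeBot]
    {u : ι → H →L[ℂ] H} {C : ℝ} (hC0 : 0 ≤ C) (hC : ∀ᶠ i in l, ‖u i‖ ≤ C) {S : Set H}
    (hS : ∀ ξ ∈ S, ∃ η, Tendsto (fun i => u i ξ) l (𝓝 η))
    (h : ∀ ξ, (∀ ζ ∈ S, inner ℂ ζ ξ = 0) → ∃ η, Tendsto (fun i => u i ξ) l (𝓝 η)) :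
    ∃ T : H →L[ℂ] H, ‖T‖ ≤ C ∧ ∀ ξ, Tendsto (fun i => u i ξ) l (𝓝 (T ξ)) := by
  -- The vectors at which the family converges form a subspace, closed by the uniform bound. It
  -- contains `S` and the orthogonal complement of `S`, so it is everything.
  let D : Submodule ℂ H :=
    { carrier := {ξ | ∃ η, Tendsto (fun i => u i ξ) l (𝓝 η)}
      add_mem' := by
        rintro ξ ξ' ⟨η, hη⟩ ⟨η', hη'⟩
        exact ⟨η + η', by simpa using hη.add hη'⟩
      zero_mem' := ⟨0, by simp⟩
      smul_mem' := by
        rintro c ξ ⟨η, hη⟩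
        exact ⟨c • η, by simpa using hη.const_smul c⟩ }
  have hD : IsClosed (D : Set H) := by
    rw [← isSeqClosed_iff_isClosed]
    intro ξ ξ₀ hξ hlim
    have hcau : Cauchy (map (fun i => u i ξ₀) l) := by
      rw [Metric.cauchy_iff]
      refine ⟨inferInstance, fun ε hε => ?_⟩
      obtain ⟨n, hn⟩ := ((Metric.tendsto_nhds.1 hlim) (ε / (4 * (C + 1))) (by positivity)).exists
      obtain ⟨η, hη⟩ := hξ n
      have h1 := Metric.tendsto_nhds.1 hη (ε / 4) (by positivity)
      have h2 : ∀ᶠ i in l, dist (u i ξ₀) η < ε / 2 := by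
        filter_upwards [h1, hC] with i hi hCi
        have h3 : dist (u i ξ₀) (u i (ξ n)) ≤ ε / 4 := by
          rw [dist_eq_norm, ← map_sub]
          refine ((u i).le_of_opNorm_le hCi _).trans ?_
          rw [dist_comm, dist_eq_norm] at hn
          calc C * ‖ξ₀ - ξ n‖ ≤ (C + 1) * (ε / (4 * (C + 1))) := by
                have := norm_nonneg (ξ₀ - ξ n)
                gcongr
                linarith
            _ = ε / 4 := by field_simp
        have := dist_triangle (u i ξ₀) (u i (ξ n)) η
        linarith
      refine ⟨_, image_mem_map h2, ?_⟩
      rintro _ ⟨i, hi, rfl⟩ _ ⟨j, hj, rfl⟩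
      have hi' : dist (u i ξ₀) η < ε / 2 := hi
      have hj' : dist (u j ξ₀) η < ε / 2 := hj
      have := dist_triangle_right (u i ξ₀) (u j ξ₀) η
      linarith
    exact CompleteSpace.complete hcau
  have htop := Submodule.eq_top_of_forall_orthogonal_mem hD hS h
  choose T hT using fun ξ => (htop ▸ Submodule.mem_top : ξ ∈ D)
  refine ⟨LinearMap.mkContinuous
    { toFun := T
      map_add' := fun ξ η => tendsto_nhds_unique (hT _) (by simpa using (hT ξ).add (hT η))
      map_smul' := fun c ξ =>
        tendsto_nhds_unique (hT _) (by simpa using (hT ξ).const_smul c) } C ?_,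
    LinearMap.mkContinuous_norm_le _ hC0 _, hT⟩
  intro ξ
  refine le_of_tendsto (hT ξ).norm ?_
  filter_upwards [hC] with i hi
  exact (u i).le_of_opNorm_le hi ξ

namespace Cc

variable {X B C : Type*} [TopologicalSpace X] [NonUnitalCStarAlgebra B] [NonUnitalCStarAlgebra C]

/-- The map `C_c(X, B) → C_c(X, C)` induced by a bounded linear map. -/
def mapCLM (φ : B →L[ℂ] C) : Cc X B →ₗ[ℂ] Cc X C where
  toFun f := ⟨φ ∘ f, clm_comp_mem φ f.2⟩
  map_add' f g := by ext x; simp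
  map_smul' c f := by ext x; simp

end Cc

namespace ClosedIdeal

variable {B : Type*} [NonUnitalCStarAlgebra B] (J : ClosedIdeal B)

/-- The left multiplication action of `B` on its ideal `J`. -/
noncomputable def mulL : B →L[ℂ] J.toStarSubalgebra →L[ℂ] J.toStarSubalgebra :=
  LinearMap.mkContinuous₂
    (LinearMap.mk₂ ℂ (fun (b : B) (x : J.toStarSubalgebra) =>
      (⟨b * x, J.mul_left b x.2⟩ : J.toStarSubalgebra))
      (fun b c x => Subtype.ext (add_mul b c (x : B)))
      (fun c b x => Subtype.ext (smul_mul_assoc c b (x : B)))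
      (fun b x y => Subtype.ext (mul_add b (x : B) y))
      (fun c b x => Subtype.ext (mul_smul_comm c b (x : B)))) 1
    fun b x => by rw [one_mul]; exact norm_mul_le b (x : B)

/-- The inclusion of an ideal as a bounded linear map. -/
noncomputable def inclL : J.toStarSubalgebra →L[ℂ] B :=
  ⟨(J.incl : J.toStarSubalgebra →ₗ[ℂ] B), continuous_subtype_val⟩

variable {J} {l : Filter J.toStarSubalgebra}

/-- For a contraction `e` the function ‖e x - x‖ of `x` is 2-Lipschitz, so pointwise convergence is
uniform on compact sets. -/
lemma eventually_forall_norm_mul_sub_le (hl : l.IsApproximateUnit)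
    (h : ∀ᶠ e : J.toStarSubalgebra in l, star e = e ∧ ‖e‖ ≤ 1 ∧ ∀ b : B, ‖b - b * e‖ ≤ ‖b‖)
    {S : Set J.toStarSubalgebra} (hS : IsCompact S) {ε : ℝ}
    (hε : 0 < ε) : ∀ᶠ e in l, ∀ x ∈ S, ‖e * x - x‖ ≤ ε := by
  refine hS.totallyBounded.eventually_forall_le ?_ (fun x ε hε => ?_) hε
  · filter_upwards [h] with e he x y
    have h1 : e * x - x = (e * y - y) + (e * (x - y) - (x - y)) := by
      rw [mul_sub]; abel
    have h2 : ‖e * (x - y)‖ ≤ 1 * ‖x - y‖ :=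
      (norm_mul_le _ _).trans (mul_le_mul_of_nonneg_right he.2.1 (norm_nonneg _))
    have h3 := norm_sub_le (e * (x - y)) (x - y)
    rw [h1]
    refine (norm_add_le _ _).trans ?_
    linarith
  · filter_upwards [Metric.tendsto_nhds.1 (hl.tendsto_mul_right x) ε hε] with e he
    rw [dist_eq_norm] at he
    exact he.le

lemma eventually_forall_norm_sub_mul_le (hl : l.IsApproximateUnit)
    (h : ∀ᶠ e : J.toStarSubalgebra in l, star e = e ∧ ‖e‖ ≤ 1 ∧ ∀ b : B, ‖b - b * e‖ ≤ ‖b‖)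
    {S : Set J.toStarSubalgebra} (hS : IsCompact S) {ε : ℝ}
    (hε : 0 < ε) : ∀ᶠ e in l, ∀ x ∈ S, ‖x * e - x‖ ≤ ε := by
  refine hS.totallyBounded.eventually_forall_le ?_ (fun x ε hε => ?_) hε
  · filter_upwards [h] with e he x y
    have h1 : x * e - x = (y * e - y) + ((x - y) * e - (x - y)) := by
      rw [sub_mul]; abel
    have h2 : ‖(x - y) * e‖ ≤ ‖x - y‖ * 1 :=
      (norm_mul_le _ _).trans (mul_le_mul_of_nonneg_left he.2.1 (norm_nonneg _))
    have h3 := norm_sub_le ((x - y) * e) (x - y)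
    rw [h1]
    refine (norm_add_le _ _).trans ?_
    linarith
  · filter_upwards [Metric.tendsto_nhds.1 (hl.tendsto_mul_left x) ε hε] with e he
    rw [dist_eq_norm] at he
    exact he.le

/-- Both ‖b - b e‖ and the quotient norm are 1-Lipschitz in `b`, so the pointwise bound of
`eventually_norm_sub_mul_le` becomes uniform. -/
lemma eventually_forall_norm_sub_mul_le_norm_mk (hl : l.IsApproximateUnit)
    (h : ∀ᶠ e : J.toStarSubalgebra in l, star e = e ∧ ‖e‖ ≤ 1 ∧ ∀ b : B, ‖b - b * e‖ ≤ ‖b‖)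
    {S : Set B} (hS : IsCompact S) {ε : ℝ}
    (hε : 0 < ε) :
    ∀ᶠ e : J.toStarSubalgebra in l, ∀ b ∈ S, ‖b - b * e‖ - ‖(Quot.mk b : J.Quot)‖ ≤ ε := by
  refine hS.totallyBounded.eventually_forall_le ?_ (fun b ε hε => ?_) hε
  · filter_upwards [h] with e he x y
    have h1 : x - x * e = (y - y * e) + ((x - y) - (x - y) * e) := by
      rw [sub_mul]; abel
    have h2 := he.2.2 (x - y)
    have h3 : ‖(Quot.mk y : J.Quot)‖ ≤ ‖(Quot.mk x : J.Quot)‖ + ‖x - y‖ := by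
      have h4 : (Quot.mk y : J.Quot) = Quot.mk x - Quot.mk (x - y) := by
        rw [← Quot.mk_sub, sub_sub_cancel]
      rw [h4]
      exact (norm_sub_le _ _).trans (add_le_add le_rfl (Quot.norm_mk_le _))
    have h5 := norm_add_le (y - y * e) ((x - y) - (x - y) * e)
    rw [← h1] at h5
    linarith
  · filter_upwards [eventually_norm_sub_mul_le hl h b hε] with e he
    linarith

end ClosedIdeal

section Groupoid

universe u v

variable {EG EM : Type*} [NormedAddCommGroup EG] [NormedSpace ℝ EG] [FiniteDimensional ℝ EG]
  [NormedAddCommGroup EM] [NormedSpace ℝ EM]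
variable {G : Type u} {M : Type*}
  [TopologicalSpace G] [ChartedSpace EG G] [IsManifold 𝓘(ℝ, EG) ∞ G]
  [TopologicalSpace M] [T2Space M] [ChartedSpace EM M] [IsManifold 𝓘(ℝ, EM) ∞ M]

/-! ### Extension of representations from C_c(G, J) to C_c(G, B) -/

namespace LieGroupoid

namespace HaarSystem

variable {𝒢 : LieGroupoid EG EM G M} (μ : 𝒢.HaarSystem) {B : Type v} [NonUnitalCStarAlgebra B]

/-- The convolution of a `B`-valued with a `J`-valued function. -/
noncomputable def convIdeal (J : ClosedIdeal B) (f : Cc G B) (g : Cc G J.toStarSubalgebra) :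
    Cc G J.toStarSubalgebra :=
  ⟨μ.convBilin J.mulL f g, μ.convBilin_mem J.mulL f.2 g.2⟩

variable {J : ClosedIdeal B}

/-- This is what makes the image of C⋆(G, J) an ideal. -/
lemma map_incl_convIdeal (f : Cc G B) (g : Cc G J.toStarSubalgebra) :
    Cc.map J.incl (μ.convIdeal J f g) = μ.convCc f (Cc.map J.incl g) := by
  refine Subtype.ext (funext fun γ => ?_)
  exact (J.inclL.integral_comp_comm (integrable_convBilin (μ := μ) J.mulL f.2 g.2 γ)).symm

/-- Moving `e` from the left factor to the right one is what makes ρ(f e) converge on vectors ρ(g)η,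
because e g tends to g. -/
lemma convCc_mapCLM_flip (f : Cc G B) (g : Cc G J.toStarSubalgebra) (e : J.toStarSubalgebra) :
    μ.convCc (Cc.mapCLM (J.mulL.flip e) f) g
      = μ.convIdeal J f (Cc.mapCLM (ContinuousLinearMap.mul ℂ J.toStarSubalgebra e) g) := by
  refine Subtype.ext (funext fun γ => integral_congr_ae (Eventually.of_forall fun η => ?_))
  exact Subtype.ext (_root_.mul_assoc _ _ _)

lemma convIdeal_mapCLM_flip (f g : Cc G B) (e : J.toStarSubalgebra) :
    μ.convIdeal J f (Cc.mapCLM (J.mulL.flip e) g)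
      = Cc.mapCLM (J.mulL.flip e) (μ.convCc f g) := by
  refine Subtype.ext (funext fun γ => ?_)
  refine Eq.trans (integral_congr_ae (Eventually.of_forall fun η => ?_))
    ((J.mulL.flip e).integral_comp_comm
      (integrable_convBilin (μ := μ) (ContinuousLinearMap.mul ℂ B) f.2 g.2 γ))
  exact Subtype.ext (_root_.mul_assoc _ _ _).symm

/-- Self-adjointness of `e` brings it to the front, so that the adjoints of ρ(f e) can be followed
to the limit. -/
lemma convCc_adj_mapCLM_flip (f : Cc G B) (g : Cc G J.toStarSubalgebra) {e : J.toStarSubalgebra}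
    (he : star e = e) :
    μ.convCc (𝒢.adj (Cc.mapCLM (J.mulL.flip e) f)) g
      = Cc.mapCLM (ContinuousLinearMap.mul ℂ J.toStarSubalgebra e)
        (μ.convIdeal J (𝒢.adj f) g) := by
  refine Subtype.ext (funext fun γ => ?_)
  refine Eq.trans (integral_congr_ae (Eventually.of_forall fun η => ?_))
    ((ContinuousLinearMap.mul ℂ J.toStarSubalgebra e).integral_comp_comm
      (integrable_convBilin (μ := μ) J.mulL (𝒢.adj f).2 g.2 γ))
  have he' : star (e : B) = e := congrArg Subtype.val he
  refine Subtype.ext ?_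
  change star (f _ * (e : B)) * (g η : B) = e * (star (f _) * (g η : B))
  rw [star_mul, he', _root_.mul_assoc]

variable {l : Filter J.toStarSubalgebra}

/-- `P` stands for the I-norm, or for the I-norm after convolution with a fixed left factor. The
differences are uniformly small, as `g` takes values in a compact set, and are supported where `g`
is. -/
lemma eventually_INorm_mul_sub_le (hl : l.IsApproximateUnit)
    (h : ∀ᶠ e : J.toStarSubalgebra in l, star e = e ∧ ‖e‖ ≤ 1 ∧ ∀ b : B, ‖b - b * e‖ ≤ ‖b‖)
    (g : Cc G J.toStarSubalgebra) {ε : ℝ} (hε : 0 < ε)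
    {P : Cc G J.toStarSubalgebra → ℝ≥0∞}
    (hP : ∀ L : Set G, IsCompact L → ∃ C : ℝ, 0 ≤ C ∧ ∀ (g : Cc G J.toStarSubalgebra) (ε : ℝ),
      (∀ γ, ‖g γ‖ ≤ ε) → (∀ γ ∉ L, g γ = 0) → P g ≤ ENNReal.ofReal (C * ε)) :
    ∀ᶠ e in l, P (Cc.mapCLM (ContinuousLinearMap.mul ℂ J.toStarSubalgebra e) g - g)
        ≤ ENNReal.ofReal ε ∧
      P (Cc.mapCLM ((ContinuousLinearMap.mul ℂ J.toStarSubalgebra).flip e) g - g)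
        ≤ ENNReal.ofReal ε := by
  obtain ⟨S, hS, hgS⟩ := Cc.exists_isCompact_forall_mem g.2
  obtain ⟨L, hL, -, -, hg0⟩ := Cc.bounded g.2
  obtain ⟨C, hC, hCP⟩ := hP L hL
  have hε' : 0 < ε / (C + 1) := by positivity
  have hle : C * (ε / (C + 1)) ≤ ε := by
    rw [mul_div_assoc', div_le_iff₀ (by positivity)]
    nlinarith
  filter_upwards [ClosedIdeal.eventually_forall_norm_mul_sub_le hl h hS hε',
    ClosedIdeal.eventually_forall_norm_sub_mul_le hl h hS hε'] with e h1 h2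
  refine ⟨(hCP _ _ (fun γ => h1 _ (hgS γ)) fun γ hγ => ?_).trans (ENNReal.ofReal_le_ofReal hle),
    (hCP _ _ (fun γ => h2 _ (hgS γ)) fun γ hγ => ?_).trans (ENNReal.ofReal_le_ofReal hle)⟩
  · change e * g γ - g γ = 0
    rw [hg0 γ hγ, mul_zero, sub_zero]
  · change g γ * e - g γ = 0
    rw [hg0 γ hγ, zero_mul, sub_zero]

lemma BoundedRep.tendsto_toLin {μ : 𝒢.HaarSystem} (ρ : μ.BoundedRep B) {ι : Type*} {F : Filter ι}
    {k : ι → Cc G B} {k₀ : Cc G B}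
    (h : ∀ ε : ℝ, 0 < ε → ∀ᶠ i in F, μ.INorm (k i - k₀ : Cc G B) ≤ ENNReal.ofReal ε) :
    Tendsto (fun i => ρ.toLin (k i)) F (𝓝 (ρ.toLin k₀)) := by
  rw [Metric.tendsto_nhds]
  intro ε hε
  filter_upwards [h _ (half_pos hε)] with i hi
  have := (ρ.bounded _).trans hi
  rw [map_sub, ← ofReal_norm, ENNReal.ofReal_le_ofReal_iff (half_pos hε).le] at this
  rw [dist_eq_norm]
  linarith

/-- The inner product of ρ(g⋆)ρ(g)ξ with ξ is ‖ρ(g)ξ‖². -/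
lemma BoundedRep.toLin_eq_zero_of_orthogonal {μ : 𝒢.HaarSystem} (ρ : μ.BoundedRep B) {ξ : ρ.H}
    (hξ : ∀ ζ ∈ {ζ | ∃ (g : Cc G B) (η : ρ.H), ρ.toLin g η = ζ}, Inner.inner ℂ ζ ξ = 0) (g : Cc G B) :
    ρ.toLin g ξ = 0 := by
  have h1 := hξ _ ⟨𝒢.adj g, ρ.toLin g ξ, rfl⟩
  rw [ρ.map_adj, ContinuousLinearMap.star_eq_adjoint, ContinuousLinearMap.adjoint_inner_left] at h1
  exact inner_self_eq_zero.1 h1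

/-- A bounded representation of `C_c(G, J)` extends to `C_c(G, B)`. -/
lemma BoundedRep.exists_extension {μ : 𝒢.HaarSystem} (ρ : μ.BoundedRep J.toStarSubalgebra) :
    ∃ ρ' : μ.BoundedRep B, ∀ g, ‖ρ'.toLin (Cc.map J.incl g)‖ = ‖ρ.toLin g‖ := by
  obtain ⟨l, hl, h⟩ := J.exists_approximateUnit
  have := hl.neBot
  let S : Set ρ.H := {ζ | ∃ (g : Cc G J.toStarSubalgebra) (η : ρ.H), ρ.toLin g η = ζ}
  -- limits in the `I`-norm along the approximate unit
  have hlim1 : ∀ g : Cc G J.toStarSubalgebra, Tendsto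
      (fun e => ρ.toLin (Cc.mapCLM (ContinuousLinearMap.mul ℂ J.toStarSubalgebra e) g)) l
      (𝓝 (ρ.toLin g)) := fun g => ρ.tendsto_toLin fun ε hε =>
    (eventually_INorm_mul_sub_le hl h g hε (P := fun g => μ.INorm g)
      fun L hL => by
        obtain ⟨C, hC, hb⟩ := μ.exists_INorm_le (B := J.toStarSubalgebra) hL
        exact ⟨C, hC, fun g ε => hb g ε⟩).mono fun e he => he.1
  have hlim2 : ∀ g : Cc G J.toStarSubalgebra, Tendsto
      (fun e => ρ.toLin (Cc.mapCLM (J.mulL.flip e) (Cc.map J.incl g))) l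
      (𝓝 (ρ.toLin g)) := fun g => ρ.tendsto_toLin fun ε hε =>
    (eventually_INorm_mul_sub_le hl h g hε (P := fun g => μ.INorm g)
      fun L hL => by
        obtain ⟨C, hC, hb⟩ := μ.exists_INorm_le (B := J.toStarSubalgebra) hL
        exact ⟨C, hC, fun g ε => hb g ε⟩).mono fun e he => he.2
  have hlim3 : ∀ (f : Cc G B) (g : Cc G J.toStarSubalgebra), Tendsto
      (fun e => ρ.toLin (μ.convIdeal J f
        (Cc.mapCLM (ContinuousLinearMap.mul ℂ J.toStarSubalgebra e) g))) l
      (𝓝 (ρ.toLin (μ.convIdeal J f g))) := fun f g => ρ.tendsto_toLin fun ε hε => by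
    refine (eventually_INorm_mul_sub_le hl h g hε
      (P := fun g => μ.INorm (μ.convBilin J.mulL f g)) fun L hL => ?_).mono fun e he => ?_
    · obtain ⟨C, hC, hb⟩ := μ.exists_INorm_convBilin_le J.mulL f.2 hL
      exact ⟨C, hC, fun g ε => hb g ε⟩
    · refine le_of_eq_of_le ?_ he.1
      congr 1
      rw [AddSubgroupClass.coe_sub, sub_eq_iff_eq_add]
      have := μ.convBilin_add_right J.mulL f.2
        (Cc.mapCLM (ContinuousLinearMap.mul ℂ J.toStarSubalgebra e) g - g).2 g.2
      refine Eq.trans ?_ this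
      rw [← Submodule.coe_add, sub_add_cancel]
      rfl
  have hmul : ∀ (f g : Cc G J.toStarSubalgebra), ρ.toLin (μ.convCc f g)
      = ρ.toLin f * ρ.toLin g := fun f g => ρ.map_conv f g _ fun _ => rfl
  have hcomp : ∀ (f : Cc G B) (g : Cc G J.toStarSubalgebra) (η : ρ.H), Tendsto
      (fun e => ρ.toLin (Cc.mapCLM (J.mulL.flip e) f) (ρ.toLin g η)) l
      (𝓝 (ρ.toLin (μ.convIdeal J f g) η)) := fun f g η => by
    have h1 := ((ContinuousLinearMap.apply ℂ ρ.H η).continuous.tendsto _).comp (hlim3 f g)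
    refine h1.congr fun e => ?_
    change ρ.toLin (μ.convIdeal J f _) η = (ρ.toLin _ * ρ.toLin _) η
    rw [← hmul, convCc_mapCLM_flip]
  have hnull : ∀ ξ, (∀ ζ ∈ S, Inner.inner ℂ ζ ξ = 0) → ∀ g, ρ.toLin g ξ = 0 :=
    fun ξ hξ g => ρ.toLin_eq_zero_of_orthogonal hξ g
  -- Since ‖e‖ ≤ 1, f e is pointwise no larger than `f`; the I-norm bound survives in the limit.
  have hbd : ∀ f : Cc G B, ∀ᶠ e in l,
      ‖ρ.toLin (Cc.mapCLM (J.mulL.flip e) f)‖ ≤ (μ.INorm f).toReal := fun f => by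
    filter_upwards [h] with e he
    have h1 : μ.INorm (Cc.mapCLM (J.mulL.flip e) f) ≤ μ.INorm f := μ.INorm_mono fun γ => by
      refine (norm_mul_le (f γ) (e : B)).trans ?_
      exact mul_le_of_le_one_right (norm_nonneg _) he.2.1
    have := ENNReal.toReal_mono (μ.INorm_ne_top f) ((ρ.bounded _).trans h1)
    rwa [toReal_enorm] at this
  choose T hT1 hT2 using fun f => ContinuousLinearMap.exists_strong_limit (S := S)
    ENNReal.toReal_nonneg (hbd f)
    (by rintro _ ⟨g, η, rfl⟩; exact ⟨_, hcomp f g η⟩)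
    (fun ξ hξ => ⟨0, by simp only [hnull ξ hξ]; exact tendsto_const_nhds⟩)
  have hTmul : ∀ f g η, T f (ρ.toLin g η) = ρ.toLin (μ.convIdeal J f g) η := fun f g η =>
    tendsto_nhds_unique (hT2 f _) (hcomp f g η)
  have hTincl : ∀ g, T (Cc.map J.incl g) = ρ.toLin g := fun g => by
    ext ξ
    exact tendsto_nhds_unique (hT2 _ ξ)
      (((ContinuousLinearMap.apply ℂ ρ.H ξ).continuous.tendsto _).comp (hlim2 g))
  -- Adjoints are not strongly continuous, so the two operators are compared through inner products:
  -- on `S`, where `e` tends to act as the identity, and on its orthogonal complement, where both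
  -- vanish.
  have hTadj : ∀ f, T (𝒢.adj f) = star (T f) := fun f => by
    have htop : LinearMap.eqLocus (T (𝒢.adj f)).toLinearMap (star (T f)).toLinearMap = ⊤ := by
      refine Submodule.eq_top_of_forall_orthogonal_mem (S := S)
        (isClosed_eq (T (𝒢.adj f)).continuous (star (T f)).continuous) ?_ ?_
      · rintro _ ⟨g, η, rfl⟩
        refine ext_inner_left ℂ fun ξ => ?_
        change Inner.inner ℂ ξ (T (𝒢.adj f) (ρ.toLin g η)) = Inner.inner ℂ ξ (star (T f) (ρ.toLin g η))
        rw [ContinuousLinearMap.star_eq_adjoint, ContinuousLinearMap.adjoint_inner_right, hTmul]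
        have h1 := (hT2 f ξ).inner (𝕜 := ℂ) (tendsto_const_nhds (x := ρ.toLin g η))
        refine tendsto_nhds_unique ?_ h1
        have h2 := ((ContinuousLinearMap.apply ℂ ρ.H η).continuous.tendsto _).comp
          (hlim1 (μ.convIdeal J (𝒢.adj f) g))
        refine ((tendsto_const_nhds (x := ξ)).inner (𝕜 := ℂ) h2).congr' ?_
        filter_upwards [h] with e he
        rw [← ContinuousLinearMap.adjoint_inner_right, ← ContinuousLinearMap.star_eq_adjoint,
          ← ρ.map_adj]
        change Inner.inner ℂ ξ (ρ.toLin _ η) = Inner.inner ℂ ξ ((ρ.toLin _ * ρ.toLin _) η)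
        rw [← hmul, convCc_adj_mapCLM_flip μ f g he.1]
      · intro ξ hξ
        have h0 : ∀ f, T f ξ = 0 := fun f =>
          tendsto_nhds_unique (hT2 f ξ) (by simp only [hnull ξ hξ]; exact tendsto_const_nhds)
        refine ext_inner_left ℂ fun ζ => ?_
        change Inner.inner ℂ ζ (T (𝒢.adj f) ξ) = Inner.inner ℂ ζ (star (T f) ξ)
        rw [ContinuousLinearMap.star_eq_adjoint, ContinuousLinearMap.adjoint_inner_right, h0,
          inner_zero_right]
        have h1 := (hT2 f ζ).inner (𝕜 := ℂ) (tendsto_const_nhds (x := ξ))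
        refine tendsto_nhds_unique (tendsto_const_nhds.congr fun e => ?_) h1
        rw [← ContinuousLinearMap.adjoint_inner_right, ← ContinuousLinearMap.star_eq_adjoint,
          ← ρ.map_adj, hnull ξ hξ, inner_zero_right]
    ext ξ
    exact LinearMap.mem_eqLocus.1 (htop ▸ Submodule.mem_top)
  refine ⟨{ H := ρ.H
            toLin :=
              { toFun := T
                map_add' := fun f g => ?_
                map_smul' := fun c f => ?_ }
            map_conv := fun f g k hk => ?_
            map_adj := hTadj
            bounded := fun f => ?_ }, fun g => congrArg norm (hTincl g)⟩
  · ext ξ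
    refine tendsto_nhds_unique (hT2 _ ξ) (((hT2 f ξ).add (hT2 g ξ)).congr fun e => ?_)
    rw [map_add, map_add, add_apply]
  · ext ξ
    refine tendsto_nhds_unique (hT2 _ ξ) (((hT2 f ξ).const_smul c).congr fun e => ?_)
    rw [map_smul, map_smul, smul_apply]
  -- By `hTmul`, T(f) ρ(g e) = ρ(f ∗ (g e)) = ρ((f ∗ g) e), and the limit of both ends is taken.
  · have hkc : k = μ.convCc f g := Subtype.ext (funext hk)
    subst hkc
    ext ξ
    refine tendsto_nhds_unique (hT2 _ ξ)
      (((T f).continuous.tendsto _).comp (hT2 g ξ) |>.congr fun e => ?_)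
    rw [Function.comp_apply, hTmul, convIdeal_mapCLM_flip]
  · change ‖T f‖ₑ ≤ _
    rw [← ofReal_norm, ENNReal.ofReal_le_iff_le_toReal (μ.INorm_ne_top f)]
    exact hT1 f

/-- Each representation in the supremum on the left is the restriction of one in the supremum on the
right. -/
lemma norm_toFull_le_norm_toFull_incl (g : Cc G J.toStarSubalgebra) :
    ‖μ.toFull g‖ ≤ ‖μ.toFull (Cc.map J.incl g)‖ := by
  refine μ.norm_toFull_le (norm_nonneg _) fun ρ => ?_
  obtain ⟨ρ', h⟩ := ρ.exists_extension
  rw [← h]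
  exact μ.norm_toLin_le ρ' _

end HaarSystem

end LieGroupoid

/-! ### Functoriality in the coefficients and exactness -/

namespace LieGroupoid

namespace HaarSystem

variable {𝒢 : LieGroupoid EG EM G M} (μ : 𝒢.HaarSystem) {B C : Type v} [NonUnitalCStarAlgebra B]
  [NonUnitalCStarAlgebra C]

lemma map_convCc (φ : B →⋆ₙₐ[ℂ] C) (f g : Cc G B) :
    Cc.map φ (μ.convCc f g) = μ.convCc (Cc.map φ f) (Cc.map φ g) := by
  let φL : B →L[ℂ] C := ⟨(φ : B →ₗ[ℂ] C),
    NonUnitalStarAlgHom.instContinuousLinearMapClassComplex.map_continuous φ⟩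
  refine Subtype.ext (funext fun γ => ?_)
  refine Eq.trans (φL.integral_comp_comm (integrable_convBilin (μ := μ)
    (ContinuousLinearMap.mul ℂ B) f.2 g.2 γ)).symm
    (integral_congr_ae (Eventually.of_forall fun η => ?_))
  exact map_mul φ _ _

/-- Functoriality of `C⋆(G, B)` in the coefficient algebra. -/
lemma exists_fullCStar_map (φ : B →⋆ₙₐ[ℂ] C) :
    ∃ Φ : μ.FullCStar B →⋆ₙₐ[ℂ] μ.FullCStar C, ∀ f, Φ (μ.toFull f) = μ.toFull (Cc.map φ f) := by
  refine μ.exists_lift ((μ.toFull (B := C)).comp (Cc.map φ)) (fun f g => ?_) (fun f => ?_)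
    fun f => ?_
  · rw [LinearMap.comp_apply, map_convCc, toFull_convCc]
    rfl
  · rw [LinearMap.comp_apply, LinearMap.comp_apply, ← toFull_adj]
    congr 1
    exact Subtype.ext (funext fun γ => map_star φ _)
  · exact (μ.enorm_toFull_le _).trans
      (μ.INorm_mono fun γ => NonUnitalStarAlgHom.norm_apply_le φ _)

/-- The error ε is charged to the indicator of `K`. Its measurability is enough to split the lower
integral, with none assumed of `f` and `g`. -/
lemma exists_lintegral_enorm_le_add {E F : Type*} [NormedAddCommGroup E] [NormedAddCommGroup F]
    {K : Set G} (hK : IsCompact K) :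
    ∃ C : ℝ, 0 ≤ C ∧ ∀ (x : M) (f : 𝒢.Fiber x → E) (g : 𝒢.Fiber x → F) (ε : ℝ), 0 ≤ ε →
      (∀ γ, ‖f γ‖ ≤ ‖g γ‖ + ε) → (∀ γ : 𝒢.Fiber x, (γ : G) ∉ K → f γ = 0) →
      ∫⁻ γ, ‖f γ‖ₑ ∂(μ.meas x) ≤ (∫⁻ γ, ‖g γ‖ₑ ∂(μ.meas x)) + ENNReal.ofReal (C * ε) := by
  obtain ⟨C, hC, h⟩ := μ.exists_lintegral_enorm_le (E := ℝ) hK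
  refine ⟨C, hC, fun x f g ε hε hfg hf0 => ?_⟩
  have hKm : MeasurableSet ((fun γ : 𝒢.Fiber x => (γ : G)) ⁻¹' K) :=
    (Fiber.isCompact_preimage hK).isClosed.measurableSet
  let k : 𝒢.Fiber x → ℝ := ((fun γ : 𝒢.Fiber x => (γ : G)) ⁻¹' K).indicator fun _ => ε
  have hk : Measurable k := measurable_const.indicator hKm
  calc ∫⁻ γ, ‖f γ‖ₑ ∂(μ.meas x) ≤ ∫⁻ γ, (‖g γ‖ₑ + ‖k γ‖ₑ) ∂(μ.meas x) := by
        refine lintegral_mono fun γ => ?_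
        by_cases hγ : (γ : G) ∈ K
        · have hkγ : k γ = ε := Set.indicator_of_mem (s := (fun γ : 𝒢.Fiber x => (γ : G)) ⁻¹' K) hγ _
          rw [hkγ, ← ofReal_norm, ← ofReal_norm, ← ofReal_norm, Real.norm_of_nonneg hε,
            ← ENNReal.ofReal_add (norm_nonneg _) hε]
          exact ENNReal.ofReal_le_ofReal (hfg γ)
        · rw [hf0 γ hγ, enorm_zero]
          exact zero_le
    _ = (∫⁻ γ, ‖g γ‖ₑ ∂(μ.meas x)) + ∫⁻ γ, ‖k γ‖ₑ ∂(μ.meas x) :=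
        lintegral_add_right _ hk.enorm
    _ ≤ _ := by
        gcongr
        refine h x k ε (fun γ => ?_) fun γ hγ => Set.indicator_of_notMem
          (s := (fun γ : 𝒢.Fiber x => (γ : G)) ⁻¹' K) hγ _
        refine (norm_indicator_le_norm_self _ _).trans ?_
        rw [Real.norm_of_nonneg hε]

lemma exists_INorm_le_add {B₁ B₂ : Type*} [NonUnitalCStarAlgebra B₁] [NonUnitalCStarAlgebra B₂]
    {K : Set G} (hK : IsCompact K) :
    ∃ C : ℝ, 0 ≤ C ∧ ∀ (f : G → B₁) (g : G → B₂) (ε : ℝ), 0 ≤ ε → (∀ γ, ‖f γ‖ ≤ ‖g γ‖ + ε) →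
      (∀ γ ∉ K, f γ = 0) → μ.INorm f ≤ μ.INorm g + ENNReal.ofReal (C * ε) := by
  obtain ⟨C, hC, h⟩ := μ.exists_lintegral_enorm_le_add (E := B₁) (F := B₂) hK
  obtain ⟨D, hD, h'⟩ := μ.exists_lintegral_enorm_le_add (E := B₁) (F := B₂)
    (hK.image 𝒢.continuous_inv)
  refine ⟨max C D, le_max_of_le_left hC, fun f g ε hε hfg hf0 => iSup_le fun x => ?_⟩
  refine max_le ?_ ?_
  · refine (h x (fun γ => f γ) (fun γ => g γ) ε hε (fun γ => hfg γ) fun γ hγ => hf0 γ hγ).trans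
      (add_le_add (le_iSup_of_le x (le_max_left _ _)) (ENNReal.ofReal_le_ofReal ?_))
    exact mul_le_mul_of_nonneg_right (le_max_left _ _) hε
  · refine (h' x (fun γ => f (𝒢.inv γ)) (fun γ => g (𝒢.inv γ)) ε hε (fun γ => hfg _)
      fun γ hγ => hf0 _ fun h => hγ ⟨_, h, 𝒢.inv_inv _⟩).trans
      (add_le_add (le_iSup_of_le x (le_max_right _ _)) (ENNReal.ofReal_le_ofReal ?_))
    exact mul_le_mul_of_nonneg_right (le_max_right _ _) hε

/-- Modulo functions with values in the ideal `J`, the `I`-norm of `f` is at most the `I`-norm of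
its class. -/
lemma exists_INorm_sub_map_incl_le (J : ClosedIdeal B) (f : Cc G B) {ε : ℝ} (hε : 0 < ε) :
    ∃ g : Cc G J.toStarSubalgebra, μ.INorm (f - Cc.map J.incl g : Cc G B)
      ≤ μ.INorm (Cc.map J.proj f) + ENNReal.ofReal ε := by
  obtain ⟨l, hl, h⟩ := J.exists_approximateUnit
  have := hl.neBot
  obtain ⟨S, hS, hfS⟩ := Cc.exists_isCompact_forall_mem f.2
  obtain ⟨K, hK, -, -, hf0⟩ := Cc.bounded f.2
  obtain ⟨C, hC, hb⟩ := μ.exists_INorm_le_add (B₁ := B) (B₂ := J.Quot) hK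
  obtain ⟨e, he⟩ := (ClosedIdeal.eventually_forall_norm_sub_mul_le_norm_mk hl h hS
    (ε := ε / (C + 1)) (by positivity)).exists
  -- The function f e takes values in `J`, and ‖f - f e‖ is pointwise within ε / (C + 1) of the norm
  -- of the class of `f`.
  refine ⟨Cc.mapCLM (J.mulL.flip e) f, (hb _ (Cc.map J.proj f) (ε / (C + 1)) (by positivity)
    (fun γ => ?_) fun γ hγ => ?_).trans (add_le_add le_rfl (ENNReal.ofReal_le_ofReal ?_))⟩
  · have := he _ (hfS γ)
    change ‖f γ - f γ * e‖ ≤ ‖(ClosedIdeal.Quot.mk (f γ) : J.Quot)‖ + _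
    linarith
  · change f γ - f γ * e = 0
    rw [hf0 γ hγ, zero_mul, sub_zero]
  · rw [mul_div_assoc', div_le_iff₀ (by positivity)]
    nlinarith

variable {μ} {J : ClosedIdeal B} {ι : μ.FullCStar J.toStarSubalgebra →⋆ₙₐ[ℂ] μ.FullCStar B}

lemma fullCStar_continuous_starAlgHom {A₁ A₂ : Type*} [NonUnitalCStarAlgebra A₁]
    [NonUnitalCStarAlgebra A₂] (φ : A₁ →⋆ₙₐ[ℂ] A₂) : Continuous φ :=
  NonUnitalStarAlgHom.instContinuousLinearMapClassComplex.map_continuous φ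

lemma injective_of_map_incl (hι : ∀ g, ι (μ.toFull g) = μ.toFull (Cc.map J.incl g)) :
    Function.Injective ι := by
  have hn : ∀ x, ‖x‖ ≤ ‖ι x‖ := fun x =>
    μ.denseRange_toFull.induction_on (p := fun x => ‖x‖ ≤ ‖ι x‖) x
      (isClosed_le continuous_norm (fullCStar_continuous_starAlgHom ι).norm)
      fun g => by rw [hι]; exact μ.norm_toFull_le_norm_toFull_incl g
  refine (injective_iff_map_eq_zero ι).2 fun x hx => ?_
  have := hn x
  rw [hx, norm_zero] at this
  exact norm_le_zero_iff.1 this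

/-- The image of `C⋆(G, J)` as a closed ideal of `C⋆(G, B)`. -/
def rangeIdeal (ι : μ.FullCStar J.toStarSubalgebra →⋆ₙₐ[ℂ] μ.FullCStar B)
    (hι : ∀ g, ι (μ.toFull g) = μ.toFull (Cc.map J.incl g)) : ClosedIdeal (μ.FullCStar B) :=
  -- The range of `ι` is closed, so the ideal property need only be checked on the images of C_c(G,
  -- B) and C_c(G, J); the right-handed version follows by taking adjoints.
  have hleft : ∀ (b : μ.FullCStar B) (y : μ.FullCStar J.toStarSubalgebra),
      b * ι y ∈ Set.range ι := fun b y => by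
    have hc := fullCStar_continuous_starAlgHom ι
    have hr := ClosedIdeal.isClosed_range_starAlgHom ι
    refine μ.denseRange_toFull.induction_on (p := fun b => b * ι y ∈ Set.range ι) b
      (hr.preimage (continuous_id.mul continuous_const)) fun f => ?_
    refine μ.denseRange_toFull.induction_on (p := fun y => μ.toFull f * ι y ∈ Set.range ι) y
      (hr.preimage (continuous_const.mul hc)) fun g => ?_
    exact ⟨μ.toFull (μ.convIdeal J f g), by rw [hι, hι, map_incl_convIdeal, toFull_convCc]⟩
  { carrier := Set.range ι
    add_mem' := by
      rintro _ _ ⟨x, rfl⟩ ⟨y, rfl⟩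
      exact ⟨x + y, map_add ι x y⟩
    zero_mem' := ⟨0, map_zero ι⟩
    smul_mem' := by
      rintro c _ ⟨x, rfl⟩
      exact ⟨c • x, map_smul ι c x⟩
    mul_mem_left' := by
      rintro b _ ⟨y, rfl⟩
      exact hleft b y
    mul_mem_right' := by
      rintro _ ⟨y, rfl⟩ b
      obtain ⟨z, hz⟩ := hleft (star b) (star y)
      exact ⟨star z, by rw [map_star, hz, star_mul, map_star, star_star, star_star]⟩
    isClosed' := ClosedIdeal.isClosed_range_starAlgHom ι }

/-- A ⋆-homomorphism of `C⋆(G, B)` that vanishes on `C_c(G, J)` factors through `C⋆(G, B / J)`. -/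
lemma exists_comp_eq_of_map_incl_eq_zero {A : Type*} [NonUnitalCStarAlgebra A]
    {π : μ.FullCStar B →⋆ₙₐ[ℂ] μ.FullCStar J.Quot}
    (hπ : ∀ f, π (μ.toFull f) = μ.toFull (Cc.map J.proj f)) (ψ : μ.FullCStar B →⋆ₙₐ[ℂ] A)
    (hψ : ∀ g, ψ (μ.toFull (Cc.map J.incl g)) = 0) :
    ∃ Θ : μ.FullCStar J.Quot →⋆ₙₐ[ℂ] A, ∀ y, Θ (π y) = ψ y := by
  have : LocallyCompactSpace G := ChartedSpace.locallyCompactSpace EG G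
  let q : Cc G B →ₗ[ℂ] A := (ψ : μ.FullCStar B →ₗ[ℂ] A).comp (μ.toFull (B := B))
  have hqa : ∀ f, q f = ψ (μ.toFull f) := fun f => rfl
  -- As `q` kills C_c(G, J), `f` may be replaced by f - g with I-norm close to that of its class.
  have hq : ∀ f : Cc G B, ‖q f‖ₑ ≤ μ.INorm (Cc.map J.proj f) := fun f => by
    refine ENNReal.le_of_forall_pos_le_add fun ε hε _ => ?_
    obtain ⟨g, hg⟩ := μ.exists_INorm_sub_map_incl_le J f (ε := ε) (by exact_mod_cast hε)
    rw [ENNReal.ofReal_coe_nnreal] at hg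
    refine le_trans ?_ hg
    have h1 : q f = q (f - Cc.map J.incl g) := by rw [map_sub, hqa (Cc.map J.incl g), hψ, sub_zero]
    rw [h1, hqa]
    refine le_trans ?_ (μ.enorm_toFull_le _)
    rw [← ofReal_norm, ← ofReal_norm]
    exact ENNReal.ofReal_le_ofReal (NonUnitalStarAlgHom.norm_apply_le ψ _)
  have hsurj := Cc.map_proj_surjective (X := G) J
  have hker : ∀ f f' : Cc G B, Cc.map J.proj f = Cc.map J.proj f' → q f = q f' := by
    intro f f' hff
    have h0 := hq (f - f')
    have h1 : μ.INorm (Cc.map J.proj (f - f') : Cc G J.Quot) = 0 := by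
      rw [map_sub, hff, sub_self]
      simp [INorm]
    rw [h1, nonpos_iff_eq_zero, enorm_eq_zero, map_sub, sub_eq_zero] at h0
    exact h0
  -- The lifts are chosen arbitrarily; by `hker` the value of `q` does not depend on them, which
  -- makes θ linear.
  let s : Cc G J.Quot → Cc G B := Function.surjInv hsurj
  have hs : ∀ f, Cc.map J.proj (s f) = f := Function.surjInv_eq hsurj
  let θ : Cc G J.Quot →ₗ[ℂ] A :=
    { toFun := fun f => q (s f)
      map_add' := fun f g => by
        rw [← map_add]
        exact hker _ _ (by rw [map_add, hs, hs, hs])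
      map_smul' := fun c f => by
        rw [RingHom.id_apply, ← map_smul]
        exact hker _ _ (by rw [map_smul, hs, hs]) }
  have hθ : ∀ f, θ (Cc.map J.proj f) = q f := fun f => hker _ _ (hs _)
  obtain ⟨Θ, hΘ⟩ := μ.exists_lift θ
    (fun f g => by
      obtain ⟨f, rfl⟩ := hsurj f
      obtain ⟨g, rfl⟩ := hsurj g
      rw [← map_convCc, hθ, hθ, hθ, hqa, hqa, hqa, toFull_convCc, map_mul])
    (fun f => by
      obtain ⟨f, rfl⟩ := hsurj f
      have h1 : 𝒢.adj (Cc.map J.proj f) = Cc.map J.proj (𝒢.adj f) :=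
        Subtype.ext (funext fun γ => (map_star J.proj _).symm)
      rw [h1, hθ, hθ, hqa, hqa, toFull_adj, map_star])
    (fun f => by
      obtain ⟨f, rfl⟩ := hsurj f
      rw [hθ]
      exact hq f)
  refine ⟨Θ, fun y => μ.denseRange_toFull.induction_on (p := fun y => Θ (π y) = ψ y) y
    (isClosed_eq ((fullCStar_continuous_starAlgHom Θ).comp (fullCStar_continuous_starAlgHom π))
      (fullCStar_continuous_starAlgHom ψ)) fun f => ?_⟩
  rw [hπ, hΘ, hθ, hqa]

/-- The quotient map by the image of `ι` factors through `π`, so it vanishes on the kernel of `π`.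
-/
lemma exact_of_map_incl_of_map_proj {π : μ.FullCStar B →⋆ₙₐ[ℂ] μ.FullCStar J.Quot}
    (hι : ∀ g, ι (μ.toFull g) = μ.toFull (Cc.map J.incl g))
    (hπ : ∀ f, π (μ.toFull f) = μ.toFull (Cc.map J.proj f)) : Function.Exact ι π := by
  intro y
  constructor
  · intro hy
    obtain ⟨Θ, hΘ⟩ := exists_comp_eq_of_map_incl_eq_zero hπ (rangeIdeal ι hι).proj fun g =>
      (ClosedIdeal.proj_eq_zero_iff _ _).2 ⟨μ.toFull g, hι g⟩
    have h := hΘ y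
    rw [hy, map_zero] at h
    exact (ClosedIdeal.proj_eq_zero_iff _ _).1 h.symm
  · rintro ⟨x, rfl⟩
    refine μ.denseRange_toFull.induction_on (p := fun x => π (ι x) = 0) x
      (isClosed_eq ((fullCStar_continuous_starAlgHom π).comp (fullCStar_continuous_starAlgHom ι))
        continuous_const) fun g => ?_
    rw [hι, hπ]
    have : Cc.map J.proj (Cc.map J.incl g) = 0 := Subtype.ext (funext fun γ => by
      change (ClosedIdeal.Quot.mk (g γ : B) : J.Quot) = ClosedIdeal.Quot.mk 0
      rw [ClosedIdeal.Quot.mk_eq, sub_zero]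
      exact (g γ).2)
    rw [this, map_zero]

lemma surjective_of_map_proj {π : μ.FullCStar B →⋆ₙₐ[ℂ] μ.FullCStar J.Quot}
    (hπ : ∀ f, π (μ.toFull f) = μ.toFull (Cc.map J.proj f)) : Function.Surjective π := by
  have : LocallyCompactSpace G := ChartedSpace.locallyCompactSpace EG G
  refine ClosedIdeal.surjective_of_denseRange π (μ.denseRange_toFull.mono ?_)
  rintro _ ⟨f, rfl⟩
  obtain ⟨f, rfl⟩ := Cc.map_proj_surjective (X := G) J f
  exact ⟨μ.toFull f, hπ f⟩

end HaarSystem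

end LieGroupoid

end Groupoid

theorem mainTheorem4
    {EG EM : Type*} [NormedAddCommGroup EG] [NormedSpace ℝ EG] [FiniteDimensional ℝ EG]
    [NormedAddCommGroup EM] [NormedSpace ℝ EM] [FiniteDimensional ℝ EM]
    {G M : Type*} [TopologicalSpace G] [ChartedSpace EG G] [IsManifold 𝓘(ℝ, EG) ∞ G]
    [TopologicalSpace M] [T2Space M] [ChartedSpace EM M] [IsManifold 𝓘(ℝ, EM) ∞ M]
    [CompactSpace M]
    (𝒢 : LieGroupoid EG EM G M) (μ : 𝒢.HaarSystem)
    {B : Type*} [NonUnitalCStarAlgebra B] (J : ClosedIdeal B) :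
    ∃ (ι : μ.FullCStar J.toStarSubalgebra →⋆ₙₐ[ℂ] μ.FullCStar B)
      (π : μ.FullCStar B →⋆ₙₐ[ℂ] μ.FullCStar J.Quot),
      (∀ f : Cc G J.toStarSubalgebra, ι (μ.toFull f) = μ.toFull (Cc.map J.incl f)) ∧
      (∀ f : Cc G B, π (μ.toFull f) = μ.toFull (Cc.map J.proj f)) ∧
      Function.Injective ι ∧ Function.Exact ι π ∧ Function.Surjective π := by
  obtain ⟨ι, hι⟩ := μ.exists_fullCStar_map J.incl
  obtain ⟨π, hπ⟩ := μ.exists_fullCStar_map J.proj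
  exact ⟨ι, π, hι, hπ, LieGroupoid.HaarSystem.injective_of_map_incl hι,
    LieGroupoid.HaarSystem.exact_of_map_incl_of_map_proj hι hπ,
    LieGroupoid.HaarSystem.surjective_of_map_proj hπ⟩
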